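/- Let $d\ge 1$, $\alpha>0$, and let $p_t(x)=(2\pi t)^{-d/2}e^{-|x|^2/(2t)}$, $x\in\mathbb R^d$, $t>0$. Let $f$ be one of the following kernels on $\mathbb R^d$: - Riesz kernel of order $\alpha<d$: $f(x)=\dfrac{\Gamma((d-\alpha)/2)}{2^{\alpha}\pi^{d/2}\Gamma(\alpha/2)}\,|x|^{-d+\alpha}$; - Bessel kernel of order $\alpha<d$: $f(x)=(4\pi)^{\alpha/2}\Gamma(\alpha/2)\displaystyle\int_0^\infty w^{(\alpha-d)/2-1}e^{-w}e^{-|x|^2/(4w)}\,dw$; - heat kernel of order $\alpha$: $f(x)=(2\pi\alpha)^{-d/2}e^{-|x|^2/(2\alpha)}$; - Poisson kernel of order $\alpha$: $f(x)=\pi^{-(d+1)/2}\Gamma((d+1)/2)\,\alpha\,(|x|^2+\alpha^2)^{-(d+1)/2}$. For $u,v>0$ and $y,z\in\mathbb R^d$ put $J_f(u,v,y,z)=\int_{\mathbb R^d}\int_{\mathbb R^d}p_u(x-y)\,p_v(x'-z)\,f(x-x')\,dx\,dx'$, and for $x\ge 0$, $a>0$ put $\Phi(x,a)=\sum_{n\ge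 0}x^n/(n!)^a$. Let $B^1,B^2$ be independent $d$-dimensional standard Brownian motions on a probability space $(\Omega,\mathcal F,P)$, let $t>0$, and let $\eta:[0,t]^2\to\mathbb R_+$ be a measurable function with $$\|\eta\|_{1,t}:=\max\Big(\sup_{s\in[0,t]}\int_0^t\eta(r,s)\,dr,\ \sup_{r\in[0,t]}\int_0^t\eta(r,s)\,ds\Big)<\infty .$$ For $\varepsilon>0$ let $$L_{t,\varepsilon}(\eta)=\int_0^t\int_0^t\int_{\mathbb R^d}\eta(r,s)\,p_\varepsilon(B^1_r-B^2_s-y)\,f(y)\,dy\,dr\,ds .$$ (i) Suppose that $f$ is the Riesz kernel or the Bessel kernel of order $\alpha<d$, and that $d<2+\alpha$. Then there is a constant $D_{\alpha,d}>0$ with $J_f(u,v,y,z)\le D_{\alpha,d}(u+v)^{-(d-\alpha)/2}$ for all $u,v>0$ and $y,z\in\mathbb R^d$. There is a random variable $L_t(\eta)$ such that $L_{t,\varepsilon}(\eta)\to L_t(\eta)$ in $L^p(\Omega)$ as $\varepsilon\downarrow 0$, for all $2\le p<\infty$. Moreover, for every such $D_{\alpha,d}$, $$\sup_{\varepsilon>0}E\big[\exp(\lambda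 L_{t,\varepsilon}(\eta))\big]\le C^*_{\alpha,d}\,\Phi\Big(\lambda D(t),\,1-\frac{d-\alpha}{2}\Big)\quad\text{for all }\lambda>0,$$ where $C^*_{\alpha,d}>0$ is a constant depending only on $\alpha$ and $d$, and $$D(t)=D_{\alpha,d}\,2^{-(d-\alpha)/2}\,\|\eta\|_{1,t}\,\Gamma\Big(1-\frac{d-\alpha}{2}\Big)\Big(1-\frac{d-\alpha}{2}\Big)^{-[1-(d-\alpha)/2]}\,t^{\,1-(d-\alpha)/2}.$$ (ii) Suppose that $f$ is the heat kernel or the Poisson kernel of order $\alpha$. Then there is a constant $C_{\alpha,d}>0$ with $J_f(u,v,y,z)\le C_{\alpha,d}$ for all $u,v>0$ and $y,z\in\mathbb R^d$. There is a random variable $L_t(\eta)$ such that $L_{t,\varepsilon}(\eta)\to L_t(\eta)$ in $L^p(\Omega)$ as $\varepsilon\downarrow 0$, for all $2\le p<\infty$. Moreover, for every such $C_{\alpha,d}$, $$\sup_{\varepsilon>0}E\big[\exp(\lambda L_{t,\varepsilon}(\eta))\big]\le \exp(\lambda C(t))\quad\text{for all }\lambda>0,\qquad C(t)=C_{\alpha,d}\,\|\eta\|_{1,t}\,t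 .$$ -/

import Mathlib

open MeasureTheory ProbabilityTheory Filter Topology
open scoped NNReal ENNReal

noncomputable section

namespace LocalTime

/-- The Euclidean space `ℝ^d`. -/
abbrev Space (d : ℕ) : Type := EuclideanSpace ℝ (Fin d)

/-- The Gaussian density `p_t(x) = (2πt)^{-d/2} exp(-|x|²/(2t))` on `ℝ^d`. As a covariance kernel,
`x ↦ p_α(x)` is the heat kernel of order `α`. -/
def heatKernel (d : ℕ) (t : ℝ) (x : Space d) : ℝ :=
  (2 * Real.pi * t) ^ (-(d : ℝ) / 2) * Real.exp (-‖x‖ ^ 2 / (2 * t))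

/-- The Riesz kernel of order `α`. -/
def rieszKernel (d : ℕ) (α : ℝ) (x : Space d) : ℝ :=
  Real.Gamma (((d : ℝ) - α) / 2) * (2 : ℝ) ^ (-α) * Real.pi ^ (-(d : ℝ) / 2) / Real.Gamma (α / 2)
    * ‖x‖ ^ (-(d : ℝ) + α)

/-- The Bessel kernel of order `α`, with normalising factor `(4π)^{α/2} Γ(α/2)`. -/
def besselKernel (d : ℕ) (α : ℝ) (x : Space d) : ℝ :=
  (4 * Real.pi) ^ (α / 2) * Real.Gamma (α / 2) *
    ∫ w in Set.Ioi (0 : ℝ),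
      w ^ ((α - (d : ℝ)) / 2 - 1) * Real.exp (-w) * Real.exp (-‖x‖ ^ 2 / (4 * w))

/-- The Poisson kernel of order `α`. -/
def poissonKernel (d : ℕ) (α : ℝ) (x : Space d) : ℝ :=
  Real.pi ^ (-((d : ℝ) + 1) / 2) * Real.Gamma (((d : ℝ) + 1) / 2) * α
    * (‖x‖ ^ 2 + α ^ 2) ^ (-((d : ℝ) + 1) / 2)

/-- `J_f(u,v,y,z) = ∫∫ p_u(x-y) p_v(x'-z) f(x-x') dx dx'`, for a non-negative kernel `f`,
with values in `[0,∞]`. -/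
def kernelEnergy {d : ℕ} (f : Space d → ℝ) (u v : ℝ) (y z : Space d) : ℝ≥0∞ :=
  ∫⁻ x : Space d, ∫⁻ x' : Space d,
    ENNReal.ofReal (heatKernel d u (x - y) * heatKernel d v (x' - z) * f (x - x'))

/-- `D` is a positive constant with `J_f(u,v,y,z) ≤ D (u+v)^{-(d-α)/2}` for all `u, v > 0` and
all `y, z`. -/
def IsDecayConst {d : ℕ} (f : Space d → ℝ) (α D : ℝ) : Prop :=
  0 < D ∧ ∀ u v : ℝ, 0 < u → 0 < v → ∀ y z : Space d,
    kernelEnergy f u v y z ≤ ENNReal.ofReal (D * (u + v) ^ (-((d : ℝ) - α) / 2))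

/-- `C` is a positive constant with `J_f(u,v,y,z) ≤ C` for all `u, v > 0` and all `y, z`. -/
def IsBoundConst {d : ℕ} (f : Space d → ℝ) (C : ℝ) : Prop :=
  0 < C ∧ ∀ u v : ℝ, 0 < u → 0 < v → ∀ y z : Space d,
    kernelEnergy f u v y z ≤ ENNReal.ofReal C

/-- `Φ(x,a) = ∑_{n ≥ 0} x^n / (n!)^a`. -/
def Phi (x a : ℝ) : ℝ :=
  ∑' n : ℕ, x ^ n / (n.factorial : ℝ) ^ a

/-- A `d`-dimensional standard Brownian motion: its coordinates are independent real standard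
Brownian motions. -/
structure IsBrownian {Ω : Type*} [MeasurableSpace Ω] {d : ℕ} (B : ℝ≥0 → Ω → Space d)
    (P : Measure Ω) : Prop where
  measurable : ∀ t, Measurable (B t)
  coord : ∀ i, IsBrownianReal (fun t ω => B t ω i) P
  indep : iIndepFun (fun (i : Fin d) (ω : Ω) (t : ℝ≥0) => B t ω i) P

/-- The norm `‖η‖_{1,t}` of a weight on `[0,t]²`, the larger of `sup_s ∫_0^t η(r,s) dr` and
`sup_r ∫_0^t η(r,s) ds`, with values in `[0,∞]`. -/
def weightNorm (η : ℝ → ℝ → ℝ≥0) (t : ℝ) : ℝ≥0∞ :=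
  max (⨆ s ∈ Set.Icc 0 t, ∫⁻ r in Set.Icc 0 t, (η r s : ℝ≥0∞))
    (⨆ r ∈ Set.Icc 0 t, ∫⁻ s in Set.Icc 0 t, (η r s : ℝ≥0∞))

/-- `L_{t,ε}(η) = ∫_0^t ∫_0^t ∫_{ℝ^d} η(r,s) p_ε(b₁(r) - b₂(s) - y) f(y) dy dr ds`, for two
paths `b₁, b₂`. -/
def approxLocalTime {d : ℕ} (f : Space d → ℝ) (η : ℝ → ℝ → ℝ≥0) (t ε : ℝ)
    (b₁ b₂ : ℝ≥0 → Space d) : ℝ :=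
  ∫ s in (0 : ℝ)..t, ∫ r in (0 : ℝ)..t, ∫ y : Space d,
    (η r s : ℝ) * heatKernel d ε (b₁ r.toNNReal - b₂ s.toNNReal - y) * f y

/-- The random variables `X ε`, `ε > 0`, converge as `ε ↓ 0`, in `L^p` for every `2 ≤ p < ∞`, to
one and the same random variable. -/
def ConvergesInLp {Ω : Type*} [MeasurableSpace Ω] (X : ℝ → Ω → ℝ) (P : Measure Ω) : Prop :=
  ∃ L : Ω → ℝ, ∀ p : ℝ≥0∞, 2 ≤ p → p ≠ ∞ →
    (∀ ε, 0 < ε → MemLp (X ε) p P) ∧ MemLp L p P ∧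
      Tendsto (fun ε => eLpNorm (X ε - L) p P) (𝓝[>] 0) (𝓝 0)

/-- `D(t) = D 2^{-(d-α)/2} N Γ(1-(d-α)/2) (1-(d-α)/2)^{-[1-(d-α)/2]} t^{1-(d-α)/2}`, where `N`
stands for `‖η‖_{1,t}`. -/
def growthConst (d : ℕ) (α D N t : ℝ) : ℝ :=
  D * (2 : ℝ) ^ (-((d : ℝ) - α) / 2) * N * Real.Gamma (1 - ((d : ℝ) - α) / 2)
    * (1 - ((d : ℝ) - α) / 2) ^ (-(1 - ((d : ℝ) - α) / 2)) * t ^ (1 - ((d : ℝ) - α) / 2)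

end LocalTime

end

/-!
Each of the four kernels is a mixture `f = ∫ p_w μ(dw)` of Gaussian densities
(`IsGaussMixture`, with `μ` explicit in every case), so that smoothing by `p_ε` merely shifts the
variances: `p_ε * f = F_ε` with `F_ε = ∫ p_{w+ε} μ(dw)` (`gaussMixture`), and
`J_f(u,v,y,z) = F_{u+v}(y-z)`. The bounds on `J_f` are therefore exactly the bounds
`F_w ≤ D w^{κ-1}`, with `κ = 1 - (d-α)/2` for the Riesz and Bessel kernels and `κ = 1` for the heat
and Poisson kernels. Moreover `L_{t,ε}(η)` is `∫ F_ε(B¹_r - B²_s) ν(dr,ds)`, where `ν` has density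
`η` (`mutualLocalTime`).

Fourier inversion turns the expectation of `∏ F_{ε_i}(X_i)`, for a random vector `X`, into an
integral of the characteristic function of `X` against positive weights which decrease in the `ε_i`.
For `X_i = B¹_{r_i} - B²_{s_i}` the characteristic function is positive, which has two consequences.

* The mixed moments of the `L_{t,ε}(η)` increase as the `ε`'s decrease
  (`lintegral_prod_mutualLocalTime_antitone`). With uniformly bounded moments this yields the
  Cauchy property in `L²`: `‖L_ε - L_δ‖² ≤ ‖L_δ‖² - ‖L_ε‖²` for `δ ≤ ε`; interpolation with higher
  moments then gives convergence in every `L^p` (`convergesInLp_of_antitone`).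
* That characteristic function is the product `φ₁ φ₂` of those of `B¹` and `B²`, whence
  `φ₁ φ₂ ≤ (φ₁² + φ₂²)/2`, and `φ_i²` is the characteristic function of `√2 Bⁱ`. So the `n`-th
  moment of `L_{t,ε}(η)` is at most that of `∫ F_ε(√2 B_r) ν(dr,ds)` for one Brownian motion `B`,
  and hence at most `‖η‖_{1,t}^n` times the `n`-th moment of `∫_0^t F_ε(√2 B_r) dr`. Conditioning
  on the past and iterating Beta integrals bounds the latter by
  `n! (D 2^{κ-1} Γ(κ) t^κ)^n / Γ(nκ+1)` (`IsBrownian.lintegral_occupation_pow_le`).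

A Stirling-type comparison, `(n!)^κ κ^{κn} ≤ C Γ(nκ+1)` (`exists_factorial_rpow_le_Gamma`), turns
the resulting exponential series into `Φ`. In the bounded case, `L_{t,ε}(η) ≤ C ‖η‖_{1,t} t` holds
pathwise.
-/

namespace LocalTime

open scoped RealInnerProductSpace

/-! ### Products of Gaussian densities and characteristic functions -/

section Pi

/-- Tonelli's theorem for a product of functions of separate variables. -/
theorem lintegral_pi_prod {E : Type*} [MeasurableSpace E] (μ : Measure E) [SigmaFinite μ] {n : ℕ}
    (f : Fin n → E → ℝ≥0∞) (hf : ∀ i, Measurable (f i)) :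
    ∫⁻ x, ∏ i, f i (x i) ∂(Measure.pi fun _ : Fin n => μ) = ∏ i, ∫⁻ y, f i y ∂μ := by
  induction n with
  | zero => simp
  | succ n ih =>
    have hm := (measurePreserving_piFinSuccAbove (fun _ : Fin (n + 1) => μ) 0).symm
    have hg : Measurable fun y : Fin n → E => ∏ i, f (Fin.succ i) (y i) :=
      Finset.measurable_prod _ fun i _ => (hf _).comp (measurable_pi_apply i)
    have hp (p : E × (Fin n → E)) :
        ∏ i, f i ((MeasurableEquiv.piFinSuccAbove (fun _ => E) 0).symm p i) =
          f 0 p.1 * ∏ i, f (Fin.succ i) (p.2 i) := by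
      rw [Fin.prod_univ_succ]
      rfl
    rw [← hm.lintegral_comp_emb (MeasurableEquiv.measurableEmbedding _), lintegral_congr hp,
      lintegral_prod_mul (hf 0).aemeasurable hg.aemeasurable, Fin.prod_univ_succ,
      ih _ fun i => hf (Fin.succ i)]

end Pi

theorem heatKernel_nonneg (d : ℕ) {t : ℝ} (ht : 0 ≤ t) (x : Space d) : 0 ≤ heatKernel d t x := by
  unfold heatKernel; positivity

theorem measurable_heatKernel (d : ℕ) :
    Measurable fun q : ℝ × Space d => heatKernel d q.1 q.2 := by
  unfold heatKernel; fun_prop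

@[fun_prop]
theorem _root_.Measurable.heatKernel {α : Type*} [MeasurableSpace α] {d : ℕ} {g : α → ℝ}
    {f : α → Space d} (hg : Measurable g) (hf : Measurable f) :
    Measurable fun a => heatKernel d (g a) (f a) :=
  (measurable_heatKernel d).comp (hg.prodMk hf)

/-- The weight `(2π)^{-d} exp(-a|ξ|²/2)`, the Fourier transform of the Gaussian density `p_a`. -/
noncomputable def fourierWeight (d : ℕ) (a : ℝ) (ξ : Space d) : ℝ :=
  (2 * Real.pi) ^ (-(d : ℝ)) * Real.exp (-(a / 2) * ‖ξ‖ ^ 2)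

theorem fourierWeight_nonneg (d : ℕ) (a : ℝ) (ξ : Space d) : 0 ≤ fourierWeight d a ξ := by
  unfold fourierWeight; positivity

theorem continuous_fourierWeight (d : ℕ) (a : ℝ) : Continuous (fourierWeight d a) := by
  unfold fourierWeight; fun_prop

theorem fourierWeight_antitone (d : ℕ) {a b : ℝ} (h : a ≤ b) (ξ : Space d) :
    fourierWeight d b ξ ≤ fourierWeight d a ξ := by
  unfold fourierWeight
  gcongr

theorem integrable_fourierWeight (d : ℕ) {a : ℝ} (ha : 0 < a) :
    Integrable (fourierWeight d a) := by
  have h := (GaussianFourier.integrable_cexp_neg_mul_sq_norm_add (V := Space d)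
    (b := ((a / 2 : ℝ) : ℂ)) (by simpa using ha) 0 0).norm
  refine (h.congr (Eventually.of_forall fun ξ => ?_)).const_mul ((2 * Real.pi) ^ (-(d : ℝ)))
  simp only [Complex.norm_exp, inner_zero_left, Complex.ofReal_zero, mul_zero, add_zero]
  congr 1
  rw [← Complex.ofReal_neg, ← Complex.ofReal_pow, ← Complex.ofReal_mul, Complex.ofReal_re]

/-- Fourier inversion for the Gaussian density. -/
theorem heatKernel_eq_integral (d : ℕ) {a : ℝ} (ha : 0 < a) (x : Space d) :
    (heatKernel d a x : ℂ) =
      ∫ ξ : Space d, (fourierWeight d a ξ : ℂ) * Complex.exp ((⟪ξ, x⟫ : ℝ) * Complex.I) := by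
  have h := GaussianFourier.integral_cexp_neg_mul_sq_norm_add (V := Space d)
    (b := ((a / 2 : ℝ) : ℂ)) (by simpa using ha) Complex.I x
  have e : ∀ ξ : Space d, (fourierWeight d a ξ : ℂ) * Complex.exp ((⟪ξ, x⟫ : ℝ) * Complex.I)
      = ((2 * Real.pi) ^ (-(d : ℝ)) : ℝ) *
        Complex.exp (-((a / 2 : ℝ) : ℂ) * ‖ξ‖ ^ 2 + Complex.I * (⟪x, ξ⟫ : ℝ)) := by
    intro ξ
    rw [fourierWeight, Complex.exp_add, real_inner_comm, mul_comm Complex.I]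
    push_cast
    ring
  simp_rw [e]
  rw [integral_const_mul, h]
  have h1 : ((Real.pi : ℂ) / ((a / 2 : ℝ) : ℂ)) ^ ((Module.finrank ℝ (Space d) : ℂ) / 2)
      = (((2 * Real.pi / a) ^ ((d : ℝ) / 2) : ℝ) : ℂ) := by
    rw [finrank_euclideanSpace_fin, Complex.ofReal_cpow (by positivity)]
    push_cast
    congr 1
    field_simp
  have h2 : Complex.exp (Complex.I ^ 2 * (‖x‖ : ℂ) ^ 2 / (4 * ((a / 2 : ℝ) : ℂ)))
      = ((Real.exp (-‖x‖ ^ 2 / (2 * a)) : ℝ) : ℂ) := by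
    rw [Complex.ofReal_exp, Complex.I_sq]
    push_cast
    congr 1
    field_simp
    ring
  rw [h1, h2, ← Complex.ofReal_mul, ← Complex.ofReal_mul, heatKernel]
  congr 1
  rw [← mul_assoc]
  congr 1
  rw [Real.div_rpow (by positivity) ha.le, Real.mul_rpow (by positivity) ha.le, neg_div,
    Real.rpow_neg ha.le, ← mul_div_assoc, ← Real.rpow_add (by positivity)]
  rw [show -(d : ℝ) + (d : ℝ) / 2 = -((d : ℝ) / 2) by ring]
  rfl

/-- The characteristic function of the random vector `(X_1, …, X_n)`. -/
noncomputable def jointCharFun {Ω : Type*} [MeasurableSpace Ω] (P : Measure Ω) {d n : ℕ}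
    (X : Fin n → Ω → Space d) (ξ : Fin n → Space d) : ℂ :=
  ∫ ω, Complex.exp ((∑ i, ⟪ξ i, X i ω⟫ : ℝ) * Complex.I) ∂P

section Fourier

variable {Ω : Type*} [MeasurableSpace Ω] (P : Measure Ω) [IsProbabilityMeasure P] {d n : ℕ}
  {X : Fin n → Ω → Space d}

theorem integrable_prod_fourierWeight (hX : ∀ i, Measurable (X i)) {a : Fin n → ℝ}
    (ha : ∀ i, 0 < a i) :
    Integrable (fun q : Ω × (Fin n → Space d) =>
      ((∏ i, fourierWeight d (a i) (q.2 i) : ℝ) : ℂ) *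
        Complex.exp ((∑ i, ⟪q.2 i, X i q.1⟫ : ℝ) * Complex.I)) (P.prod volume) := by
  have hWi : Integrable fun ξ : Fin n → Space d => ∏ i, fourierWeight d (a i) (ξ i) :=
    Integrable.fintype_prod (f := fun i ξ => fourierWeight d (a i) ξ)
      fun i => integrable_fourierWeight d (ha i)
  have hWc : Continuous fun ξ : Fin n → Space d => ∏ i, fourierWeight d (a i) (ξ i) :=
    continuous_finsetProd _ fun i _ => (continuous_fourierWeight d (a i)).comp (continuous_apply i)
  have hme : Measurable fun q : Ω × (Fin n → Space d) => ∑ i, (⟪q.2 i, X i q.1⟫ : ℝ) := by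
    refine Finset.measurable_sum _ fun i _ => ?_
    exact Measurable.inner ((measurable_pi_apply i).comp measurable_snd)
      ((hX i).comp measurable_fst)
  refine Integrable.mono' (hWi.comp_snd P) ?_ (Eventually.of_forall fun q => ?_)
  · refine Measurable.aestronglyMeasurable ?_
    refine (Complex.measurable_ofReal.comp (hWc.measurable.comp measurable_snd)).mul ?_
    exact Complex.measurable_exp.comp ((Complex.measurable_ofReal.comp hme).mul_const _)
  · rw [norm_mul, Complex.norm_exp_ofReal_mul_I, mul_one, Complex.norm_real,
      Real.norm_of_nonneg (Finset.prod_nonneg fun i _ => fourierWeight_nonneg _ _ _)]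

theorem prod_heatKernel_eq_integral {a : Fin n → ℝ} (ha : ∀ i, 0 < a i) (x : Fin n → Space d) :
    ((∏ i, heatKernel d (a i) (x i) : ℝ) : ℂ) = ∫ ξ : Fin n → Space d,
      ((∏ i, fourierWeight d (a i) (ξ i) : ℝ) : ℂ) *
        Complex.exp ((∑ i, ⟪ξ i, x i⟫ : ℝ) * Complex.I) := by
  rw [Complex.ofReal_prod, Finset.prod_congr rfl fun i _ => heatKernel_eq_integral d (ha i) (x i),
    ← integral_fintype_prod_volume_eq_prod (𝕜 := ℂ)
      (fun i (ξ : Space d) => (fourierWeight d (a i) ξ : ℂ) *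
        Complex.exp ((⟪ξ, x i⟫ : ℝ) * Complex.I))]
  congr 1
  ext ξ
  rw [Finset.prod_mul_distrib, ← Complex.exp_sum, ← Finset.sum_mul]
  push_cast
  rfl

/-- Parseval's identity for the expectation of a product of Gaussian densities. -/
theorem integral_prod_heatKernel (hX : ∀ i, Measurable (X i)) {a : Fin n → ℝ}
    (ha : ∀ i, 0 < a i) :
    ((∫ ω, ∏ i, heatKernel d (a i) (X i ω) ∂P : ℝ) : ℂ) =
      ∫ ξ : Fin n → Space d,
        ((∏ i, fourierWeight d (a i) (ξ i) : ℝ) : ℂ) * jointCharFun P X ξ := by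
  rw [← integral_complex_ofReal]
  simp_rw [prod_heatKernel_eq_integral ha]
  rw [integral_integral_swap (integrable_prod_fourierWeight P hX ha)]
  simp_rw [integral_const_mul, jointCharFun]

theorem integrable_prod_heatKernel (hX : ∀ i, Measurable (X i)) {a : Fin n → ℝ}
    (ha : ∀ i, 0 < a i) : Integrable (fun ω => ∏ i, heatKernel d (a i) (X i ω)) P := by
  refine (integrable_prod_fourierWeight P hX ha).integral_prod_left.re.congr
    (Eventually.of_forall fun ω => ?_)
  simp only [← prod_heatKernel_eq_integral ha fun i => X i ω]
  exact Complex.ofReal_re _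

theorem lintegral_prod_heatKernel_eq_ofReal (hX : ∀ i, Measurable (X i)) {a : Fin n → ℝ}
    (ha : ∀ i, 0 < a i) :
    ∫⁻ ω, ∏ i, ENNReal.ofReal (heatKernel d (a i) (X i ω)) ∂P =
      ENNReal.ofReal (∫ ω, ∏ i, heatKernel d (a i) (X i ω) ∂P) := by
  rw [ofReal_integral_eq_lintegral_ofReal (integrable_prod_heatKernel P hX ha)
    (Eventually.of_forall fun ω => Finset.prod_nonneg fun i _ => heatKernel_nonneg d (ha i).le _)]
  exact lintegral_congr fun ω =>
    (ENNReal.ofReal_prod_of_nonneg fun i _ => heatKernel_nonneg d (ha i).le _).symm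

/-- If the characteristic function is non-negative, the expectation of a product of Gaussian
densities is the integral of this function against positive weights, which decrease in the
variances. -/
theorem lintegral_prod_heatKernel (hX : ∀ i, Measurable (X i))
    (hpos : ∀ ξ, 0 ≤ (jointCharFun P X ξ).re) {a : Fin n → ℝ} (ha : ∀ i, 0 < a i) :
    ∫⁻ ω, ∏ i, ENNReal.ofReal (heatKernel d (a i) (X i ω)) ∂P =
      ∫⁻ ξ : Fin n → Space d,
        ENNReal.ofReal ((∏ i, fourierWeight d (a i) (ξ i)) * (jointCharFun P X ξ).re) := by
  have hint : Integrable fun ξ : Fin n → Space d =>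
      ((∏ i, fourierWeight d (a i) (ξ i) : ℝ) : ℂ) * jointCharFun P X ξ := by
    have := (integrable_prod_fourierWeight P hX ha).integral_prod_right
    simpa only [integral_const_mul, jointCharFun] using this
  have hre : ∀ ξ : Fin n → Space d,
      (((∏ i, fourierWeight d (a i) (ξ i) : ℝ) : ℂ) * jointCharFun P X ξ).re =
        (∏ i, fourierWeight d (a i) (ξ i)) * (jointCharFun P X ξ).re :=
    fun ξ => Complex.re_ofReal_mul _ _
  have hR : ∫ ω, ∏ i, heatKernel d (a i) (X i ω) ∂P =
      ∫ ξ : Fin n → Space d, (∏ i, fourierWeight d (a i) (ξ i)) * (jointCharFun P X ξ).re := by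
    have h := congrArg Complex.re (integral_prod_heatKernel P hX ha)
    rw [Complex.ofReal_re] at h
    rw [h]
    exact (integral_re hint).symm.trans (integral_congr_ae (Eventually.of_forall hre))
  rw [lintegral_prod_heatKernel_eq_ofReal P hX ha, hR, ofReal_integral_eq_lintegral_ofReal]
  · exact hint.re.congr (Eventually.of_forall fun ξ => hre ξ)
  · exact Eventually.of_forall fun ξ =>
      mul_nonneg (Finset.prod_nonneg fun i _ => fourierWeight_nonneg _ _ _) (hpos ξ)

/-- Averaging a Gaussian density over a shift by a centred Gaussian vector of covariance `τ I`
adds `τ` to its variance. -/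
theorem lintegral_heatKernel_add {N : Ω → Space d} (hN : Measurable N) {τ : ℝ} (hτ : 0 ≤ τ)
    (hchar : ∀ ξ : Space d, ∫ ω, Complex.exp ((⟪ξ, N ω⟫ : ℝ) * Complex.I) ∂P =
      Real.exp (-(τ / 2) * ‖ξ‖ ^ 2)) {a : ℝ} (ha : 0 < a) (x : Space d) :
    ∫⁻ ω, ENNReal.ofReal (heatKernel d a (x + N ω)) ∂P =
      ENNReal.ofReal (heatKernel d (a + τ) x) := by
  have hX : ∀ _ : Fin 1, Measurable fun ω => x + N ω := fun _ => hN.const_add x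
  have h1 := lintegral_prod_heatKernel_eq_ofReal P hX (a := fun _ => a) fun _ => ha
  have h2 := integral_prod_heatKernel P hX (a := fun _ => a) fun _ => ha
  have h3 := prod_heatKernel_eq_integral (d := d) (n := 1) (a := fun _ => a + τ)
    (fun _ => by positivity) (fun _ => x)
  simp only [Finset.univ_unique, Fin.default_eq_zero, Fin.isValue, Finset.prod_singleton]
    at h1 h2 h3
  rw [h1]
  congr 1
  rw [← Complex.ofReal_inj, h2, h3]
  congr 1
  ext ξ
  have hj : jointCharFun P (fun (_ : Fin 1) ω => x + N ω) ξ =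
      Complex.exp ((⟪ξ 0, x⟫ : ℝ) * Complex.I) * Real.exp (-(τ / 2) * ‖ξ 0‖ ^ 2) := by
    rw [← hchar, ← integral_const_mul, jointCharFun]
    congr 1
    ext ω
    rw [← Complex.exp_add, Fin.sum_univ_one, inner_add_right]
    push_cast
    ring_nf
  have hw : fourierWeight d (a + τ) (ξ 0) =
      fourierWeight d a (ξ 0) * Real.exp (-(τ / 2) * ‖ξ 0‖ ^ 2) := by
    rw [fourierWeight, fourierWeight, mul_assoc, ← Real.exp_add]
    ring_nf
  rw [hj, hw, Finset.sum_singleton]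
  push_cast
  ring

end Fourier

/-- A Gaussian density is, up to a constant, also a Fourier weight. -/
theorem heatKernel_eq_mul_fourierWeight (d : ℕ) {w : ℝ} (hw : 0 < w) (y : Space d) :
    heatKernel d w y =
      (2 * Real.pi * w) ^ (-(d : ℝ) / 2) * (2 * Real.pi) ^ (d : ℝ) * fourierWeight d w⁻¹ y := by
  have h : (2 * Real.pi) ^ (d : ℝ) * (2 * Real.pi) ^ (-(d : ℝ)) = 1 := by
    rw [← Real.rpow_add (by positivity), add_neg_cancel, Real.rpow_zero]
  have h2 : -‖y‖ ^ 2 / (2 * w) = -(w⁻¹ / 2) * ‖y‖ ^ 2 := by field_simp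
  rw [heatKernel, fourierWeight, h2]
  linear_combination -(2 * Real.pi * w) ^ (-(d : ℝ) / 2) *
    Real.exp (-(w⁻¹ / 2) * ‖y‖ ^ 2) * h

/-- The characteristic function of the Gaussian density. -/
theorem integral_heatKernel_mul_exp (d : ℕ) {w : ℝ} (hw : 0 < w) (ξ : Space d) :
    ∫ y : Space d, (heatKernel d w y : ℂ) * Complex.exp ((⟪y, ξ⟫ : ℝ) * Complex.I) =
      Real.exp (-(w / 2) * ‖ξ‖ ^ 2) := by
  simp_rw [heatKernel_eq_mul_fourierWeight d hw, Complex.ofReal_mul _ (fourierWeight _ _ _),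
    mul_assoc (Complex.ofReal _) (Complex.ofReal _)]
  rw [integral_const_mul, ← heatKernel_eq_integral d (inv_pos.2 hw), ← Complex.ofReal_mul,
    heatKernel, ← mul_assoc]
  congr 1
  have : (2 * Real.pi * w) ^ (-(d : ℝ) / 2) * (2 * Real.pi) ^ (d : ℝ) *
      (2 * Real.pi * w⁻¹) ^ (-(d : ℝ) / 2) = 1 := by
    rw [mul_right_comm, ← Real.mul_rpow (by positivity) (by positivity),
      show 2 * Real.pi * w * (2 * Real.pi * w⁻¹) = (2 * Real.pi) ^ (2 : ℝ) by
        rw [Real.rpow_two]; field_simp,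
      ← Real.rpow_mul (by positivity), ← Real.rpow_add (by positivity)]
    ring_nf
    simp
  rw [this, one_mul]
  congr 1
  field_simp

theorem integrable_heatKernel (d : ℕ) {w : ℝ} (hw : 0 < w) : Integrable (heatKernel d w) := by
  refine ((integrable_fourierWeight d (inv_pos.2 hw)).const_mul
    ((2 * Real.pi * w) ^ (-(d : ℝ) / 2) * (2 * Real.pi) ^ (d : ℝ))).congr
    (Eventually.of_forall fun y => (heatKernel_eq_mul_fourierWeight d hw y).symm)

/-- The semigroup property of the Gaussian densities. -/
theorem lintegral_heatKernel_mul (d : ℕ) {u w : ℝ} (hu : 0 < u) (hw : 0 < w) (x : Space d) :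
    ∫⁻ y : Space d, ENNReal.ofReal (heatKernel d u (x - y)) * ENNReal.ofReal (heatKernel d w y) =
      ENNReal.ofReal (heatKernel d (u + w) x) := by
  have hm : Measurable (heatKernel d w) :=
    (measurable_heatKernel d).comp (measurable_const.prodMk measurable_id)
  have h0 := integral_heatKernel_mul_exp d hw 0
  simp only [inner_zero_right, Complex.ofReal_zero, zero_mul, Complex.exp_zero, mul_one, norm_zero,
    ne_eq, OfNat.ofNat_ne_zero, not_false_eq_true, zero_pow, mul_zero, Real.exp_zero] at h0
  rw [integral_complex_ofReal, Complex.ofReal_inj] at h0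
  -- `p_w` is the law of a Gaussian vector, and `p_u` is averaged over the shift by that vector
  let Q : Measure (Space d) := volume.withDensity fun y => ENNReal.ofReal (heatKernel d w y)
  have : IsProbabilityMeasure Q := by
    refine ⟨?_⟩
    rw [withDensity_apply _ MeasurableSet.univ, setLIntegral_univ,
      ← ofReal_integral_eq_lintegral_ofReal (integrable_heatKernel d hw)
        (Eventually.of_forall fun y => heatKernel_nonneg d hw.le y), h0, ENNReal.ofReal_one]
  have h := lintegral_heatKernel_add Q (N := fun y => -y) measurable_neg hw.le (fun ξ => ?_) hu x
  · rw [← h, lintegral_withDensity_eq_lintegral_mul _ hm.ennreal_ofReal]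
    · refine lintegral_congr fun y => ?_
      rw [Pi.mul_apply, mul_comm, sub_eq_add_neg]
    · exact ((measurable_heatKernel d).comp
        (measurable_const.prodMk (measurable_neg.const_add x))).ennreal_ofReal
  · rw [integral_withDensity_eq_integral_toReal_smul hm.ennreal_ofReal
      (Eventually.of_forall fun _ => ENNReal.ofReal_lt_top), ← norm_neg ξ,
      ← integral_heatKernel_mul_exp d hw]
    congr 1
    ext y
    rw [ENNReal.toReal_ofReal (heatKernel_nonneg d hw.le y), Complex.real_smul, inner_neg_right,
      inner_neg_right, real_inner_comm]

/-! ### Gaussian mixtures -/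

/-- The Gaussian mixture `x ↦ ∫ p_{w+ε}(x) μ(dw)`, with values in `[0,∞]`. It is the convolution of
`p_ε` with the mixture of the densities `p_w`. -/
noncomputable def gaussMixture (d : ℕ) (μ : Measure ℝ) (ε : ℝ) (x : Space d) : ℝ≥0∞ :=
  ∫⁻ w, ENNReal.ofReal (heatKernel d (w + ε) x) ∂μ

section Mixture

variable {d : ℕ} {μ : Measure ℝ} [SigmaFinite μ]

theorem measurable_gaussMixture (ε : ℝ) : Measurable (gaussMixture d μ ε) :=
  Measurable.lintegral_prod_right' (f := fun q : Space d × ℝ =>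
    ENNReal.ofReal (heatKernel d (q.2 + ε) q.1)) (by fun_prop)

@[fun_prop]
theorem _root_.Measurable.gaussMixture {α : Type*} [MeasurableSpace α] {ε : ℝ}
    {f : α → Space d} (hf : Measurable f) : Measurable fun a => gaussMixture d μ ε (f a) :=
  (measurable_gaussMixture ε).comp hf

variable {Ω : Type*} [MeasurableSpace Ω] (P : Measure Ω) [IsProbabilityMeasure P] {n : ℕ}

theorem lintegral_prod_gaussMixture {X : Fin n → Ω → Space d} (hX : ∀ i, Measurable (X i))
    (ε : Fin n → ℝ) :
    ∫⁻ ω, ∏ i, gaussMixture d μ (ε i) (X i ω) ∂P =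
      ∫⁻ w : Fin n → ℝ, ∫⁻ ω, ∏ i, ENNReal.ofReal (heatKernel d (w i + ε i) (X i ω)) ∂P
        ∂(Measure.pi fun _ => μ) := by
  have h : ∀ ω, ∏ i, gaussMixture d μ (ε i) (X i ω) = ∫⁻ w : Fin n → ℝ,
      ∏ i, ENNReal.ofReal (heatKernel d (w i + ε i) (X i ω)) ∂(Measure.pi fun _ => μ) := fun ω =>
    (lintegral_pi_prod μ (fun i w => ENNReal.ofReal (heatKernel d (w + ε i) (X i ω))) fun i => by
      fun_prop).symm
  rw [lintegral_congr h]
  refine lintegral_lintegral_swap (f := fun ω (w : Fin n → ℝ) =>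
    ∏ i, ENNReal.ofReal (heatKernel d (w i + ε i) (X i ω))) (Measurable.aemeasurable ?_)
  fun_prop

theorem ae_pi_pos (hμ : ∀ᵐ w ∂μ, 0 < w) :
    ∀ᵐ w ∂(Measure.pi fun _ : Fin n => μ), ∀ i, 0 < w i :=
  ae_all_iff.2 fun _ => Measure.tendsto_eval_ae_ae.eventually hμ

/-- Expectations of products of Gaussian mixtures decrease in the variances of the smoothing, when
the characteristic function of the arguments is non-negative. -/
theorem lintegral_prod_gaussMixture_antitone (hμ : ∀ᵐ w ∂μ, 0 < w) {X : Fin n → Ω → Space d}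
    (hX : ∀ i, Measurable (X i)) (hpos : ∀ ξ, 0 ≤ (jointCharFun P X ξ).re) {ε δ : Fin n → ℝ}
    (hε : ∀ i, 0 < ε i) (h : ∀ i, ε i ≤ δ i) :
    ∫⁻ ω, ∏ i, gaussMixture d μ (δ i) (X i ω) ∂P ≤
      ∫⁻ ω, ∏ i, gaussMixture d μ (ε i) (X i ω) ∂P := by
  rw [lintegral_prod_gaussMixture P hX, lintegral_prod_gaussMixture P hX]
  refine lintegral_mono_ae ?_
  filter_upwards [ae_pi_pos (n := n) hμ] with w hw
  rw [lintegral_prod_heatKernel P hX hpos fun i => add_pos (hw i) ((hε i).trans_le (h i)),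
    lintegral_prod_heatKernel P hX hpos fun i => add_pos (hw i) (hε i)]
  refine lintegral_mono fun ξ => ENNReal.ofReal_le_ofReal ?_
  refine mul_le_mul_of_nonneg_right (Finset.prod_le_prod (fun i _ => fourierWeight_nonneg _ _ _)
    fun i _ => fourierWeight_antitone _ (by gcongr; exact h i) _) (hpos ξ)

/-- An inequality between characteristic functions carries over to expectations of products of
Gaussian mixtures. -/
theorem lintegral_prod_gaussMixture_le (hμ : ∀ᵐ w ∂μ, 0 < w) {X Y Z : Fin n → Ω → Space d}
    (hX : ∀ i, Measurable (X i)) (hY : ∀ i, Measurable (Y i)) (hZ : ∀ i, Measurable (Z i))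
    (hXp : ∀ ξ, 0 ≤ (jointCharFun P X ξ).re) (hYp : ∀ ξ, 0 ≤ (jointCharFun P Y ξ).re)
    (hZp : ∀ ξ, 0 ≤ (jointCharFun P Z ξ).re)
    (hle : ∀ ξ, (jointCharFun P X ξ).re ≤
      2⁻¹ * ((jointCharFun P Y ξ).re + (jointCharFun P Z ξ).re))
    {ε : Fin n → ℝ} (hε : ∀ i, 0 < ε i) :
    ∫⁻ ω, ∏ i, gaussMixture d μ (ε i) (X i ω) ∂P ≤
      2⁻¹ * (∫⁻ ω, ∏ i, gaussMixture d μ (ε i) (Y i ω) ∂P +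
        ∫⁻ ω, ∏ i, gaussMixture d μ (ε i) (Z i ω) ∂P) := by
  rw [lintegral_prod_gaussMixture P hX, lintegral_prod_gaussMixture P hY,
    lintegral_prod_gaussMixture P hZ, ← lintegral_add_left, ← lintegral_const_mul' _ _ (by simp)]
  · refine lintegral_mono_ae ?_
    filter_upwards [ae_pi_pos (n := n) hμ] with w hw
    have hw' : ∀ i, 0 < w i + ε i := fun i => add_pos (hw i) (hε i)
    rw [lintegral_prod_heatKernel P hX hXp hw', lintegral_prod_heatKernel P hY hYp hw',
      lintegral_prod_heatKernel P hZ hZp hw', ← lintegral_add_left,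
      ← lintegral_const_mul' _ _ (by simp)]
    · refine lintegral_mono fun ξ => ?_
      have hW : 0 ≤ ∏ i, fourierWeight d (w i + ε i) (ξ i) :=
        Finset.prod_nonneg fun i _ => fourierWeight_nonneg _ _ _
      have h2 : (2⁻¹ : ℝ≥0∞) = ENNReal.ofReal 2⁻¹ := by
        rw [ENNReal.ofReal_inv_of_pos two_pos, ENNReal.ofReal_ofNat]
      rw [← ENNReal.ofReal_add (mul_nonneg hW (hYp ξ)) (mul_nonneg hW (hZp ξ)), h2,
        ← ENNReal.ofReal_mul (by norm_num)]
      refine ENNReal.ofReal_le_ofReal ?_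
      calc _ ≤ _ := mul_le_mul_of_nonneg_left (hle ξ) hW
        _ = _ := by ring
    · have hc : Measurable fun ξ : Fin n → Space d => ∏ i, fourierWeight d (w i + ε i) (ξ i) :=
        Finset.measurable_prod _ fun i _ =>
          (continuous_fourierWeight d _).measurable.comp (measurable_pi_apply i)
      refine (hc.mul (Complex.measurable_re.comp ?_)).ennreal_ofReal
      refine StronglyMeasurable.measurable (StronglyMeasurable.integral_prod_right' (f := fun q :
        (Fin n → Space d) × Ω => Complex.exp ((∑ i, ⟪q.1 i, Y i q.2⟫ : ℝ) * Complex.I)) ?_)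
      refine Measurable.stronglyMeasurable (Complex.measurable_exp.comp
        ((Complex.measurable_ofReal.comp (Finset.measurable_sum _ fun i _ => ?_)).mul_const _))
      exact Measurable.inner ((measurable_pi_apply i).comp measurable_fst)
        ((hY i).comp measurable_snd)
  · refine Measurable.lintegral_prod_right' (f := fun q : (Fin n → ℝ) × Ω =>
      ∏ i, ENNReal.ofReal (heatKernel d (q.1 i + ε i) (Y i q.2))) ?_
    fun_prop

/-- Averaging over a centred Gaussian shift of covariance `τ I` adds `τ` to the smoothing. -/
theorem lintegral_gaussMixture_add (hμ : ∀ᵐ w ∂μ, 0 < w) {N : Ω → Space d} (hN : Measurable N)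
    {τ : ℝ} (hτ : 0 ≤ τ)
    (hchar : ∀ ξ : Space d, ∫ ω, Complex.exp ((⟪ξ, N ω⟫ : ℝ) * Complex.I) ∂P =
      Real.exp (-(τ / 2) * ‖ξ‖ ^ 2)) {ε : ℝ} (hε : 0 < ε) (x : Space d) :
    ∫⁻ ω, gaussMixture d μ ε (x + N ω) ∂P = gaussMixture d μ (ε + τ) x := by
  unfold gaussMixture
  rw [lintegral_lintegral_swap]
  · refine lintegral_congr_ae ?_
    filter_upwards [hμ] with w hw
    rw [lintegral_heatKernel_add P hN hτ hchar (add_pos hw hε), add_assoc]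
  · exact Measurable.aemeasurable (by fun_prop)

end Mixture

theorem heatKernel_neg (d : ℕ) (t : ℝ) (x : Space d) : heatKernel d t (-x) = heatKernel d t x := by
  rw [heatKernel, heatKernel, norm_neg]

/-- `f` is the mixture of the Gaussian densities `p_w`, `w > 0`, with respect to `μ`. The origin is
left out: for the Riesz and Bessel kernels the mixture is infinite there, whereas the real-valued
kernels take a junk value. -/
structure IsGaussMixture {d : ℕ} (f : Space d → ℝ) (μ : Measure ℝ) : Prop where
  sigmaFinite : SigmaFinite μ
  ae_pos : ∀ᵐ w ∂μ, 0 < w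
  measurable : Measurable f
  nonneg : ∀ x, 0 ≤ f x
  ofReal_eq : ∀ x, x ≠ 0 → ENNReal.ofReal (f x) = ∫⁻ w, ENNReal.ofReal (heatKernel d w x) ∂μ

namespace IsGaussMixture

variable {d : ℕ} [NeZero d] {f : Space d → ℝ} {μ : Measure ℝ}

instance : Nontrivial (Space d) := by
  have : Nonempty (Fin d) := ⟨0⟩
  infer_instance

/-- The convolution of `p_ε` with a mixture shifts the variances by `ε`. -/
theorem lintegral_conv (hf : IsGaussMixture f μ) {ε : ℝ} (hε : 0 < ε) (x : Space d) :
    ∫⁻ y, ENNReal.ofReal (heatKernel d ε (x - y)) * ENNReal.ofReal (f y) =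
      gaussMixture d μ ε x := by
  have := hf.sigmaFinite
  have hne : ∀ᵐ y : Space d, y ≠ 0 := by
    rw [ae_iff]
    simp
  calc _ = ∫⁻ y : Space d, ∫⁻ w : ℝ, ENNReal.ofReal (heatKernel d ε (x - y)) *
        ENNReal.ofReal (heatKernel d w y) ∂μ := by
        refine lintegral_congr_ae ?_
        filter_upwards [hne] with y hy
        rw [hf.ofReal_eq y hy, lintegral_const_mul' _ _ ENNReal.ofReal_ne_top]
    _ = ∫⁻ w : ℝ, (∫⁻ y : Space d, ENNReal.ofReal (heatKernel d ε (x - y)) *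
        ENNReal.ofReal (heatKernel d w y)) ∂μ := by
        refine lintegral_lintegral_swap (Measurable.aemeasurable ?_)
        fun_prop
    _ = _ := by
        refine lintegral_congr_ae ?_
        filter_upwards [hf.ae_pos] with w hw
        rw [lintegral_heatKernel_mul d hε hw, add_comm]

theorem kernelEnergy_eq (hf : IsGaussMixture f μ) {u v : ℝ} (hu : 0 < u) (hv : 0 < v)
    (y z : Space d) : kernelEnergy f u v y z = gaussMixture d μ (u + v) (y - z) := by
  have h1 : ∀ x : Space d, ∫⁻ x', ENNReal.ofReal
      (heatKernel d u (x - y) * heatKernel d v (x' - z) * f (x - x')) =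
      ∫⁻ h, ENNReal.ofReal (heatKernel d u (y - x)) *
        ENNReal.ofReal (heatKernel d v (x - (h + z))) * ENNReal.ofReal (f h) := by
    intro x
    -- substitute `h = x - x'`
    rw [← lintegral_sub_left_eq_self _ x]
    refine lintegral_congr fun h => ?_
    rw [ENNReal.ofReal_mul (mul_nonneg (heatKernel_nonneg d hu.le _) (heatKernel_nonneg d hv.le _)),
      ENNReal.ofReal_mul (heatKernel_nonneg d hu.le _), ← heatKernel_neg d u (x - y), neg_sub]
    congr 4 <;> abel
  rw [kernelEnergy, lintegral_congr h1, lintegral_lintegral_swap]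
  · rw [← hf.lintegral_conv (add_pos hu hv)]
    refine lintegral_congr fun h => ?_
    rw [lintegral_mul_const']
    · congr 1
      rw [← lintegral_add_right_eq_self _ (h + z)]
      have := lintegral_heatKernel_mul d hu hv (y - (h + z))
      rw [show y - z - h = y - (h + z) by abel, ← this]
      refine lintegral_congr fun x => ?_
      congr 3 <;> abel
    · exact ENNReal.ofReal_ne_top
  · refine Measurable.aemeasurable ?_
    have := hf.measurable
    fun_prop

theorem gaussMixture_eq_kernelEnergy (hf : IsGaussMixture f μ) {w : ℝ} (hw : 0 < w) (x : Space d) :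
    gaussMixture d μ w x = kernelEnergy f (w / 2) (w / 2) x 0 := by
  rw [hf.kernelEnergy_eq (half_pos hw) (half_pos hw), add_halves, sub_zero]

theorem integral_heatKernel_mul (hf : IsGaussMixture f μ) {ε : ℝ} (hε : 0 < ε) (x : Space d) :
    ∫ y, heatKernel d ε (x - y) * f y = (gaussMixture d μ ε x).toReal := by
  rw [integral_eq_lintegral_of_nonneg_ae, ← hf.lintegral_conv hε]
  · congr 1
    exact lintegral_congr fun y => ENNReal.ofReal_mul (heatKernel_nonneg d hε.le _)
  · exact Eventually.of_forall fun y => mul_nonneg (heatKernel_nonneg d hε.le _) (hf.nonneg y)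
  · have := hf.measurable
    exact Measurable.aestronglyMeasurable (by fun_prop)

end IsGaussMixture

/-! ### Characteristic functions of Brownian motion -/

section Brownian

variable {Ω : Type*} [MeasurableSpace Ω] {P : Measure Ω} {d : ℕ} {B : ℝ≥0 → Ω → Space d}

/-- A Brownian motion agrees almost surely, at all times, with one whose paths are all
continuous. -/
theorem IsBrownian.exists_continuous (hB : IsBrownian B P) :
    ∃ B' : ℝ≥0 → Ω → Space d, IsBrownian B' P ∧ (∀ ω, Continuous fun t => B' t ω) ∧
      ∀ᵐ ω ∂P, ∀ t, B' t ω = B t ω := by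
  classical
  have hc : ∀ᵐ ω ∂P, ∀ i, Continuous fun t => B t ω i := ae_all_iff.2 fun i => (hB.coord i).cont
  rw [ae_iff] at hc
  set N := toMeasurable P {ω | ¬ ∀ i, Continuous fun t => B t ω i} with hN
  have hNm : MeasurableSet N := measurableSet_toMeasurable _ _
  have hN0 : ∀ᵐ ω ∂P, ω ∉ N := by
    rw [ae_iff]
    simpa [hN, measure_toMeasurable] using hc
  let B' : ℝ≥0 → Ω → Space d := fun t ω => if ω ∈ N then 0 else B t ω
  have hBB : ∀ᵐ ω ∂P, ∀ t, B' t ω = B t ω := by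
    filter_upwards [hN0] with ω hω t
    simp [B', hω]
  have hcont : ∀ ω, Continuous fun t => B' t ω := by
    intro ω
    by_cases hω : ω ∈ N
    · simp only [B', hω, if_true]
      exact continuous_const
    · simp only [B', hω, if_false]
      have h1 : ∀ i, Continuous fun t => B t ω i := by
        by_contra h
        exact hω (subset_toMeasurable P _ h)
      exact (PiLp.continuous_toLp 2 _).comp (continuous_pi h1)
  refine ⟨B', ⟨fun t => Measurable.ite hNm measurable_const (hB.measurable t), fun i => ?_, ?_⟩,
    hcont, hBB⟩
  · refine ⟨(hB.coord i).toIsPreBrownianReal.congr fun t => ?_, Eventually.of_forall fun ω => ?_⟩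
    · filter_upwards [hBB] with ω hω
      rw [hω t]
    · exact (EuclideanSpace.proj i).continuous.comp (hcont ω)
  · refine hB.indep.congr fun i => ?_
    filter_upwards [hBB] with ω hω
    ext t
    rw [hω t]

theorem integral_exp_of_hasLaw {Y : Ω → ℝ} {v : ℝ≥0} (hY : HasLaw Y (gaussianReal 0 v) P)
    (c : ℝ) :
    ∫ ω, Complex.exp ((c * Y ω : ℝ) * Complex.I) ∂P = Real.exp (-(c ^ 2 * v / 2)) := by
  have h := charFun_gaussianReal (μ := 0) (v := v) c
  rw [← hY.map_eq, charFun_apply_real, integral_map hY.aemeasurable (by fun_prop)] at h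
  push_cast
  rw [h]
  push_cast
  ring_nf

/-- Linear functionals of finitely many values of a Brownian motion are centred Gaussian. -/
theorem IsBrownian.exists_hasLaw (hB : IsBrownian B P) {n : ℕ} (r : Fin n → ℝ≥0)
    (ξ : Fin n → Space d) :
    ∃ v : ℝ≥0, HasLaw (fun ω => ∑ i, ⟪ξ i, B (r i) ω⟫) (gaussianReal 0 v) P := by
  have hG : ∀ j : Fin d, HasGaussianLaw (fun ω => ∑ i, ξ i j * B (r i) ω j) P := fun j => by
    have hBj := hB.coord j
    exact ((hBj.isGaussianProcess.comp_right r).smul fun i => ξ i j).hasGaussianLaw_fun_sum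
      (I := Finset.univ)
  have hI : iIndepFun (fun (j : Fin d) ω => ∑ i, ξ i j * B (r i) ω j) P := by
    refine hB.indep.comp (fun j (b : ℝ≥0 → ℝ) => ∑ i, ξ i j * b (r i)) fun j => ?_
    fun_prop
  have hE : (fun ω => ∑ i, ⟪ξ i, B (r i) ω⟫) = fun ω => ∑ j, ∑ i, ξ i j * B (r i) ω j := by
    ext ω
    rw [Finset.sum_comm]
    refine Finset.sum_congr rfl fun i _ => ?_
    simp [PiLp.inner_apply, mul_comm]
  have hS := hI.hasGaussianLaw_fun_sum hG
  rw [← hE] at hS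
  refine ⟨Var[fun ω => ∑ i, ⟪ξ i, B (r i) ω⟫; P].toNNReal, ⟨hS.aemeasurable, ?_⟩⟩
  · rw [hS.map_eq_gaussianReal]
    congr 1
    rw [hE]
    rw [integral_finsetSum _ fun j _ => (hG j).integrable]
    refine Finset.sum_eq_zero fun j _ => ?_
    rw [integral_finsetSum]
    · refine Finset.sum_eq_zero fun i _ => ?_
      rw [integral_const_mul, (hB.coord j).integral_eval, mul_zero]
    · exact fun i _ => ((hB.coord j).integrable_eval _).const_mul _

theorem jointCharFun_smul {n : ℕ} (r : Fin n → ℝ≥0)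
    (ξ : Fin n → Space d) {v : ℝ≥0}
    (hv : HasLaw (fun ω => ∑ i, ⟪ξ i, B (r i) ω⟫) (gaussianReal 0 v) P) (c : ℝ) :
    jointCharFun P (fun i ω => c • B (r i) ω) ξ = Real.exp (-(c ^ 2 * v / 2)) := by
  rw [← integral_exp_of_hasLaw hv, jointCharFun]
  simp_rw [real_inner_smul_right, Finset.mul_sum]

variable {B₁ B₂ : ℝ≥0 → Ω → Space d}

theorem jointCharFun_sub (hB₁ : IsBrownian B₁ P) (hB₂ : IsBrownian B₂ P)
    (hI : IndepFun (fun (ω : Ω) (t : ℝ≥0) => B₁ t ω) (fun (ω : Ω) (t : ℝ≥0) => B₂ t ω) P) {n : ℕ}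
    (r s : Fin n → ℝ≥0) (ξ : Fin n → Space d) {v₁ v₂ : ℝ≥0}
    (hv₁ : HasLaw (fun ω => ∑ i, ⟪ξ i, B₁ (r i) ω⟫) (gaussianReal 0 v₁) P)
    (hv₂ : HasLaw (fun ω => ∑ i, ⟪ξ i, B₂ (s i) ω⟫) (gaussianReal 0 v₂) P) :
    jointCharFun P (fun i ω => B₁ (r i) ω - B₂ (s i) ω) ξ =
      (Real.exp (-(v₁ / 2)) * Real.exp (-(v₂ / 2)) : ℝ) := by
  have h : IndepFun (fun ω => Complex.exp (((1 : ℝ) * ∑ i, ⟪ξ i, B₁ (r i) ω⟫ : ℝ) * Complex.I))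
      (fun ω => Complex.exp (((-1 : ℝ) * ∑ i, ⟪ξ i, B₂ (s i) ω⟫ : ℝ) * Complex.I)) P := by
    refine hI.comp (φ := fun b : ℝ≥0 → Space d =>
        Complex.exp (((1 : ℝ) * ∑ i, ⟪ξ i, b (r i)⟫ : ℝ) * Complex.I))
      (ψ := fun b : ℝ≥0 → Space d =>
        Complex.exp (((-1 : ℝ) * ∑ i, ⟪ξ i, b (s i)⟫ : ℝ) * Complex.I)) ?_ ?_
    all_goals fun_prop
  have m₁ := hB₁.measurable
  have m₂ := hB₂.measurable
  have h2 := h.integral_fun_mul_eq_mul_integral (Measurable.aestronglyMeasurable (by fun_prop))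
    (Measurable.aestronglyMeasurable (by fun_prop))
  rw [integral_exp_of_hasLaw hv₁, integral_exp_of_hasLaw hv₂] at h2
  norm_num at h2
  rw [jointCharFun, Complex.ofReal_mul]
  push_cast
  rw [← h2]
  refine integral_congr_ae (Eventually.of_forall fun ω => ?_)
  simp only [← Complex.exp_add, inner_sub_right, Complex.ofReal_sub, Finset.sum_sub_distrib]
  ring_nf

theorem jointCharFun_sub_re_nonneg (hB₁ : IsBrownian B₁ P) (hB₂ : IsBrownian B₂ P)
    (hI : IndepFun (fun (ω : Ω) (t : ℝ≥0) => B₁ t ω) (fun (ω : Ω) (t : ℝ≥0) => B₂ t ω) P) {n : ℕ}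
    (r s : Fin n → ℝ≥0) (ξ : Fin n → Space d) :
    0 ≤ (jointCharFun P (fun i ω => B₁ (r i) ω - B₂ (s i) ω) ξ).re := by
  obtain ⟨v₁, hv₁⟩ := hB₁.exists_hasLaw r ξ
  obtain ⟨v₂, hv₂⟩ := hB₂.exists_hasLaw s ξ
  rw [jointCharFun_sub hB₁ hB₂ hI r s ξ hv₁ hv₂, Complex.ofReal_re]
  positivity

theorem IsBrownian.jointCharFun_smul_re_nonneg (hB : IsBrownian B P) {n : ℕ} (r : Fin n → ℝ≥0)
    (ξ : Fin n → Space d) (c : ℝ) : 0 ≤ (jointCharFun P (fun i ω => c • B (r i) ω) ξ).re := by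
  obtain ⟨v, hv⟩ := hB.exists_hasLaw r ξ
  rw [jointCharFun_smul r ξ hv, Complex.ofReal_re]
  positivity

/-- The characteristic function of the differences of two independent Brownian motions is the
geometric mean of those of each motion run at double speed, and so at most their arithmetic
mean. -/
theorem jointCharFun_sub_re_le (hB₁ : IsBrownian B₁ P) (hB₂ : IsBrownian B₂ P)
    (hI : IndepFun (fun (ω : Ω) (t : ℝ≥0) => B₁ t ω) (fun (ω : Ω) (t : ℝ≥0) => B₂ t ω) P) {n : ℕ}
    (r s : Fin n → ℝ≥0) (ξ : Fin n → Space d) :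
    (jointCharFun P (fun i ω => B₁ (r i) ω - B₂ (s i) ω) ξ).re ≤
      2⁻¹ * ((jointCharFun P (fun i ω => √2 • B₁ (r i) ω) ξ).re +
        (jointCharFun P (fun i ω => √2 • B₂ (s i) ω) ξ).re) := by
  obtain ⟨v₁, hv₁⟩ := hB₁.exists_hasLaw r ξ
  obtain ⟨v₂, hv₂⟩ := hB₂.exists_hasLaw s ξ
  rw [jointCharFun_sub hB₁ hB₂ hI r s ξ hv₁ hv₂, jointCharFun_smul r ξ hv₁,
    jointCharFun_smul s ξ hv₂, Complex.ofReal_re, Complex.ofReal_re, Complex.ofReal_re]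
  have e (v : ℝ) : Real.exp (-(√2 ^ 2 * v / 2)) = Real.exp (-(v / 2)) ^ 2 := by
    rw [← Real.exp_nat_mul, Real.sq_sqrt two_pos.le]
    push_cast
    ring_nf
  rw [e, e]
  nlinarith [sq_nonneg (Real.exp (-(v₁ / 2 : ℝ)) - Real.exp (-(v₂ / 2 : ℝ)))]

/-- The increments of a Brownian motion are centred Gaussian vectors. -/
theorem IsBrownian.integral_exp_increment (hB : IsBrownian B P) {r t : ℝ≥0} (hrt : r ≤ t) (c : ℝ)
    (ξ : Space d) :
    ∫ ω, Complex.exp ((⟪ξ, c • (B t ω - B r ω)⟫ : ℝ) * Complex.I) ∂P =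
      Real.exp (-(c ^ 2 * (t - r) / 2) * ‖ξ‖ ^ 2) := by
  have hlaw : ∀ j : Fin d, HasLaw (fun ω => B t ω j - B r ω j) (gaussianReal 0 (t - r)) P := by
    intro j
    have h := (hB.coord j).hasLaw_sub t r
    have e : nndist (t : ℝ) (r : ℝ) = t - r := by
      ext
      rw [coe_nndist, Real.dist_eq, abs_of_nonneg (sub_nonneg.2 (by exact_mod_cast hrt)),
        NNReal.coe_sub hrt]
    rw [← e]
    exact h
  have hI : iIndepFun (fun (j : Fin d) ω => c * ξ j * (B t ω j - B r ω j)) P := by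
    refine hB.indep.comp (fun j (b : ℝ≥0 → ℝ) => c * ξ j * (b t - b r)) fun j => ?_
    fun_prop
  have m := hB.measurable
  have hm : ∀ j : Fin d, Measurable fun ω => c * ξ j * (B t ω j - B r ω j) := fun j => by fun_prop
  have h := congrFun (hI.charFun_map_fun_sum_eq_prod fun j => (hm j).aemeasurable) 1
  rw [Finset.prod_apply, charFun_apply_real, integral_map (by fun_prop) (by fun_prop)] at h
  have h2 : ∀ j : Fin d, charFun (P.map fun ω => c * ξ j * (B t ω j - B r ω j)) 1 =
      Real.exp (-((c * ξ j) ^ 2 * (t - r) / 2)) := by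
    intro j
    rw [← NNReal.coe_sub hrt, ← integral_exp_of_hasLaw (hlaw j) (c * ξ j), charFun_apply_real,
      integral_map (hm j).aemeasurable (by fun_prop)]
    simp
  simp_rw [h2] at h
  rw [← Complex.ofReal_prod, ← Real.exp_sum] at h
  convert h using 1
  · congr 1
    ext ω
    simp [PiLp.inner_apply, mul_comm, mul_left_comm, mul_assoc]
  · rw [EuclideanSpace.real_norm_sq_eq, Finset.mul_sum]
    congr 3
    ext j
    ring

/-- The increment of a Brownian motion after time `r` is independent of its values up to `r`. -/
theorem IsBrownian.indepFun_increment [IsProbabilityMeasure P] (hB : IsBrownian B P) {r t : ℝ≥0}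
    (hrt : r ≤ t) :
    IndepFun (fun ω => B t ω - B r ω) (fun ω (u : Set.Iic r) => B u ω) P := by
  have m := hB.measurable
  -- the pairs (increment, past) of the coordinates are independent, and each has independent
  -- components; so the joint law is a product over all coordinates and both components
  let p : Fin d → Ω → ℝ × (Set.Iic r → ℝ) := fun j ω => (B t ω j - B r ω j, fun u => B u ω j)
  have hp : ∀ j, Measurable (p j) := fun j => by fun_prop
  have hpI : iIndepFun p P := by
    refine hB.indep.comp (fun j (b : ℝ≥0 → ℝ) => (b t - b r, fun u : Set.Iic r => b u)) fun j => ?_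
    fun_prop
  have hpast : ∀ j, Measurable fun ω (u : Set.Iic r) => B u ω j := fun j => by fun_prop
  have hpj : ∀ j, P.map (p j) = (P.map fun ω => B t ω j - B r ω j).prod
      (P.map fun ω (u : Set.Iic r) => B u ω j) := by
    intro j
    refine IndepFun.map_prod_eq_prod_map_map (by fun_prop) (hpast j).aemeasurable ?_
    have h := (hB.coord j).indepFun_shift r
    have hφ : Measurable fun b : ℝ≥0 → ℝ => b (t - r) := measurable_pi_apply _
    have := h.comp hφ measurable_id
    simpa [Function.comp_def, add_tsub_cancel_of_le hrt] using this
  have hmap := hpI.map_fun_eq_pi_map fun j => (hp j).aemeasurable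
  simp_rw [hpj] at hmap
  have (j : Fin d) : IsProbabilityMeasure (P.map fun ω => B t ω j - B r ω j) :=
    Measure.isProbabilityMeasure_map (by fun_prop)
  have (j : Fin d) : IsProbabilityMeasure (P.map fun ω (u : Set.Iic r) => B u ω j) :=
    Measure.isProbabilityMeasure_map (hpast j).aemeasurable
  have hq := (measurePreserving_arrowProdEquivProdArrow ℝ (Set.Iic r → ℝ) (Fin d)
    (fun j => P.map fun ω => B t ω j - B r ω j)
    (fun j => P.map fun ω (u : Set.Iic r) => B u ω j)).map_eq
  rw [← hmap, Measure.map_map (MeasurableEquiv.measurable _) (by fun_prop)] at hq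
  have hA : IndepFun (fun ω (j : Fin d) => B t ω j - B r ω j)
      (fun ω (j : Fin d) (u : Set.Iic r) => B u ω j) P := by
    rw [indepFun_iff_map_prod_eq_prod_map_map (by fun_prop)
      (measurable_pi_lambda _ hpast).aemeasurable]
    have h1 := (hpI.comp (fun _ => Prod.fst) fun _ => measurable_fst).map_fun_eq_pi_map
      fun j => (measurable_fst.comp (hp j)).aemeasurable
    have h2 := (hpI.comp (fun _ => Prod.snd) fun _ => measurable_snd).map_fun_eq_pi_map
      fun j => (measurable_snd.comp (hp j)).aemeasurable
    simp only [Function.comp_def, p] at h1 h2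
    rw [h1, h2]
    exact hq
  exact hA.comp (φ := fun x : Fin d → ℝ => WithLp.toLp 2 x)
    (ψ := fun (x : Fin d → Set.Iic r → ℝ) (u : Set.Iic r) => WithLp.toLp 2 fun j => x j u)
    (by fun_prop) (by fun_prop)

end Brownian

/-! ### Iterated and beta integrals -/

/-- The mass of a power of a diffuse measure on the line, decomposed according to the largest of
the coordinates. -/
theorem measure_univ_pow_succ (n : ℕ) (ν : Measure ℝ) [SFinite ν] [NullSingletonClass ν] :
    ν Set.univ ^ (n + 1) = (n + 1) * ∫⁻ r, ν (Set.Iic r) ^ n ∂ν := by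
  induction n generalizing ν with
  | zero => simp
  | succ n ih =>
    have hmI : Measurable fun r => ν (Set.Iic r) :=
      Monotone.measurable fun a b h => measure_mono (Set.Iic_subset_Iic.2 h)
    have hsplit : ∀ r, ν Set.univ = ν (Set.Iic r) + ν (Set.Ioi r) := fun r => by
      rw [← Set.compl_Iic, measure_add_measure_compl measurableSet_Iic]
    have hind : Measurable fun q : ℝ × ℝ => (Set.Ioi q.1).indicator (1 : ℝ → ℝ≥0∞) q.2 := by
      have : (fun q : ℝ × ℝ => (Set.Ioi q.1).indicator (1 : ℝ → ℝ≥0∞) q.2) =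
          {q : ℝ × ℝ | q.1 < q.2}.indicator 1 := by
        ext q
        simp [Set.indicator_apply]
      rw [this]
      exact measurable_one.indicator (measurableSet_lt measurable_fst measurable_snd)
    have hswap : ∫⁻ r, ν (Set.Iic r) ^ n * ν (Set.Ioi r) ∂ν =
        ∫⁻ u, ∫⁻ r in Set.Iic u, ν (Set.Iic r) ^ n ∂ν ∂ν := by
      calc _ = ∫⁻ r, ∫⁻ u, ν (Set.Iic r) ^ n * (Set.Ioi r).indicator 1 u ∂ν ∂ν := by
            refine lintegral_congr fun r => ?_
            rw [lintegral_const_mul _ (measurable_one.indicator measurableSet_Ioi),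
              lintegral_indicator_one measurableSet_Ioi]
        _ = ∫⁻ u, ∫⁻ r, ν (Set.Iic r) ^ n * (Set.Ioi r).indicator 1 u ∂ν ∂ν :=
            lintegral_lintegral_swap (((hmI.comp measurable_fst).pow_const n).mul hind).aemeasurable
        _ = _ := by
            refine lintegral_congr fun u => ?_
            rw [← restrict_Iio_eq_restrict_Iic, ← lintegral_indicator measurableSet_Iio]
            refine lintegral_congr fun r => ?_
            by_cases h : r < u <;> simp [h]
    have hrest : ∀ u, (n + 1) * ∫⁻ r in Set.Iic u, ν (Set.Iic r) ^ n ∂ν =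
        ν (Set.Iic u) ^ (n + 1) := by
      intro u
      have h := ih (ν.restrict (Set.Iic u))
      rw [Measure.restrict_apply_univ] at h
      rw [h]
      congr 1
      refine setLIntegral_congr_fun measurableSet_Iic fun r hr => ?_
      rw [Measure.restrict_apply measurableSet_Iic, Set.inter_eq_left.2 (Set.Iic_subset_Iic.2 hr)]
    calc ν Set.univ ^ (n + 1 + 1)
        = (n + 1) * ∫⁻ r, ν (Set.Iic r) ^ n * ν Set.univ ∂ν := by
          rw [pow_succ, ih, lintegral_mul_const _ (hmI.pow_const n), mul_assoc]
      _ = (n + 1) * ∫⁻ r, (ν (Set.Iic r) ^ (n + 1) + ν (Set.Iic r) ^ n * ν (Set.Ioi r)) ∂ν := by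
          congr 1
          refine lintegral_congr fun r => ?_
          rw [hsplit r, mul_add, pow_succ]
      _ = (n + 1) * ∫⁻ r, ν (Set.Iic r) ^ (n + 1) ∂ν + ∫⁻ u, ν (Set.Iic u) ^ (n + 1) ∂ν := by
          rw [lintegral_add_left (hmI.pow_const _), mul_add, hswap,
            ← lintegral_congr hrest, ← lintegral_const_mul' _ _ (by finiteness),
            ← lintegral_const_mul' _ _ (by finiteness)]
      _ = _ := by
          push_cast
          ring

/-- The power of an integral, as an iterated integral ordered by the largest of the variables. -/
theorem setLIntegral_pow_succ {h : ℝ → ℝ≥0∞} (hh : Measurable h) (n : ℕ) (t : ℝ) :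
    (∫⁻ u in Set.Ioc 0 t, h u) ^ (n + 1) =
      (n + 1) * ∫⁻ r in Set.Ioc 0 t, h r * (∫⁻ u in Set.Ioc 0 r, h u) ^ n := by
  have key := measure_univ_pow_succ n ((volume.restrict (Set.Ioc 0 t)).withDensity h)
  rw [withDensity_apply _ MeasurableSet.univ, setLIntegral_univ] at key
  have hm : Measurable fun r => ((volume.restrict (Set.Ioc 0 t)).withDensity h) (Set.Iic r) ^ n :=
    (Monotone.measurable fun a b h => measure_mono (Set.Iic_subset_Iic.2 h)).pow_const n
  rw [key, lintegral_withDensity_eq_lintegral_mul _ hh hm]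
  congr 1
  refine setLIntegral_congr_fun measurableSet_Ioc fun r hr => ?_
  rw [Pi.mul_apply, withDensity_apply _ measurableSet_Iic,
    Measure.restrict_restrict measurableSet_Iic]
  rw [Set.inter_comm, Set.Ioc_inter_Iic, min_eq_right hr.2]

theorem lintegral_Ioo_eq_comp_mul (g : ℝ → ℝ≥0∞) {t : ℝ} (ht : 0 < t) :
    ∫⁻ r in Set.Ioo 0 t, g r = ∫⁻ x in Set.Ioo 0 1, ENNReal.ofReal t * g (t * x) := by
  have h := lintegral_image_eq_lintegral_abs_deriv_mul (s := Set.Ioo (0 : ℝ) 1)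
    (f := fun x => t * x) (f' := fun _ => t) measurableSet_Ioo
    (fun x _ => by simpa using ((hasDerivAt_id x).const_mul t).hasDerivWithinAt)
    (fun x _ y _ hxy => mul_left_cancel₀ ht.ne' hxy) g
  rw [abs_of_pos ht] at h
  rw [← h]
  congr 2
  rw [Set.image_mul_left_Ioo ht]
  simp

/-- The Beta integral on `(0,t)`. -/
theorem lintegral_beta {κ b t : ℝ} (hκ : 0 < κ) (hb : 0 < b) (ht : 0 < t) :
    ∫⁻ r in Set.Ioc 0 t, ENNReal.ofReal ((t - r) ^ (κ - 1) * r ^ (b - 1)) =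
      ENNReal.ofReal (Real.Gamma κ * Real.Gamma b / Real.Gamma (κ + b) * t ^ (κ + b - 1)) := by
  have h1 := lintegral_betaPDF_eq_one hb hκ
  rw [lintegral_betaPDF] at h1
  have hB := beta_pos hb hκ
  rw [setLIntegral_congr Ioo_ae_eq_Ioc.symm, lintegral_Ioo_eq_comp_mul _ ht]
  have h2 : ∀ x ∈ Set.Ioo (0 : ℝ) 1,
      ENNReal.ofReal t * ENNReal.ofReal ((t - t * x) ^ (κ - 1) * (t * x) ^ (b - 1)) =
      ENNReal.ofReal (beta b κ * t ^ (κ + b - 1)) *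
        ENNReal.ofReal (1 / beta b κ * x ^ (b - 1) * (1 - x) ^ (κ - 1)) := by
    intro x hx
    rw [← ENNReal.ofReal_mul ht.le, ← ENNReal.ofReal_mul (by positivity)]
    congr 1
    have e : t ^ (κ + b - 1) = t * t ^ (κ - 1) * t ^ (b - 1) := by
      rw [show κ + b - 1 = 1 + (κ - 1) + (b - 1) by ring, Real.rpow_add ht, Real.rpow_add ht,
        Real.rpow_one]
    rw [show t - t * x = t * (1 - x) by ring, Real.mul_rpow ht.le (by linarith [hx.2]),
      Real.mul_rpow ht.le hx.1.le, e]
    field_simp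
  rw [setLIntegral_congr_fun measurableSet_Ioo h2, lintegral_const_mul', h1, mul_one, beta,
    add_comm b κ, mul_comm (Real.Gamma b)]
  exact ENNReal.ofReal_ne_top

theorem lintegral_rpow_sub_one {b t : ℝ} (hb : 0 < b) (ht : 0 < t) :
    ∫⁻ r in Set.Ioc 0 t, ENNReal.ofReal (r ^ (b - 1)) = ENNReal.ofReal (t ^ b / b) := by
  have h := lintegral_beta one_pos hb ht
  simp only [sub_self, Real.rpow_zero, one_mul, Real.Gamma_one] at h
  rw [h, add_comm 1 b, Real.Gamma_add_one hb.ne', add_sub_cancel_right]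
  congr 1
  have := Real.Gamma_pos_of_pos hb
  field_simp

/-! ### Moments of the occupation functional of one Brownian motion -/

/-- The occupation functional `∫_0^r F_ε(√2 b(u)) du` of a path `b`, where `F_ε` is the smoothed
Gaussian mixture. -/
noncomputable def occupation {d : ℕ} (μ : Measure ℝ) (ε : ℝ) (b : ℝ≥0 → Space d) (r : ℝ) : ℝ≥0∞ :=
  ∫⁻ u in Set.Ioc 0 r, gaussMixture d μ ε (√2 • b u.toNNReal)

theorem measurable_comap_Iic {Ω : Type*} {d : ℕ} {B : ℝ≥0 → Ω → Space d} {u r : ℝ≥0} (hu : u ≤ r) :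
    Measurable[MeasurableSpace.comap (fun ω (u : Set.Iic r) => B u ω) MeasurableSpace.pi]
      (B u) := by
  let := MeasurableSpace.comap (fun ω (u : Set.Iic r) => B u ω) MeasurableSpace.pi
  have h : Measurable fun ω (u : Set.Iic r) => B u ω := comap_measurable _
  exact measurable_pi_iff.1 h ⟨u, hu⟩

section Occupation

variable {Ω : Type*} {d : ℕ} {μ : Measure ℝ} [SigmaFinite μ] {B : ℝ≥0 → Ω → Space d} {ε : ℝ}

theorem measurable_path [MeasurableSpace Ω] (hc : ∀ ω, Continuous fun t => B t ω)
    (hm : ∀ t, Measurable (B t)) : Measurable fun q : ℝ × Ω => B q.1.toNNReal q.2 :=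
  (measurable_uncurry_of_continuous_of_measurable hc hm).comp
    ((measurable_real_toNNReal.comp measurable_fst).prodMk measurable_snd)

/-- The occupation functional up to time `r` depends on the path up to time `r` only, so the
σ-algebra on `Ω` may be that of the past at time `r`. -/
theorem measurable_occupation [MeasurableSpace Ω] (hc : ∀ ω, Continuous fun t => B t ω) (r : ℝ)
    (hm : ∀ t ≤ r.toNNReal, Measurable (B t)) :
    Measurable fun ω => occupation μ ε (fun t => B t ω) r := by
  have h : ∀ ω, occupation μ ε (fun t => B t ω) r =
      ∫⁻ u in Set.Ioc 0 r, gaussMixture d μ ε (√2 • B (min u.toNNReal r.toNNReal) ω) := fun ω =>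
    setLIntegral_congr_fun measurableSet_Ioc fun u hu => by
      simp only [min_eq_left (Real.toNNReal_le_toNNReal hu.2)]
  simp_rw [h]
  have hp := measurable_path (B := fun t => B (min t r.toNNReal))
    (fun ω => (hc ω).comp (by fun_prop)) (fun t => hm _ (min_le_right _ _))
  exact Measurable.lintegral_prod_left' (hp.const_smul (√2 : ℝ)).gaussMixture

theorem measurable_mul_occupation_pow_of_le [MeasurableSpace Ω]
    (hc : ∀ ω, Continuous fun t => B t ω) (n : ℕ) (r : ℝ)
    (hm : ∀ t ≤ r.toNNReal, Measurable (B t)) :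
    Measurable fun ω => gaussMixture d μ ε (√2 • B r.toNNReal ω) *
      occupation μ ε (fun t => B t ω) r ^ n :=
  ((hm _ le_rfl).const_smul (√2 : ℝ)).gaussMixture.mul
    ((measurable_occupation hc r hm).pow_const n)

theorem measurable_occupation_uncurry [MeasurableSpace Ω] (hc : ∀ ω, Continuous fun t => B t ω)
    (hm : ∀ t, Measurable (B t)) :
    Measurable fun q : ℝ × Ω => occupation μ ε (fun t => B t q.2) q.1 := by
  have h : ∀ q : ℝ × Ω, occupation μ ε (fun t => B t q.2) q.1 =
      ∫⁻ u, {p : (ℝ × Ω) × ℝ | 0 < p.2 ∧ p.2 ≤ p.1.1}.indicator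
        (fun p => gaussMixture d μ ε (√2 • B p.2.toNNReal p.1.2)) (q, u) := fun q => by
    rw [occupation, ← lintegral_indicator measurableSet_Ioc]
    rfl
  simp_rw [h]
  have hp := measurable_path hc hm
  have hp2 : Measurable fun p : (ℝ × Ω) × ℝ => B p.2.toNNReal p.1.2 :=
    hp.comp (measurable_snd.prodMk (measurable_snd.comp measurable_fst))
  refine Measurable.lintegral_prod_right'
    (Measurable.indicator (hp2.const_smul (√2 : ℝ)).gaussMixture ?_)
  exact (measurableSet_lt measurable_const measurable_snd).inter
    (measurableSet_le measurable_snd (measurable_fst.comp measurable_fst))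

theorem measurable_mul_occupation_pow_right [MeasurableSpace Ω]
    (hc : ∀ ω, Continuous fun t => B t ω) (hm : ∀ t, Measurable (B t)) (n : ℕ) (ω : Ω) :
    Measurable fun r : ℝ => gaussMixture d μ ε (√2 • B r.toNNReal ω) *
      occupation μ ε (fun u => B u ω) r ^ n := by
  have hp : Measurable fun r : ℝ => B r.toNNReal ω :=
    ((hc ω).comp continuous_real_toNNReal).measurable
  have ho : Measurable fun r : ℝ => occupation μ ε (fun u => B u ω) r :=
    (measurable_occupation_uncurry (μ := μ) (ε := ε) hc hm).comp
      (measurable_id.prodMk measurable_const)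
  exact (hp.const_smul (√2 : ℝ)).gaussMixture.mul (ho.pow_const n)

theorem measurable_mul_occupation_pow [MeasurableSpace Ω] (hc : ∀ ω, Continuous fun t => B t ω)
    (hm : ∀ t, Measurable (B t)) (n : ℕ) :
    Measurable fun q : Ω × ℝ => gaussMixture d μ ε (√2 • B q.2.toNNReal q.1) *
      occupation μ ε (fun u => B u q.1) q.2 ^ n := by
  have hp := (measurable_path hc hm).comp (measurable_snd.prodMk (measurable_fst (α := Ω) (β := ℝ)))
  have ho := (measurable_occupation_uncurry (μ := μ) (ε := ε) hc hm).comp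
    (measurable_snd.prodMk (measurable_fst (α := Ω) (β := ℝ)))
  exact (hp.const_smul (√2 : ℝ)).gaussMixture.mul (ho.pow_const n)

variable [MeasurableSpace Ω] {P : Measure Ω} [IsProbabilityMeasure P]

/-- By independence of increments, the conditional expectation of `F_ε(√2 B_t)` given the past at
time `r < t` is at most `sup_x F_{ε+2(t-r)}(x)`. -/
theorem IsBrownian.lintegral_mul_past_le (hB : IsBrownian B P) (hμ : ∀ᵐ w ∂μ, 0 < w) (hε : 0 < ε)
    {r t : ℝ≥0} (hrt : r ≤ t) {K : ℝ≥0∞}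
    (hK : ∀ x, gaussMixture d μ (ε + 2 * (t - r)) x ≤ K) {H : Ω → ℝ≥0∞}
    (hH : Measurable[MeasurableSpace.comap (fun ω (u : Set.Iic r) => B u ω) MeasurableSpace.pi] H) :
    ∫⁻ ω, gaussMixture d μ ε (√2 • B t ω) * H ω ∂P ≤ K * ∫⁻ ω, H ω ∂P := by
  have m := hB.measurable
  have hle : MeasurableSpace.comap (fun ω (u : Set.Iic r) => B u ω) MeasurableSpace.pi ≤
      (inferInstance : MeasurableSpace Ω) :=
    Measurable.comap_le (measurable_pi_lambda _ fun u => m u)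
  have hHm : Measurable H := hH.mono hle le_rfl
  have hpast : Measurable[MeasurableSpace.comap (fun ω (u : Set.Iic r) => B u ω) MeasurableSpace.pi]
      fun ω => (√2 • B r ω, H ω) := by
    refine Measurable.prodMk ?_ hH
    refine Measurable.const_smul ?_ (√2 : ℝ)
    exact measurable_comap_Iic le_rfl
  have hI : IndepFun (fun ω => √2 • (B t ω - B r ω)) (fun ω => (√2 • B r ω, H ω)) P := by
    have h1 := hB.indepFun_increment hrt
    have h2 : IndepFun (fun ω => √2 • (B t ω - B r ω)) (fun ω (u : Set.Iic r) => B u ω) P :=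
      h1.comp (φ := fun x => √2 • x) (ψ := id) (by fun_prop) measurable_id
    exact indep_of_indep_of_le_right h2 hpast.comap_le
  have hN : Measurable fun ω => √2 • (B t ω - B r ω) := by fun_prop
  have hY : Measurable fun ω => (√2 • B r ω, H ω) := by fun_prop
  have hmap := (indepFun_iff_map_prod_eq_prod_map_map hN.aemeasurable hY.aemeasurable).1 hI
  have hG : Measurable fun q : Space d × (Space d × ℝ≥0∞) =>
      gaussMixture d μ ε (q.2.1 + q.1) * q.2.2 := by fun_prop
  have hchar : ∀ ξ : Space d,
      ∫ ω, Complex.exp ((⟪ξ, √2 • (B t ω - B r ω)⟫ : ℝ) * Complex.I) ∂P =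
        Real.exp (-((2 * (t - r : ℝ)) / 2) * ‖ξ‖ ^ 2) := fun ξ => by
    rw [hB.integral_exp_increment hrt, Real.sq_sqrt two_pos.le]
  have hτ : (0 : ℝ) ≤ 2 * (t - r) := mul_nonneg two_pos.le (sub_nonneg.2 (by exact_mod_cast hrt))
  calc ∫⁻ ω, gaussMixture d μ ε (√2 • B t ω) * H ω ∂P
      = ∫⁻ q, gaussMixture d μ ε (q.2.1 + q.1) * q.2.2
          ∂(P.map fun ω => (√2 • (B t ω - B r ω), (√2 • B r ω, H ω))) := by
        rw [lintegral_map hG (hN.prodMk hY)]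
        refine lintegral_congr fun ω => ?_
        congr 2
        rw [← smul_add]
        congr 1
        abel
    _ = ∫⁻ y, ∫⁻ n, gaussMixture d μ ε (y.1 + n) * y.2 ∂(P.map fun ω => √2 • (B t ω - B r ω))
          ∂(P.map fun ω => (√2 • B r ω, H ω)) := by
        rw [hmap, lintegral_prod_symm' _ hG]
    _ ≤ ∫⁻ y, K * y.2 ∂(P.map fun ω => (√2 • B r ω, H ω)) := by
        refine lintegral_mono fun y => ?_
        rw [lintegral_mul_const _ (by fun_prop), lintegral_map (by fun_prop) hN,
          lintegral_gaussMixture_add P hμ hN hτ hchar hε]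
        gcongr
        exact hK _
    _ = K * ∫⁻ ω, H ω ∂P := by
        rw [lintegral_const_mul _ measurable_snd, lintegral_map measurable_snd hY]

variable {D κ : ℝ}

/-- Moments of the occupation functional, weighted by `F_ε` at the final time. The bound iterates a
Beta integral. -/
theorem IsBrownian.lintegral_mul_occupation_pow_le (hB : IsBrownian B P)
    (hc : ∀ ω, Continuous fun t => B t ω) (hμ : ∀ᵐ w ∂μ, 0 < w) (hε : 0 < ε) (hD : 0 < D)
    (hκ : 0 < κ) (hκ1 : κ ≤ 1)
    (hF : ∀ w, 0 < w → ∀ x, gaussMixture d μ w x ≤ ENNReal.ofReal (D * w ^ (κ - 1))) (n : ℕ)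
    {t : ℝ} (ht : 0 < t) :
    ∫⁻ ω, gaussMixture d μ ε (√2 • B t.toNNReal ω) * occupation μ ε (fun u => B u ω) t ^ n ∂P ≤
      ENNReal.ofReal (n.factorial * (D * 2 ^ (κ - 1) * Real.Gamma κ) ^ (n + 1) /
        Real.Gamma ((n + 1) * κ) * t ^ ((n + 1) * κ - 1)) := by
  have m := hB.measurable
  have hstep : ∀ r t : ℝ, 0 ≤ r → r < t → ∀ x,
      gaussMixture d μ (ε + 2 * ((t.toNNReal : ℝ) - r.toNNReal)) x ≤
        ENNReal.ofReal (D * 2 ^ (κ - 1) * (t - r) ^ (κ - 1)) := by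
    intro r t hr hrt x
    rw [Real.coe_toNNReal _ hr, Real.coe_toNNReal _ (hr.trans hrt.le)]
    have h0 : 0 < t - r := sub_pos.2 hrt
    refine (hF _ (by positivity) x).trans (ENNReal.ofReal_le_ofReal ?_)
    rw [mul_assoc, ← Real.mul_rpow two_pos.le h0.le]
    exact mul_le_mul_of_nonneg_left
      (Real.rpow_le_rpow_of_nonpos (by positivity) (by linarith) (by linarith)) hD.le
  have hΓ := Real.Gamma_pos_of_pos hκ
  induction n generalizing t with
  | zero =>
    have h := hB.lintegral_mul_past_le (H := fun _ => 1) hμ hε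
      (Real.toNNReal_le_toNNReal ht.le) (hstep 0 t le_rfl ht) measurable_const
    simp only [mul_one, lintegral_const, measure_univ] at h
    simp only [pow_zero, mul_one]
    refine h.trans (le_of_eq ?_)
    congr 1
    rw [sub_zero, Nat.factorial_zero, Nat.cast_one, Nat.cast_zero, zero_add, zero_add, pow_one,
      one_mul, one_mul, mul_div_cancel_right₀ _ hΓ.ne']
  | succ n ih =>
    have hZ : ∀ ω, occupation μ ε (fun u => B u ω) t ^ (n + 1) = (n + 1) *
        ∫⁻ r in Set.Ioc 0 t, gaussMixture d μ ε (√2 • B r.toNNReal ω) *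
          occupation μ ε (fun u => B u ω) r ^ n := fun ω => by
      have hp : Measurable fun r : ℝ => B r.toNNReal ω :=
        ((hc ω).comp continuous_real_toNNReal).measurable
      exact setLIntegral_pow_succ (by fun_prop) n t
    have hpo := measurable_mul_occupation_pow (μ := μ) (ε := ε) hc m n
    have hnt : ∀ᵐ r : ℝ ∂(volume.restrict (Set.Ioc 0 t)), r ≠ t :=
      ae_restrict_of_ae (by simp [ae_iff])
    have hn0 : (0 : ℝ) < (n + 1) * κ := by positivity
    calc _ = (n + 1) * ∫⁻ ω, (∫⁻ r in Set.Ioc 0 t, gaussMixture d μ ε (√2 • B t.toNNReal ω) *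
          (gaussMixture d μ ε (√2 • B r.toNNReal ω) *
            occupation μ ε (fun u => B u ω) r ^ n)) ∂P := by
          rw [← lintegral_const_mul' _ _ (by finiteness)]
          refine lintegral_congr fun ω => ?_
          rw [hZ, lintegral_const_mul _ (measurable_mul_occupation_pow_right hc m n ω),
            mul_left_comm]
      _ = (n + 1) * ∫⁻ r in Set.Ioc 0 t, (∫⁻ ω, gaussMixture d μ ε (√2 • B t.toNNReal ω) *
          (gaussMixture d μ ε (√2 • B r.toNNReal ω) *
            occupation μ ε (fun u => B u ω) r ^ n) ∂P) := by
          congr 1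
          refine lintegral_lintegral_swap (Measurable.aemeasurable ?_)
          exact ((((m _).comp measurable_fst).const_smul (√2 : ℝ)).gaussMixture).mul hpo
      _ ≤ (n + 1) * ∫⁻ r in Set.Ioc 0 t, ENNReal.ofReal (D * 2 ^ (κ - 1) * (t - r) ^ (κ - 1)) *
          ENNReal.ofReal (n.factorial * (D * 2 ^ (κ - 1) * Real.Gamma κ) ^ (n + 1) /
            Real.Gamma ((n + 1) * κ) * r ^ ((n + 1) * κ - 1)) := by
          refine mul_le_mul_right (lintegral_mono_ae ?_) _
          filter_upwards [ae_restrict_mem measurableSet_Ioc, hnt] with r hr hrt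
          have hrt' : r < t := lt_of_le_of_ne hr.2 hrt
          refine (hB.lintegral_mul_past_le hμ hε (Real.toNNReal_le_toNNReal hr.2)
            (hstep r t hr.1.le hrt') ?_).trans (mul_le_mul_right (ih hr.1) _)
          exact @measurable_mul_occupation_pow_of_le Ω d μ _ B ε (MeasurableSpace.comap
            (fun ω (u : Set.Iic r.toNNReal) => B u ω) MeasurableSpace.pi) hc n r
            fun u hu => measurable_comap_Iic hu
      _ = (n + 1) * ∫⁻ r in Set.Ioc 0 t, ENNReal.ofReal (n.factorial * (D * 2 ^ (κ - 1)) *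
            (D * 2 ^ (κ - 1) * Real.Gamma κ) ^ (n + 1) / Real.Gamma ((n + 1) * κ)) *
            ENNReal.ofReal ((t - r) ^ (κ - 1) * r ^ ((n + 1) * κ - 1)) := by
          congr 1
          refine setLIntegral_congr_fun measurableSet_Ioc fun r hr => ?_
          have : 0 ≤ t - r := sub_nonneg.2 hr.2
          have := Real.Gamma_pos_of_pos hn0
          rw [← ENNReal.ofReal_mul (by positivity), ← ENNReal.ofReal_mul (by positivity)]
          congr 1
          ring
      _ = _ := by
          have := Real.Gamma_pos_of_pos hn0
          rw [lintegral_const_mul' _ _ ENNReal.ofReal_ne_top, lintegral_beta hκ hn0 ht,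
            ← ENNReal.ofReal_mul (by positivity),
            show (n + 1 : ℝ≥0∞) = ENNReal.ofReal (n + 1) by
              rw [ENNReal.ofReal_add (by positivity) zero_le_one]; simp,
            ← ENNReal.ofReal_mul (by positivity)]
          congr 1
          rw [show κ + (n + 1) * κ = (n + 1 + 1) * κ by ring, Nat.factorial_succ]
          push_cast
          field_simp
          ring

/-- Moments of the occupation functional, by integrating the previous bound over the final time. -/
theorem IsBrownian.lintegral_occupation_pow_le (hB : IsBrownian B P)
    (hc : ∀ ω, Continuous fun t => B t ω) (hμ : ∀ᵐ w ∂μ, 0 < w) (hε : 0 < ε) (hD : 0 < D)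
    (hκ : 0 < κ) (hκ1 : κ ≤ 1)
    (hF : ∀ w, 0 < w → ∀ x, gaussMixture d μ w x ≤ ENNReal.ofReal (D * w ^ (κ - 1))) (n : ℕ)
    {t : ℝ} (ht : 0 < t) :
    ∫⁻ ω, occupation μ ε (fun u => B u ω) t ^ n ∂P ≤
      ENNReal.ofReal (n.factorial * (D * 2 ^ (κ - 1) * Real.Gamma κ * t ^ κ) ^ n /
        Real.Gamma (n * κ + 1)) := by
  have m := hB.measurable
  cases n with
  | zero => simp
  | succ n =>
    have hZ : ∀ ω, occupation μ ε (fun u => B u ω) t ^ (n + 1) = (n + 1) *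
        ∫⁻ r in Set.Ioc 0 t, gaussMixture d μ ε (√2 • B r.toNNReal ω) *
          occupation μ ε (fun u => B u ω) r ^ n := fun ω => by
      have hp : Measurable fun r : ℝ => B r.toNNReal ω :=
        ((hc ω).comp continuous_real_toNNReal).measurable
      exact setLIntegral_pow_succ (by fun_prop) n t
    have hpo := measurable_mul_occupation_pow (μ := μ) (ε := ε) hc m n
    have hn0 : (0 : ℝ) < (n + 1) * κ := by positivity
    have hΓ := Real.Gamma_pos_of_pos hκ
    have hΓn := Real.Gamma_pos_of_pos hn0
    simp_rw [hZ]
    rw [lintegral_const_mul' _ _ (by finiteness), lintegral_lintegral_swap hpo.aemeasurable]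
    calc _ ≤ (n + 1) * ∫⁻ r in Set.Ioc 0 t, ENNReal.ofReal (n.factorial *
          (D * 2 ^ (κ - 1) * Real.Gamma κ) ^ (n + 1) / Real.Gamma ((n + 1) * κ)) *
            ENNReal.ofReal (r ^ ((n + 1) * κ - 1)) := by
          refine mul_le_mul_right (setLIntegral_mono' measurableSet_Ioc fun r hr => ?_) _
          rw [← ENNReal.ofReal_mul (by positivity)]
          exact hB.lintegral_mul_occupation_pow_le hc hμ hε hD hκ hκ1 hF n hr.1
      _ = _ := by
          rw [lintegral_const_mul' _ _ ENNReal.ofReal_ne_top, lintegral_rpow_sub_one hn0 ht,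
            ← ENNReal.ofReal_mul (by positivity),
            show (n + 1 : ℝ≥0∞) = ENNReal.ofReal (n + 1) by
              rw [ENNReal.ofReal_add (by positivity) zero_le_one]; simp,
            ← ENNReal.ofReal_mul (by positivity)]
          congr 1
          push_cast
          rw [Nat.factorial_succ, Real.Gamma_add_one hn0.ne', mul_pow _ (t ^ κ),
            ← Real.rpow_natCast (t ^ κ), ← Real.rpow_mul ht.le κ]
          push_cast
          rw [mul_comm κ]
          field_simp

end Occupation

/-! ### Moments of the mutual local time -/

/-- The weighted mutual local time `∫ F_ε(b₁(r) - b₂(s)) ν(dr,ds)` of two paths, where `F_ε` is the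
smoothed Gaussian mixture. -/
noncomputable def mutualLocalTime {d : ℕ} (μ : Measure ℝ) (ν : Measure (ℝ × ℝ)) (ε : ℝ)
    (b₁ b₂ : ℝ≥0 → Space d) : ℝ≥0∞ :=
  ∫⁻ q, gaussMixture d μ ε (b₁ q.1.toNNReal - b₂ q.2.toNNReal) ∂ν

/-- If the smoothed kernel is bounded, then so is the mutual local time, pathwise. -/
theorem mutualLocalTime_le {d : ℕ} {μ : Measure ℝ} {ν : Measure (ℝ × ℝ)} {ε : ℝ}
    {C : ℝ≥0∞} (hF : ∀ x, gaussMixture d μ ε x ≤ C) (b₁ b₂ : ℝ≥0 → Space d) :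
    mutualLocalTime μ ν ε b₁ b₂ ≤ C * ν Set.univ :=
  (lintegral_mono fun _ => hF _).trans (lintegral_const C).le

theorem lintegral_gaussMixture_le_occupation {d : ℕ} {μ : Measure ℝ} [SigmaFinite μ]
    {ν : Measure (ℝ × ℝ)} {N : ℝ≥0} {t : ℝ} {b : ℝ≥0 → Space d} (hb : Continuous b) {ε : ℝ}
    {p : ℝ × ℝ → ℝ} (hp : Measurable p)
    (hν : ν.map p ≤ (N : ℝ≥0∞) • volume.restrict (Set.Ioc 0 t)) :
    ∫⁻ q, gaussMixture d μ ε (√2 • b (p q).toNNReal) ∂ν ≤ N * occupation μ ε b t := by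
  have hbm : Measurable fun r : ℝ => √2 • b r.toNNReal :=
    ((hb.comp continuous_real_toNNReal).const_smul (√2 : ℝ)).measurable
  rw [← lintegral_map (f := fun r : ℝ => gaussMixture d μ ε (√2 • b r.toNNReal))
    hbm.gaussMixture hp, occupation, ← smul_eq_mul, ← lintegral_smul_measure]
  exact lintegral_mono' hν le_rfl

section Moments

variable {Ω : Type*} {d : ℕ} {μ : Measure ℝ} [SigmaFinite μ] {ν : Measure (ℝ × ℝ)}
  [IsFiniteMeasure ν] [MeasurableSpace Ω] {P : Measure Ω} [IsProbabilityMeasure P]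

/-- Expectations of products of functionals of the form `∫ F_ε(X_q) ν(dq)` are multiple integrals
of expectations of products. -/
theorem lintegral_prod_lintegral_gaussMixture {X : ℝ × ℝ → Ω → Space d}
    (hX : Measurable (Function.uncurry X)) {n : ℕ} (ε : Fin n → ℝ) :
    ∫⁻ ω, ∏ i, (∫⁻ q, gaussMixture d μ (ε i) (X q ω) ∂ν) ∂P =
      ∫⁻ q : Fin n → ℝ × ℝ, ∫⁻ ω, ∏ i, gaussMixture d μ (ε i) (X (q i) ω) ∂P
        ∂(Measure.pi fun _ => ν) := by
  have hX1 (ω : Ω) : Measurable fun q => X q ω := hX.comp measurable_prodMk_right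
  have h : ∀ ω, ∏ i, (∫⁻ q, gaussMixture d μ (ε i) (X q ω) ∂ν) = ∫⁻ q : Fin n → ℝ × ℝ,
      ∏ i, gaussMixture d μ (ε i) (X (q i) ω) ∂(Measure.pi fun _ => ν) := fun ω =>
    (lintegral_pi_prod ν (fun i q => gaussMixture d μ (ε i) (X q ω)) fun i =>
      (hX1 ω).gaussMixture).symm
  rw [lintegral_congr h]
  refine lintegral_lintegral_swap (f := fun ω (q : Fin n → ℝ × ℝ) =>
    ∏ i, gaussMixture d μ (ε i) (X (q i) ω)) (Measurable.aemeasurable ?_)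
  refine Finset.measurable_prod _ fun i _ => Measurable.gaussMixture ?_
  have h2 : Measurable fun p : Ω × (Fin n → ℝ × ℝ) => (p.2 i, p.1) :=
    ((measurable_pi_apply i).comp measurable_snd).prodMk measurable_fst
  exact hX.comp h2

variable {B₁ B₂ : ℝ≥0 → Ω → Space d}

theorem measurable_path_fst {B : ℝ≥0 → Ω → Space d} (hc : ∀ ω, Continuous fun t => B t ω)
    (hm : ∀ t, Measurable (B t)) :
    Measurable (Function.uncurry fun (q : ℝ × ℝ) ω => B q.1.toNNReal ω) :=
  (measurable_path hc hm).comp ((measurable_fst.comp measurable_fst).prodMk measurable_snd)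

theorem measurable_path_snd {B : ℝ≥0 → Ω → Space d} (hc : ∀ ω, Continuous fun t => B t ω)
    (hm : ∀ t, Measurable (B t)) :
    Measurable (Function.uncurry fun (q : ℝ × ℝ) ω => B q.2.toNNReal ω) :=
  (measurable_path hc hm).comp ((measurable_snd.comp measurable_fst).prodMk measurable_snd)

theorem measurable_path_sub (hc₁ : ∀ ω, Continuous fun t => B₁ t ω) (hm₁ : ∀ t, Measurable (B₁ t))
    (hc₂ : ∀ ω, Continuous fun t => B₂ t ω) (hm₂ : ∀ t, Measurable (B₂ t)) :
    Measurable (Function.uncurry fun (q : ℝ × ℝ) ω => B₁ q.1.toNNReal ω - B₂ q.2.toNNReal ω) :=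
  (measurable_path_fst hc₁ hm₁).sub (measurable_path_snd hc₂ hm₂)

theorem measurable_mutualLocalTime (hc₁ : ∀ ω, Continuous fun t => B₁ t ω)
    (hm₁ : ∀ t, Measurable (B₁ t)) (hc₂ : ∀ ω, Continuous fun t => B₂ t ω)
    (hm₂ : ∀ t, Measurable (B₂ t)) (ε : ℝ) :
    Measurable fun ω => mutualLocalTime μ ν ε (fun t => B₁ t ω) (fun t => B₂ t ω) :=
  Measurable.lintegral_prod_left' (measurable_path_sub hc₁ hm₁ hc₂ hm₂).gaussMixture

/-- Mixed moments of the smoothed local times increase as the smoothing parameters decrease. -/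
theorem lintegral_prod_mutualLocalTime_antitone (hB₁ : IsBrownian B₁ P) (hB₂ : IsBrownian B₂ P)
    (hI : IndepFun (fun (ω : Ω) (t : ℝ≥0) => B₁ t ω) (fun (ω : Ω) (t : ℝ≥0) => B₂ t ω) P)
    (hc₁ : ∀ ω, Continuous fun t => B₁ t ω) (hc₂ : ∀ ω, Continuous fun t => B₂ t ω)
    (hμ : ∀ᵐ w ∂μ, 0 < w) {n : ℕ} {ε δ : Fin n → ℝ} (hε : ∀ i, 0 < ε i) (h : ∀ i, ε i ≤ δ i) :
    ∫⁻ ω, ∏ i, mutualLocalTime μ ν (δ i) (fun t => B₁ t ω) (fun t => B₂ t ω) ∂P ≤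
      ∫⁻ ω, ∏ i, mutualLocalTime μ ν (ε i) (fun t => B₁ t ω) (fun t => B₂ t ω) ∂P := by
  have hX := measurable_path_sub hc₁ hB₁.measurable hc₂ hB₂.measurable
  have h1 := lintegral_prod_lintegral_gaussMixture (μ := μ) (ν := ν) (P := P) hX ε
  have h2 := lintegral_prod_lintegral_gaussMixture (μ := μ) (ν := ν) (P := P) hX δ
  simp only [mutualLocalTime]
  rw [h1, h2]
  refine lintegral_mono fun q => ?_
  exact lintegral_prod_gaussMixture_antitone P hμ
    (fun i => (hB₁.measurable _).sub (hB₂.measurable _))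
    (jointCharFun_sub_re_nonneg hB₁ hB₂ hI (fun i => (q i).1.toNNReal) fun i => (q i).2.toNNReal)
    hε h

/-- The moments of the mutual local time are at most the mean of those of two self-functionals, in
each of which only one of the motions occurs. -/
theorem lintegral_mutualLocalTime_pow_le_half (hB₁ : IsBrownian B₁ P) (hB₂ : IsBrownian B₂ P)
    (hI : IndepFun (fun (ω : Ω) (t : ℝ≥0) => B₁ t ω) (fun (ω : Ω) (t : ℝ≥0) => B₂ t ω) P)
    (hc₁ : ∀ ω, Continuous fun t => B₁ t ω) (hc₂ : ∀ ω, Continuous fun t => B₂ t ω)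
    (hμ : ∀ᵐ w ∂μ, 0 < w) {ε : ℝ} (hε : 0 < ε) (n : ℕ) :
    ∫⁻ ω, mutualLocalTime μ ν ε (fun t => B₁ t ω) (fun t => B₂ t ω) ^ n ∂P ≤
      2⁻¹ * (∫⁻ ω, (∫⁻ q, gaussMixture d μ ε (√2 • B₁ q.1.toNNReal ω) ∂ν) ^ n ∂P +
        ∫⁻ ω, (∫⁻ q, gaussMixture d μ ε (√2 • B₂ q.2.toNNReal ω) ∂ν) ^ n ∂P) := by
  have hX := measurable_path_sub hc₁ hB₁.measurable hc₂ hB₂.measurable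
  have hY : Measurable (Function.uncurry fun (q : ℝ × ℝ) ω => √2 • B₁ q.1.toNNReal ω) :=
    (measurable_path_fst hc₁ hB₁.measurable).const_smul (√2 : ℝ)
  have hZ : Measurable (Function.uncurry fun (q : ℝ × ℝ) ω => √2 • B₂ q.2.toNNReal ω) :=
    (measurable_path_snd hc₂ hB₂.measurable).const_smul (√2 : ℝ)
  have h1 := lintegral_prod_lintegral_gaussMixture (μ := μ) (ν := ν) (P := P) hX
    fun _ : Fin n => ε
  have h2 := lintegral_prod_lintegral_gaussMixture (μ := μ) (ν := ν) (P := P) hY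
    fun _ : Fin n => ε
  have h3 := lintegral_prod_lintegral_gaussMixture (μ := μ) (ν := ν) (P := P) hZ
    fun _ : Fin n => ε
  simp only [Finset.prod_const, Finset.card_univ, Fintype.card_fin] at h1 h2 h3
  simp only [mutualLocalTime]
  rw [h1, h2, h3, ← lintegral_add_left, ← lintegral_const_mul' _ _ (by simp)]
  · refine lintegral_mono fun q => ?_
    exact lintegral_prod_gaussMixture_le P hμ
      (fun i => (hB₁.measurable _).sub (hB₂.measurable _))
      (fun i => (hB₁.measurable _).const_smul (√2 : ℝ))
      (fun i => (hB₂.measurable _).const_smul (√2 : ℝ))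
      (jointCharFun_sub_re_nonneg hB₁ hB₂ hI (fun i => (q i).1.toNNReal) fun i => (q i).2.toNNReal)
      (fun ξ => hB₁.jointCharFun_smul_re_nonneg (fun i => (q i).1.toNNReal) ξ (√2 : ℝ))
      (fun ξ => hB₂.jointCharFun_smul_re_nonneg (fun i => (q i).2.toNNReal) ξ (√2 : ℝ))
      (jointCharFun_sub_re_le hB₁ hB₂ hI (fun i => (q i).1.toNNReal) fun i => (q i).2.toNNReal)
      (fun _ => hε)
  · refine Measurable.lintegral_prod_right' (f := fun p : (Fin n → ℝ × ℝ) × Ω =>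
      ∏ i, gaussMixture d μ ε (√2 • B₁ (p.1 i).1.toNNReal p.2)) ?_
    refine Finset.measurable_prod _ fun i _ => Measurable.gaussMixture ?_
    have h4 : Measurable fun p : (Fin n → ℝ × ℝ) × Ω => (p.1 i, p.2) :=
      ((measurable_pi_apply i).comp measurable_fst).prodMk measurable_snd
    exact hY.comp h4

variable {D κ : ℝ} {N : ℝ≥0} {t : ℝ}

/-- Moment bound for the smoothed mutual local time, uniform in the smoothing. -/
theorem lintegral_mutualLocalTime_pow_le (hB₁ : IsBrownian B₁ P) (hB₂ : IsBrownian B₂ P)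
    (hI : IndepFun (fun (ω : Ω) (t : ℝ≥0) => B₁ t ω) (fun (ω : Ω) (t : ℝ≥0) => B₂ t ω) P)
    (hc₁ : ∀ ω, Continuous fun t => B₁ t ω) (hc₂ : ∀ ω, Continuous fun t => B₂ t ω)
    (hμ : ∀ᵐ w ∂μ, 0 < w) {ε : ℝ} (hε : 0 < ε) (hD : 0 < D) (hκ : 0 < κ) (hκ1 : κ ≤ 1)
    (hF : ∀ w, 0 < w → ∀ x, gaussMixture d μ w x ≤ ENNReal.ofReal (D * w ^ (κ - 1)))
    (ht : 0 < t) (hν₁ : ν.map Prod.fst ≤ (N : ℝ≥0∞) • volume.restrict (Set.Ioc 0 t))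
    (hν₂ : ν.map Prod.snd ≤ (N : ℝ≥0∞) • volume.restrict (Set.Ioc 0 t)) (n : ℕ) :
    ∫⁻ ω, mutualLocalTime μ ν ε (fun t => B₁ t ω) (fun t => B₂ t ω) ^ n ∂P ≤
      ENNReal.ofReal (n.factorial * (D * 2 ^ (κ - 1) * N * Real.Gamma κ * t ^ κ) ^ n /
        Real.Gamma (n * κ + 1)) := by
  have hΓ := Real.Gamma_pos_of_pos hκ
  have hΓn := Real.Gamma_pos_of_pos (show (0 : ℝ) < n * κ + 1 by positivity)
  have key : ∀ (B : ℝ≥0 → Ω → Space d) (p : ℝ × ℝ → ℝ), IsBrownian B P →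
      (∀ ω, Continuous fun t => B t ω) → Measurable p →
      ν.map p ≤ (N : ℝ≥0∞) • volume.restrict (Set.Ioc 0 t) →
      ∫⁻ ω, (∫⁻ q, gaussMixture d μ ε (√2 • B (p q).toNNReal ω) ∂ν) ^ n ∂P ≤
        ENNReal.ofReal (n.factorial * (D * 2 ^ (κ - 1) * N * Real.Gamma κ * t ^ κ) ^ n /
          Real.Gamma (n * κ + 1)) := by
    intro B p hB hc hp hν
    calc _ ≤ ∫⁻ ω, (N : ℝ≥0∞) ^ n * occupation μ ε (fun u => B u ω) t ^ n ∂P := by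
          refine lintegral_mono fun ω => ?_
          rw [← mul_pow]
          gcongr
          exact lintegral_gaussMixture_le_occupation (hc ω) hp hν
      _ ≤ (N : ℝ≥0∞) ^ n * ENNReal.ofReal (n.factorial *
          (D * 2 ^ (κ - 1) * Real.Gamma κ * t ^ κ) ^ n / Real.Gamma (n * κ + 1)) := by
          rw [lintegral_const_mul' _ _ (by finiteness)]
          gcongr
          exact hB.lintegral_occupation_pow_le hc hμ hε hD hκ hκ1 hF n ht
      _ = _ := by
          rw [← ENNReal.ofReal_coe_nnreal, ← ENNReal.ofReal_pow N.coe_nonneg,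
            ← ENNReal.ofReal_mul (by positivity)]
          congr 1
          rw [show D * 2 ^ (κ - 1) * N * Real.Gamma κ * t ^ κ =
            N * (D * 2 ^ (κ - 1) * Real.Gamma κ * t ^ κ) by ring, mul_pow (N : ℝ)]
          ring
  refine (lintegral_mutualLocalTime_pow_le_half hB₁ hB₂ hI hc₁ hc₂ hμ hε n).trans ?_
  calc _ ≤ _ := mul_le_mul_right (add_le_add (key B₁ Prod.fst hB₁ hc₁ measurable_fst hν₁)
        (key B₂ Prod.snd hB₂ hc₂ measurable_snd hν₂)) _
    _ = _ := by
        rw [← two_mul, ← mul_assoc, ENNReal.inv_mul_cancel two_ne_zero ENNReal.ofNat_ne_top,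
          one_mul]

end Moments

/-! ### A criterion for convergence in all `L^p` -/

/-- A bounded family of vectors of a Hilbert space with `‖u ε‖² ≤ ⟪u ε, u δ⟫` for `δ ≤ ε` converges
as `ε ↓ 0`. -/
theorem exists_tendsto_of_inner_le {H : Type*} [NormedAddCommGroup H] [InnerProductSpace ℝ H]
    [CompleteSpace H] {u : ℝ → H} {C : ℝ} (hC : ∀ ε, 0 < ε → ‖u ε‖ ≤ C)
    (h : ∀ ε δ, 0 < δ → δ ≤ ε → ‖u ε‖ ^ 2 ≤ ⟪u ε, u δ⟫) :
    ∃ L, Tendsto u (𝓝[>] 0) (𝓝 L) := by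
  have hd : ∀ ε δ, 0 < δ → δ ≤ ε → dist (u ε) (u δ) ^ 2 ≤ ‖u δ‖ ^ 2 - ‖u ε‖ ^ 2 := by
    intro ε δ hδ hle
    rw [dist_eq_norm, norm_sub_sq_real]
    linarith [h ε δ hδ hle]
  have hanti : AntitoneOn (fun ε => ‖u ε‖ ^ 2) (Set.Ioi 0) := fun δ hδ ε _ hle => by
    have := hd ε δ hδ hle
    simp only
    nlinarith [sq_nonneg (dist (u ε) (u δ))]
  have hbdd : BddAbove ((fun ε => ‖u ε‖ ^ 2) '' Set.Ioi 0) := by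
    refine ⟨C ^ 2, ?_⟩
    rintro _ ⟨ε, hε, rfl⟩
    exact pow_le_pow_left₀ (norm_nonneg _) (hC ε hε) 2
  have hlim := hanti.tendsto_nhdsGT hbdd
  set S := sSup ((fun ε => ‖u ε‖ ^ 2) '' Set.Ioi 0)
  refine cauchy_map_iff_exists_tendsto.1 (Metric.cauchy_iff.2 ⟨inferInstance, fun e he => ?_⟩)
  have hev : ∀ᶠ ε in 𝓝[>] (0 : ℝ), S - e ^ 2 < ‖u ε‖ ^ 2 :=
    hlim.eventually (lt_mem_nhds (by linarith [sq_pos_of_pos he]))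
  refine ⟨u '' {ε | 0 < ε ∧ S - e ^ 2 < ‖u ε‖ ^ 2}, image_mem_map ?_, ?_⟩
  · exact Filter.inter_mem self_mem_nhdsWithin hev
  · have key : ∀ ε δ, 0 < δ → δ ≤ ε → S - e ^ 2 < ‖u ε‖ ^ 2 → dist (u ε) (u δ) < e := by
      intro ε δ hδ hle hlt
      have h1 : ‖u δ‖ ^ 2 ≤ S := le_csSup hbdd ⟨δ, hδ, rfl⟩
      have h2 := hd ε δ hδ hle
      exact lt_of_pow_lt_pow_left₀ 2 he.le (by linarith)
    rintro _ ⟨ε, ⟨hε, hε'⟩, rfl⟩ _ ⟨δ, ⟨hδ, hδ'⟩, rfl⟩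
    rcases le_total δ ε with hle | hle
    · exact key ε δ hδ hle hε'
    · rw [dist_comm]
      exact key δ ε hε hle hδ'

section Lp

variable {Ω : Type*} [MeasurableSpace Ω] {P : Measure Ω}

theorem eLpNorm_natCast {f : Ω → ℝ} {n : ℕ} (hn : n ≠ 0) :
    eLpNorm f n P = (∫⁻ ω, ‖f ω‖ₑ ^ n ∂P) ^ (1 / (n : ℝ)) := by
  rw [eLpNorm_eq_lintegral_rpow_enorm_toReal (by exact_mod_cast hn) (ENNReal.natCast_ne_top n)]
  simp

theorem eLpNorm_natCast_pow {f : Ω → ℝ} {n : ℕ} (hn : n ≠ 0) :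
    eLpNorm f n P ^ n = ∫⁻ ω, ‖f ω‖ₑ ^ n ∂P := by
  rw [eLpNorm_natCast hn, ← ENNReal.rpow_natCast, ← ENNReal.rpow_mul, one_div,
    inv_mul_cancel₀ (by exact_mod_cast hn), ENNReal.rpow_one]

/-- Interpolation between `L²` and a higher moment, a case of the Cauchy-Schwarz inequality. -/
theorem eLpNorm_succ_pow_le {f : Ω → ℝ} (hf : AEStronglyMeasurable f P) {n : ℕ} (hn : n ≠ 0) :
    eLpNorm f (n + 1 : ℕ) P ^ (n + 1) ≤ eLpNorm f 2 P * eLpNorm f (2 * n : ℕ) P ^ n := by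
  rw [eLpNorm_natCast_pow n.succ_ne_zero]
  have h := ENNReal.lintegral_mul_le_Lp_mul_Lq P Real.HolderConjugate.two_two
    (f := fun ω => ‖f ω‖ₑ) (g := fun ω => ‖f ω‖ₑ ^ n) hf.enorm (hf.enorm.pow_const n)
  have e2 : eLpNorm f 2 P = (∫⁻ ω, ‖f ω‖ₑ ^ (2 : ℝ) ∂P) ^ (1 / (2 : ℝ)) := by
    rw [eLpNorm_eq_lintegral_rpow_enorm_toReal two_ne_zero ENNReal.ofNat_ne_top]
    simp
  have e3 : eLpNorm f (2 * n : ℕ) P ^ n =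
      (∫⁻ ω, (‖f ω‖ₑ ^ n) ^ (2 : ℝ) ∂P) ^ (1 / (2 : ℝ)) := by
    have hi : ∀ ω, (‖f ω‖ₑ ^ n) ^ (2 : ℝ) = ‖f ω‖ₑ ^ (2 * n) := fun ω => by
      rw [ENNReal.rpow_ofNat, ← pow_mul, mul_comm]
    simp_rw [hi]
    rw [← eLpNorm_natCast_pow (by omega), mul_comm 2 n, pow_mul, ← ENNReal.rpow_ofNat,
      ← ENNReal.rpow_mul]
    norm_num
  rw [e2, e3]
  refine le_trans (le_of_eq ?_) h
  exact lintegral_congr fun ω => by rw [Pi.mul_apply, pow_succ']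

/-- A criterion for convergence in all `L^p`: moments bounded uniformly, and mixed second moments
which increase as the parameters decrease. -/
theorem convergesInLp_of_antitone [IsProbabilityMeasure P] {X : ℝ → Ω → ℝ}
    (hm : ∀ ε, 0 < ε → AEStronglyMeasurable (X ε) P)
    (h0 : ∀ ε ω, 0 ≤ X ε ω)
    (hb : ∀ n : ℕ, ∃ C : ℝ≥0∞, C ≠ ∞ ∧ ∀ ε, 0 < ε → ∫⁻ ω, ENNReal.ofReal (X ε ω) ^ n ∂P ≤ C)
    (hanti : ∀ ε δ, 0 < δ → δ ≤ ε → ∫⁻ ω, ENNReal.ofReal (X ε ω) * ENNReal.ofReal (X ε ω) ∂P ≤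
      ∫⁻ ω, ENNReal.ofReal (X ε ω) * ENNReal.ofReal (X δ ω) ∂P) :
    ConvergesInLp X P := by
  have hb' : ∀ n : ℕ, n ≠ 0 → ∃ C : ℝ≥0∞, C ≠ ∞ ∧ ∀ ε, 0 < ε → eLpNorm (X ε) n P ≤ C := by
    intro n hn
    obtain ⟨C, hC, hle⟩ := hb n
    refine ⟨C ^ (1 / (n : ℝ)), ENNReal.rpow_ne_top_of_nonneg (by positivity) hC, fun ε hε => ?_⟩
    rw [eLpNorm_natCast hn]
    refine ENNReal.rpow_le_rpow ?_ (by positivity)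
    simpa only [Real.enorm_of_nonneg (h0 ε _)] using hle ε hε
  have hmem : ∀ (n : ℕ) ε, n ≠ 0 → 0 < ε → MemLp (X ε) n P := fun n ε hn hε => by
    obtain ⟨C, hC, hle⟩ := hb' n hn
    exact ⟨hm ε hε, (hle ε hε).trans_lt hC.lt_top⟩
  -- nothing is known for `ε ≤ 0`, but a family in `L²` needs a value there
  let Y : ℝ → Ω → ℝ := fun ε => if 0 < ε then X ε else 0
  have hY : ∀ ε, 0 < ε → Y ε = X ε := fun ε hε => if_pos hε
  have hYm : ∀ ε, MemLp (Y ε) 2 P := fun ε => by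
    by_cases hε : 0 < ε
    · rw [hY ε hε]
      exact_mod_cast hmem 2 ε two_ne_zero hε
    · simp [Y, hε]
  let u : ℝ → Lp ℝ 2 P := fun ε => (hYm ε).toLp (Y ε)
  have hinner : ∀ ε δ, 0 < ε → 0 < δ → ⟪u ε, u δ⟫ =
      (∫⁻ ω, ENNReal.ofReal (X ε ω) * ENNReal.ofReal (X δ ω) ∂P).toReal := by
    intro ε δ hε hδ
    rw [L2.inner_def]
    have : ∀ᵐ ω ∂P, ⟪u ε ω, u δ ω⟫ = X ε ω * X δ ω := by
      filter_upwards [(hYm ε).coeFn_toLp, (hYm δ).coeFn_toLp] with ω h1 h2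
      rw [h1, h2, hY ε hε, hY δ hδ]
      exact mul_comm _ _
    rw [integral_congr_ae this, integral_eq_lintegral_of_nonneg_ae
      (Eventually.of_forall fun ω => mul_nonneg (h0 _ _) (h0 _ _)) ((hm ε hε).mul (hm δ hδ))]
    congr 1
    exact lintegral_congr fun ω => ENNReal.ofReal_mul (h0 _ _)
  obtain ⟨C₂, hC₂, hle₂⟩ := hb' 2 two_ne_zero
  obtain ⟨L, hL⟩ := exists_tendsto_of_inner_le (u := u) (C := C₂.toReal)
    (fun ε hε => by
      rw [Lp.norm_toLp, hY ε hε]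
      exact ENNReal.toReal_mono hC₂ (by exact_mod_cast hle₂ ε hε))
    (fun ε δ hδ hle => by
      have hε := hδ.trans_le hle
      rw [← real_inner_self_eq_norm_sq, hinner ε ε hε hε, hinner ε δ hε hδ]
      refine ENNReal.toReal_mono ?_ (hanti ε δ hδ hle)
      have h2 : ∀ ω, ENNReal.ofReal (X ε ω) * ENNReal.ofReal (X δ ω) =
          ‖X ε ω * X δ ω‖ₑ := fun ω => by
        rw [enorm_mul, Real.enorm_of_nonneg (h0 _ _), Real.enorm_of_nonneg (h0 _ _)]
      rw [lintegral_congr h2]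
      exact (MemLp.integrable_mul (p := 2) (q := 2) (by exact_mod_cast hmem 2 ε two_ne_zero hε)
        (by exact_mod_cast hmem 2 δ two_ne_zero hδ)).2.ne)
  have hpos : ∀ᶠ ε : ℝ in 𝓝[>] 0, 0 < ε := self_mem_nhdsWithin
  have hT : Tendsto (fun ε => eLpNorm (Y ε - ⇑L) 2 P) (𝓝[>] 0) (𝓝 0) := by
    refine ((Lp.tendsto_Lp_iff_tendsto_eLpNorm' u L).1 hL).congr fun ε => eLpNorm_congr_ae ?_
    exact (hYm ε).coeFn_toLp.sub EventuallyEq.rfl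
  have hTm : TendstoInMeasure P Y (𝓝[>] 0) (⇑L) := tendstoInMeasure_of_tendsto_eLpNorm two_ne_zero
    (fun ε => (hYm ε).1) (Lp.aestronglyMeasurable L) hT
  -- Fatou's lemma along an almost surely convergent subsequence bounds the moments of the limit
  have hLb : ∀ n : ℕ, n ≠ 0 → MemLp (⇑L) n P := fun n hn => by
    obtain ⟨C, hC, hle⟩ := hb' n hn
    obtain ⟨ns, hns, hae⟩ := hTm.exists_seq_tendsto_ae'
    have hev : ∀ᶠ k in atTop, eLpNorm (Y (ns k)) n P ≤ C :=
      (hns.eventually hpos).mono fun k hk => by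
        rw [hY _ hk]
        exact hle _ hk
    exact ⟨Lp.aestronglyMeasurable L,
      (Lp.eLpNorm_le_of_ae_tendsto hev (fun k => (hYm _).1) hae).trans_lt hC.lt_top⟩
  refine ⟨⇑L, fun p hp2 hp => ?_⟩
  obtain ⟨n, hn⟩ := exists_nat_ge p.toReal
  have hpn : p ≤ (n : ℝ≥0∞) := by
    rw [← ENNReal.ofReal_toReal hp, ← ENNReal.ofReal_natCast]
    exact ENNReal.ofReal_le_ofReal hn
  have hn0 : n ≠ 0 := by
    rintro rfl
    simp only [Nat.cast_zero, nonpos_iff_eq_zero] at hpn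
    simp [hpn] at hp2
  refine ⟨fun ε hε => (hmem n ε hn0 hε).mono_exponent hpn, (hLb n hn0).mono_exponent hpn, ?_⟩
  obtain ⟨C, hC, hle⟩ := hb' (2 * n) (by omega)
  have hLC := (hLb (2 * n) (by omega)).2
  have hlim : Tendsto (fun ε => (eLpNorm (Y ε - ⇑L) 2 P * (C + eLpNorm (⇑L) (2 * n : ℕ) P) ^ n) ^
      (1 / ((n + 1 : ℕ) : ℝ))) (𝓝[>] 0) (𝓝 0) := by
    have h1 := ENNReal.Tendsto.mul_const hT
      (Or.inr (show (C + eLpNorm (⇑L) (2 * n : ℕ) P) ^ n ≠ ∞ from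
        ENNReal.pow_ne_top (ENNReal.add_ne_top.2 ⟨hC, hLC.ne⟩)))
    rw [zero_mul] at h1
    have h2 := h1.ennrpow_const (1 / ((n + 1 : ℕ) : ℝ))
    rwa [ENNReal.zero_rpow_of_pos (by positivity)] at h2
  have hbound : ∀ ε, 0 < ε → eLpNorm (X ε - ⇑L) p P ≤
      (eLpNorm (Y ε - ⇑L) 2 P * (C + eLpNorm (⇑L) (2 * n : ℕ) P) ^ n) ^
        (1 / ((n + 1 : ℕ) : ℝ)) := by
    intro ε hε
    have hmm : AEStronglyMeasurable (X ε - ⇑L) P := (hm ε hε).sub (Lp.aestronglyMeasurable L)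
    have hsub : eLpNorm (X ε - ⇑L) (2 * n : ℕ) P ≤ C + eLpNorm (⇑L) (2 * n : ℕ) P :=
      (eLpNorm_sub_le (hm ε hε) (Lp.aestronglyMeasurable L)
        (by exact_mod_cast (show 1 ≤ 2 * n by omega))).trans (add_le_add_left (hle ε hε) _)
    have hpow : eLpNorm (X ε - ⇑L) (n + 1 : ℕ) P =
        (eLpNorm (X ε - ⇑L) (n + 1 : ℕ) P ^ (n + 1)) ^ (1 / ((n + 1 : ℕ) : ℝ)) := by
      rw [← ENNReal.rpow_natCast, ← ENNReal.rpow_mul, mul_one_div_cancel (by positivity),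
        ENNReal.rpow_one]
    have hsucc : eLpNorm (X ε - ⇑L) (n + 1 : ℕ) P ^ (n + 1) ≤
        eLpNorm (Y ε - ⇑L) 2 P * (C + eLpNorm (⇑L) (2 * n : ℕ) P) ^ n := by
      rw [hY ε hε]
      exact (eLpNorm_succ_pow_le hmm hn0).trans (mul_le_mul_right (pow_le_pow_left' hsub n) _)
    refine (eLpNorm_le_eLpNorm_of_exponent_le
      (hpn.trans (Nat.cast_le.2 n.le_succ)) hmm).trans ?_
    rw [hpow]
    exact ENNReal.rpow_le_rpow hsucc (by positivity)
  exact tendsto_of_tendsto_of_tendsto_of_le_of_le' tendsto_const_nhds hlim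
    (Eventually.of_forall fun ε => zero_le) (hpos.mono hbound)

end Lp

/-! ### The Riesz, Bessel, heat and Poisson kernels as Gaussian mixtures -/

/-- The inverse gamma integral, from Euler's integral by the substitution `s ↦ 1/s`. -/
theorem lintegral_rpow_mul_exp_neg_div {b A : ℝ} (hb : 0 < b) (hA : 0 < A) :
    ∫⁻ s in Set.Ioi (0 : ℝ), ENNReal.ofReal (s ^ (-b - 1) * Real.exp (-(A / s))) =
      ENNReal.ofReal (Real.Gamma b * A ^ (-b)) := by
  have himg : (fun x : ℝ => x⁻¹) '' Set.Ioi 0 = Set.Ioi 0 := by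
    ext x
    refine ⟨?_, fun hx => ⟨x⁻¹, inv_pos.2 (Set.mem_Ioi.1 hx), inv_inv x⟩⟩
    rintro ⟨y, hy, rfl⟩
    exact inv_pos.2 (Set.mem_Ioi.1 hy)
  have h := lintegral_image_eq_lintegral_abs_deriv_mul (s := Set.Ioi (0 : ℝ))
    (f := fun x => x⁻¹) (f' := fun x => -(x ^ 2)⁻¹) measurableSet_Ioi
    (fun x hx => (hasDerivAt_inv (ne_of_gt hx)).hasDerivWithinAt)
    inv_injective.injOn (fun s => ENNReal.ofReal (s ^ (-b - 1) * Real.exp (-(A / s))))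
  rw [himg] at h
  rw [h]
  have hI := Real.integral_rpow_mul_exp_neg_mul_Ioi hb hA
  have hint : IntegrableOn (fun x : ℝ => x ^ (b - 1) * Real.exp (-(A * x))) (Set.Ioi 0) := by
    refine Integrable.of_integral_ne_zero ?_
    rw [hI]
    have := Real.Gamma_pos_of_pos hb
    positivity
  rw [one_div, Real.inv_rpow hA.le, ← Real.rpow_neg hA.le, mul_comm] at hI
  rw [← hI, ofReal_integral_eq_lintegral_ofReal hint
    ((ae_restrict_mem measurableSet_Ioi).mono fun x (hx : 0 < x) => by positivity)]
  refine setLIntegral_congr_fun measurableSet_Ioi fun x (hx : 0 < x) => ?_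
  rw [← ENNReal.ofReal_mul (abs_nonneg _)]
  congr 1
  rw [abs_neg, abs_of_pos (by positivity), div_inv_eq_mul, ← mul_assoc, Real.inv_rpow hx.le,
    ← Real.rpow_neg hx.le, ← Real.rpow_natCast x 2, ← Real.rpow_neg hx.le, ← Real.rpow_add hx]
  congr 2
  push_cast
  ring

/-- The measure on the half-line with density `ρ`. -/
noncomputable def mixingMeasure (ρ : ℝ → ℝ) : Measure ℝ :=
  (volume.restrict (Set.Ioi 0)).withDensity fun w => ENNReal.ofReal (ρ w)

section Mixing

variable {d : ℕ} {ρ : ℝ → ℝ}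

instance sigmaFinite_mixingMeasure : SigmaFinite (mixingMeasure ρ) := by
  unfold mixingMeasure
  exact SigmaFinite.withDensity_ofReal _

theorem ae_mixingMeasure_pos : ∀ᵐ w ∂mixingMeasure ρ, 0 < w :=
  (withDensity_absolutelyContinuous _ _).ae_le (ae_restrict_mem measurableSet_Ioi)

theorem lintegral_mixingMeasure (hρ : Measurable ρ) {g : ℝ → ℝ≥0∞} (hg : Measurable g) :
    ∫⁻ w, g w ∂mixingMeasure ρ = ∫⁻ w in Set.Ioi 0, ENNReal.ofReal (ρ w) * g w := by
  rw [mixingMeasure, lintegral_withDensity_eq_lintegral_mul _ hρ.ennreal_ofReal hg]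
  rfl

theorem heatKernel_le_apply_zero {t s : ℝ} (ht : 0 < t) (hts : t ≤ s) (x : Space d) :
    heatKernel d s x ≤ heatKernel d t 0 := by
  have hs : 0 < s := ht.trans_le hts
  have hd : (0 : ℝ) ≤ d := d.cast_nonneg
  unfold heatKernel
  have h1 : Real.exp (-‖x‖ ^ 2 / (2 * s)) ≤ 1 := by
    rw [Real.exp_le_one_iff]
    exact div_nonpos_of_nonpos_of_nonneg (by nlinarith [sq_nonneg ‖x‖]) (by positivity)
  have h2 : (2 * Real.pi * s) ^ (-(d : ℝ) / 2) ≤ (2 * Real.pi * t) ^ (-(d : ℝ) / 2) :=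
    Real.rpow_le_rpow_of_nonpos (by positivity) (by gcongr) (by linarith)
  have h3 : Real.exp (-‖(0 : Space d)‖ ^ 2 / (2 * t)) = 1 := by simp
  rw [h3, mul_one]
  calc _ ≤ (2 * Real.pi * s) ^ (-(d : ℝ) / 2) * 1 := by gcongr
    _ ≤ _ := by rwa [mul_one]

theorem gaussMixture_le_lintegral_zero {μ : Measure ℝ} (hμ : ∀ᵐ w ∂μ, 0 < w) {w : ℝ} (hw : 0 ≤ w)
    (x : Space d) : gaussMixture d μ w x ≤ ∫⁻ s, ENNReal.ofReal (heatKernel d s 0) ∂μ := by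
  refine lintegral_mono_ae (hμ.mono fun s hs => ENNReal.ofReal_le_ofReal ?_)
  exact heatKernel_le_apply_zero hs (by linarith) x

theorem heatKernel_eq_rpow_mul {w : ℝ} (hw : 0 < w) (x : Space d) :
    heatKernel d w x =
      (2 * Real.pi) ^ (-(d : ℝ) / 2) * (w ^ (-(d : ℝ) / 2) * Real.exp (-(‖x‖ ^ 2 / 2 / w))) := by
  rw [heatKernel, Real.mul_rpow (by positivity) hw.le, mul_assoc]
  congr 3
  field_simp

/-- Mixing with a density dominated by `w^{α/2-1}` gives the decay `w^{-(d-α)/2}`. -/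
theorem exists_gaussMixture_mixingMeasure_le {α c : ℝ} (hα : 0 < α) (hαd : α < d) (hc : 0 ≤ c)
    (hρm : Measurable ρ) (hρ : ∀ s, 0 < s → ρ s ≤ c * s ^ (α / 2 - 1)) :
    ∃ D, 0 < D ∧ ∀ w, 0 < w → ∀ x,
      gaussMixture d (mixingMeasure ρ) w x ≤ ENNReal.ofReal (D * w ^ (-((d : ℝ) - α) / 2)) := by
  have hb : 0 < ((d : ℝ) - α) / 2 := by linarith
  set b := ((d : ℝ) - α) / 2 with hb_def
  have hd : (0 : ℝ) ≤ d := d.cast_nonneg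
  have hp : 0 < (2 * Real.pi) ^ (-(d : ℝ) / 2) := by positivity
  set p := (2 * Real.pi) ^ (-(d : ℝ) / 2) with hp_def
  refine ⟨c * p * (2 / α + 1 / b) + 1, by positivity, fun w hw x => ?_⟩
  have hker : ∀ s, 0 < s → heatKernel d (s + w) x ≤ p * (s + w) ^ (-(d : ℝ) / 2) := by
    intro s hs
    rw [heatKernel_eq_rpow_mul (by positivity)]
    have : Real.exp (-(‖x‖ ^ 2 / 2 / (s + w))) ≤ 1 := by
      rw [Real.exp_le_one_iff, neg_nonpos]; positivity
    calc _ ≤ p * ((s + w) ^ (-(d : ℝ) / 2) * 1) := by gcongr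
      _ = _ := by rw [mul_one]
  have hpt : ∀ s, 0 < s → ENNReal.ofReal (ρ s) * ENNReal.ofReal (heatKernel d (s + w) x) ≤
      ENNReal.ofReal (c * p) * ENNReal.ofReal (s ^ (α / 2 - 1) * (s + w) ^ (-(d : ℝ) / 2)) := by
    intro s hs
    rw [← ENNReal.ofReal_mul' (heatKernel_nonneg d (by positivity) _),
      ← ENNReal.ofReal_mul (by positivity)]
    refine ENNReal.ofReal_le_ofReal ?_
    calc _ ≤ (c * s ^ (α / 2 - 1)) * (p * (s + w) ^ (-(d : ℝ) / 2)) :=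
          mul_le_mul (hρ s hs) (hker s hs) (heatKernel_nonneg d (by positivity) _) (by positivity)
      _ = _ := by ring
  -- `s + w` is at least `w`, which serves on `(0, w]`, and at least `s`, which serves beyond `w`
  have h1 : ∫⁻ s in Set.Ioc 0 w, ENNReal.ofReal (s ^ (α / 2 - 1) * (s + w) ^ (-(d : ℝ) / 2)) ≤
      ENNReal.ofReal (2 / α * w ^ (-b)) := by
    calc _ ≤ ∫⁻ s in Set.Ioc 0 w,
          ENNReal.ofReal (w ^ (-(d : ℝ) / 2)) * ENNReal.ofReal (s ^ (α / 2 - 1)) := by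
          refine setLIntegral_mono' measurableSet_Ioc fun s hs => ?_
          have hs0 := hs.1
          rw [← ENNReal.ofReal_mul (by positivity), mul_comm]
          refine ENNReal.ofReal_le_ofReal (mul_le_mul_of_nonneg_right ?_ (by positivity))
          exact Real.rpow_le_rpow_of_nonpos hw (by linarith) (by linarith)
      _ = _ := by
          rw [lintegral_const_mul' _ _ ENNReal.ofReal_ne_top,
            lintegral_rpow_sub_one (half_pos hα) hw, ← ENNReal.ofReal_mul (by positivity)]
          congr 1
          rw [show -b = -(d : ℝ) / 2 + α / 2 by rw [hb_def]; ring, Real.rpow_add hw]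
          field_simp
  have h2 : ∫⁻ s in Set.Ioi w, ENNReal.ofReal (s ^ (α / 2 - 1) * (s + w) ^ (-(d : ℝ) / 2)) ≤
      ENNReal.ofReal (1 / b * w ^ (-b)) := by
    have hlt : -b - 1 < -1 := by linarith
    calc _ ≤ ∫⁻ s in Set.Ioi w, ENNReal.ofReal (s ^ (-b - 1)) := by
          refine setLIntegral_mono' measurableSet_Ioi fun s (hs : w < s) => ?_
          have hs0 := hw.trans hs
          refine ENNReal.ofReal_le_ofReal ?_
          rw [show -b - 1 = (α / 2 - 1) + -(d : ℝ) / 2 by rw [hb_def]; ring, Real.rpow_add hs0]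
          refine mul_le_mul_of_nonneg_left ?_ (by positivity)
          exact Real.rpow_le_rpow_of_nonpos hs0 (by linarith) (by linarith)
      _ = ENNReal.ofReal (∫ s in Set.Ioi w, s ^ (-b - 1)) := by
          rw [ofReal_integral_eq_lintegral_ofReal (integrableOn_Ioi_rpow_of_lt hlt hw)
            ((ae_restrict_mem measurableSet_Ioi).mono fun x (hx : w < x) =>
              Real.rpow_nonneg (hw.trans hx).le _)]
      _ = _ := by
          rw [integral_Ioi_rpow_of_lt hlt hw, sub_add_cancel]
          congr 1
          field_simp
  calc gaussMixture d (mixingMeasure ρ) w x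
      = ∫⁻ s in Set.Ioi 0, ENNReal.ofReal (ρ s) * ENNReal.ofReal (heatKernel d (s + w) x) :=
        lintegral_mixingMeasure hρm (by fun_prop)
    _ ≤ ∫⁻ s in Set.Ioi 0, ENNReal.ofReal (c * p) *
          ENNReal.ofReal (s ^ (α / 2 - 1) * (s + w) ^ (-(d : ℝ) / 2)) :=
        setLIntegral_mono' measurableSet_Ioi hpt
    _ ≤ ENNReal.ofReal (c * p) * (ENNReal.ofReal (2 / α * w ^ (-b)) +
          ENNReal.ofReal (1 / b * w ^ (-b))) := by
        rw [lintegral_const_mul' _ _ ENNReal.ofReal_ne_top, ← Set.Ioc_union_Ioi_eq_Ioi hw.le]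
        gcongr
        exact (lintegral_union_le _ _ _).trans (add_le_add h1 h2)
    _ ≤ _ := by
        rw [← ENNReal.ofReal_add (by positivity) (by positivity),
          ← ENNReal.ofReal_mul (by positivity)]
        refine ENNReal.ofReal_le_ofReal ?_
        rw [show -((d : ℝ) - α) / 2 = -b by rw [hb_def]; ring]
        have : 0 ≤ w ^ (-b) := by positivity
        nlinarith

end Mixing

section Kernels

variable {d : ℕ} {α : ℝ}

theorem measurable_rieszKernel : Measurable (rieszKernel d α) := by
  unfold rieszKernel
  exact (measurable_norm.pow_const _).const_mul _

theorem measurable_poissonKernel : Measurable (poissonKernel d α) := by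
  unfold poissonKernel
  exact (((measurable_norm.pow_const 2).add_const _).pow_const _).const_mul _

theorem measurable_besselKernel : Measurable (besselKernel d α) := by
  unfold besselKernel
  refine Measurable.const_mul (StronglyMeasurable.measurable ?_) _
  refine StronglyMeasurable.integral_prod_right' (f := fun q : Space d × ℝ =>
    q.2 ^ ((α - (d : ℝ)) / 2 - 1) * Real.exp (-q.2) * Real.exp (-‖q.1‖ ^ 2 / (4 * q.2))) ?_
  exact Measurable.stronglyMeasurable (by fun_prop)

theorem isGaussMixture_heatKernel (hα : 0 < α) :
    IsGaussMixture (heatKernel d α) (Measure.dirac α) where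
  sigmaFinite := inferInstance
  ae_pos := by rw [ae_dirac_eq]; exact hα
  measurable := by fun_prop
  nonneg := heatKernel_nonneg d hα.le
  ofReal_eq x _ := by rw [lintegral_dirac]

theorem isGaussMixture_rieszKernel (hα : 0 < α) (hαd : α < d) :
    IsGaussMixture (rieszKernel d α)
      (mixingMeasure fun w => 2 ^ (-α / 2) / Real.Gamma (α / 2) * w ^ (α / 2 - 1)) where
  sigmaFinite := inferInstance
  ae_pos := ae_mixingMeasure_pos
  measurable := measurable_rieszKernel
  nonneg x := by
    have h1 := Real.Gamma_pos_of_pos (half_pos hα)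
    have h2 := Real.Gamma_pos_of_pos (half_pos (sub_pos.2 hαd))
    unfold rieszKernel
    positivity
  ofReal_eq x hx := by
    have hΓ := Real.Gamma_pos_of_pos (half_pos hα)
    have hb : 0 < ((d : ℝ) - α) / 2 := by linarith
    have hx' : 0 < ‖x‖ := norm_pos_iff.2 hx
    rw [lintegral_mixingMeasure (by fun_prop) (by fun_prop)]
    have hpt : ∀ w ∈ Set.Ioi (0 : ℝ), ENNReal.ofReal (2 ^ (-α / 2) / Real.Gamma (α / 2) *
        w ^ (α / 2 - 1)) * ENNReal.ofReal (heatKernel d w x) =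
        ENNReal.ofReal (2 ^ (-α / 2) / Real.Gamma (α / 2) * (2 * Real.pi) ^ (-(d : ℝ) / 2)) *
        ENNReal.ofReal (w ^ (-(((d : ℝ) - α) / 2) - 1) * Real.exp (-(‖x‖ ^ 2 / 2 / w))) := by
      intro w (hw : 0 < w)
      rw [← ENNReal.ofReal_mul (by positivity), ← ENNReal.ofReal_mul (by positivity),
        heatKernel_eq_rpow_mul hw,
        show -(((d : ℝ) - α) / 2) - 1 = (α / 2 - 1) + -(d : ℝ) / 2 by ring, Real.rpow_add hw]
      congr 1
      ring
    rw [setLIntegral_congr_fun measurableSet_Ioi hpt,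
      lintegral_const_mul' _ _ ENNReal.ofReal_ne_top,
      lintegral_rpow_mul_exp_neg_div hb (by positivity),
      ← ENNReal.ofReal_mul (by positivity)]
    congr 1
    rw [rieszKernel, Real.div_rpow (by positivity) (by norm_num), ← Real.rpow_natCast ‖x‖ 2,
      ← Real.rpow_mul hx'.le, Real.mul_rpow (by norm_num) Real.pi_pos.le,
      show -(d : ℝ) + α = (2 : ℕ) * -(((d : ℝ) - α) / 2) by push_cast; ring,
      show -α = -α / 2 + -(d : ℝ) / 2 - -(((d : ℝ) - α) / 2) by ring, Real.rpow_sub two_pos,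
      Real.rpow_add two_pos]
    field_simp
    congr 1
    ring

theorem isGaussMixture_besselKernel (hα : 0 < α) (hαd : α < d) :
    IsGaussMixture (besselKernel d α)
      (mixingMeasure fun w => (4 * Real.pi) ^ (α / 2) * Real.Gamma (α / 2) *
        (2 ^ (((d : ℝ) - α) / 2) * (2 * Real.pi) ^ ((d : ℝ) / 2)) *
          (w ^ (α / 2 - 1) * Real.exp (-w / 2))) where
  sigmaFinite := inferInstance
  ae_pos := ae_mixingMeasure_pos
  measurable := measurable_besselKernel
  nonneg x := by
    have h1 := Real.Gamma_pos_of_pos (half_pos hα)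
    unfold besselKernel
    refine mul_nonneg (by positivity) (setIntegral_nonneg measurableSet_Ioi fun w hw => ?_)
    have : 0 < w := hw
    positivity
  ofReal_eq x hx := by
    have hΓ := Real.Gamma_pos_of_pos (half_pos hα)
    have hb : 0 < ((d : ℝ) - α) / 2 := by linarith
    have hx' : 0 < ‖x‖ := norm_pos_iff.2 hx
    set b := ((d : ℝ) - α) / 2 with hb_def
    set c := (4 * Real.pi) ^ (α / 2) * Real.Gamma (α / 2) with hc_def
    have hc : 0 < c := by positivity
    let g : ℝ → ℝ := fun s => s ^ (-b - 1) * Real.exp (-s / 2) * Real.exp (-(‖x‖ ^ 2 / 2 / s))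
    have hgm : Measurable g := by fun_prop
    have hg0 : ∀ᵐ s ∂volume.restrict (Set.Ioi (0 : ℝ)), 0 ≤ g s :=
      (ae_restrict_mem measurableSet_Ioi).mono fun s (hs : 0 < s) => by positivity
    have hgi : IntegrableOn g (Set.Ioi 0) := by
      refine ⟨hgm.aestronglyMeasurable, ?_⟩
      rw [hasFiniteIntegral_iff_ofReal hg0]
      refine lt_of_le_of_lt (setLIntegral_mono' measurableSet_Ioi fun s (hs : 0 < s) =>
        ENNReal.ofReal_le_ofReal ?_) ((lintegral_rpow_mul_exp_neg_div (A := ‖x‖ ^ 2 / 2) hb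
          (by positivity)).trans_lt ENNReal.ofReal_lt_top)
      refine mul_le_mul_of_nonneg_right ?_ (Real.exp_pos _).le
      refine mul_le_of_le_one_right (by positivity) ?_
      rw [Real.exp_le_one_iff]
      linarith
    -- substitute `s = 2w`, since `e^{-|x|²/(4w)}` belongs to the Gaussian density of variance `2w`
    have hI : ∫ w in Set.Ioi (0 : ℝ), w ^ ((α - (d : ℝ)) / 2 - 1) * Real.exp (-w) *
        Real.exp (-‖x‖ ^ 2 / (4 * w)) = 2 ^ b * ∫ s in Set.Ioi 0, g s := by
      have h := integral_comp_mul_left_Ioi g 0 two_pos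
      rw [mul_zero, smul_eq_mul] at h
      have h' : ∫ s in Set.Ioi 0, g s = 2 * ∫ w in Set.Ioi 0, g (2 * w) := by
        rw [h, mul_inv_cancel_left₀ two_ne_zero]
      rw [h', ← mul_assoc, ← integral_const_mul]
      refine setIntegral_congr_fun measurableSet_Ioi fun w (hw : 0 < w) => ?_
      simp only [g]
      rw [Real.mul_rpow two_pos.le hw.le, show (α - (d : ℝ)) / 2 - 1 = -b - 1 by rw [hb_def]; ring,
        show (-b - 1 : ℝ) = -(b + 1) by ring, Real.rpow_neg two_pos.le, Real.rpow_add two_pos,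
        Real.rpow_one, show -‖x‖ ^ 2 / (4 * w) = -(‖x‖ ^ 2 / 2 / (2 * w)) by field_simp; norm_num,
        show -(2 * w) / 2 = -w by ring]
      field_simp
    rw [besselKernel, ← hc_def, hI, ← mul_assoc, ENNReal.ofReal_mul (by positivity),
      ofReal_integral_eq_lintegral_ofReal hgi hg0,
      ← lintegral_const_mul' _ _ ENNReal.ofReal_ne_top,
      lintegral_mixingMeasure (by fun_prop) (by fun_prop)]
    refine setLIntegral_congr_fun measurableSet_Ioi fun w (hw : 0 < w) => ?_
    simp only [g]
    rw [← ENNReal.ofReal_mul (by positivity), ← ENNReal.ofReal_mul (by positivity),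
      heatKernel_eq_rpow_mul hw,
      show -b - 1 = (α / 2 - 1) + -(d : ℝ) / 2 by rw [hb_def]; ring, Real.rpow_add hw,
      show -(d : ℝ) / 2 = -((d : ℝ) / 2) by ring, Real.rpow_neg (by positivity : 0 ≤ 2 * Real.pi)]
    congr 1
    field_simp

/-- The mixture representation of the Poisson kernel, valid at the origin as well. -/
theorem ofReal_poissonKernel_eq (hα : 0 < α) (x : Space d) :
    ENNReal.ofReal (poissonKernel d α x) = ∫⁻ w, ENNReal.ofReal (heatKernel d w x)
      ∂mixingMeasure fun w => α * (2 * Real.pi) ^ (-(1 : ℝ) / 2) *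
        (w ^ (-(3 : ℝ) / 2) * Real.exp (-(α ^ 2 / 2 / w))) := by
  have hb : 0 < ((d : ℝ) + 1) / 2 := by positivity
  have hA : 0 < (‖x‖ ^ 2 + α ^ 2) / 2 := by positivity
  rw [lintegral_mixingMeasure (by fun_prop) (by fun_prop)]
  have hpt : ∀ w ∈ Set.Ioi (0 : ℝ), ENNReal.ofReal (α * (2 * Real.pi) ^ (-(1 : ℝ) / 2) *
        (w ^ (-(3 : ℝ) / 2) * Real.exp (-(α ^ 2 / 2 / w)))) * ENNReal.ofReal (heatKernel d w x) =
      ENNReal.ofReal (α * (2 * Real.pi) ^ (-(((d : ℝ) + 1) / 2))) *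
      ENNReal.ofReal (w ^ (-(((d : ℝ) + 1) / 2) - 1) *
        Real.exp (-((‖x‖ ^ 2 + α ^ 2) / 2 / w))) := by
    intro w (hw : 0 < w)
    rw [← ENNReal.ofReal_mul (by positivity), ← ENNReal.ofReal_mul (by positivity),
      heatKernel_eq_rpow_mul hw,
      show -(((d : ℝ) + 1) / 2) - 1 = -(3 : ℝ) / 2 + -(d : ℝ) / 2 by ring, Real.rpow_add hw,
      show -(((d : ℝ) + 1) / 2) = -(1 : ℝ) / 2 + -(d : ℝ) / 2 by ring,
      Real.rpow_add (by positivity : 0 < 2 * Real.pi),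
      show -((‖x‖ ^ 2 + α ^ 2) / 2 / w) = -(α ^ 2 / 2 / w) + -(‖x‖ ^ 2 / 2 / w) by ring,
      Real.exp_add]
    congr 1
    ring
  rw [setLIntegral_congr_fun measurableSet_Ioi hpt, lintegral_const_mul' _ _ ENNReal.ofReal_ne_top,
    lintegral_rpow_mul_exp_neg_div hb hA, ← ENNReal.ofReal_mul (by positivity)]
  congr 1
  rw [poissonKernel, Real.div_rpow (by positivity) (by norm_num),
    Real.mul_rpow (by norm_num) Real.pi_pos.le,
    show -((d : ℝ) + 1) / 2 = -(((d : ℝ) + 1) / 2) by ring]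
  have h2 : (0 : ℝ) < 2 ^ (-(((d : ℝ) + 1) / 2)) := by positivity
  field_simp

theorem isGaussMixture_poissonKernel (hα : 0 < α) :
    IsGaussMixture (poissonKernel d α) (mixingMeasure fun w =>
      α * (2 * Real.pi) ^ (-(1 : ℝ) / 2) *
        (w ^ (-(3 : ℝ) / 2) * Real.exp (-(α ^ 2 / 2 / w)))) where
  sigmaFinite := inferInstance
  ae_pos := ae_mixingMeasure_pos
  measurable := measurable_poissonKernel
  nonneg x := by
    have := Real.Gamma_pos_of_pos (show 0 < ((d : ℝ) + 1) / 2 by positivity)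
    unfold poissonKernel
    positivity
  ofReal_eq x _ := ofReal_poissonKernel_eq hα x

variable [NeZero d]

/-- The Riesz and Bessel kernels are Gaussian mixtures whose smoothings decay like
`w^{-(d-α)/2}`. -/
theorem exists_mixture_riesz_bessel (hα : 0 < α) (hαd : α < d) {f : Space d → ℝ}
    (hf : f = rieszKernel d α ∨ f = besselKernel d α) :
    ∃ μ, IsGaussMixture f μ ∧ ∃ D, IsDecayConst f α D := by
  have hΓ := Real.Gamma_pos_of_pos (half_pos hα)
  rcases hf with rfl | rfl
  · have hm := isGaussMixture_rieszKernel hα hαd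
    obtain ⟨D, hD, hle⟩ := exists_gaussMixture_mixingMeasure_le hα hαd
      (c := 2 ^ (-α / 2) / Real.Gamma (α / 2)) (by positivity) (by fun_prop) (fun s hs => le_rfl)
    exact ⟨_, hm, D, hD, fun u v hu hv y z => by
      rw [hm.kernelEnergy_eq hu hv]
      exact hle _ (add_pos hu hv) _⟩
  · have hm := isGaussMixture_besselKernel hα hαd
    obtain ⟨D, hD, hle⟩ := exists_gaussMixture_mixingMeasure_le hα hαd
      (ρ := fun w => (4 * Real.pi) ^ (α / 2) * Real.Gamma (α / 2) *
        (2 ^ (((d : ℝ) - α) / 2) * (2 * Real.pi) ^ ((d : ℝ) / 2)) *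
          (w ^ (α / 2 - 1) * Real.exp (-w / 2)))
      (c := (4 * Real.pi) ^ (α / 2) * Real.Gamma (α / 2) *
        (2 ^ (((d : ℝ) - α) / 2) * (2 * Real.pi) ^ ((d : ℝ) / 2))) (by positivity) (by fun_prop)
      (fun s hs => by
        refine mul_le_mul_of_nonneg_left (mul_le_of_le_one_right (by positivity) ?_)
          (by positivity)
        rw [Real.exp_le_one_iff]
        linarith)
    exact ⟨_, hm, D, hD, fun u v hu hv y z => by
      rw [hm.kernelEnergy_eq hu hv]
      exact hle _ (add_pos hu hv) _⟩

/-- The heat and Poisson kernels are Gaussian mixtures which are bounded, by their values at the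
origin. -/
theorem exists_mixture_heat_poisson (hα : 0 < α) {f : Space d → ℝ}
    (hf : f = heatKernel d α ∨ f = poissonKernel d α) :
    ∃ μ, IsGaussMixture f μ ∧ ∃ C, IsBoundConst f C := by
  rcases hf with rfl | rfl
  · have hm := isGaussMixture_heatKernel (d := d) hα
    refine ⟨_, hm, heatKernel d α 0, ?_, fun u v hu hv y z => ?_⟩
    · unfold heatKernel
      positivity
    · rw [hm.kernelEnergy_eq hu hv]
      refine (gaussMixture_le_lintegral_zero hm.ae_pos (add_pos hu hv).le _).trans ?_
      rw [lintegral_dirac]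
  · have hm := isGaussMixture_poissonKernel (d := d) hα
    refine ⟨_, hm, poissonKernel d α 0, ?_, fun u v hu hv y z => ?_⟩
    · have := Real.Gamma_pos_of_pos (show 0 < ((d : ℝ) + 1) / 2 by positivity)
      unfold poissonKernel
      positivity
    · rw [hm.kernelEnergy_eq hu hv, ofReal_poissonKernel_eq hα]
      exact gaussMixture_le_lintegral_zero hm.ae_pos (add_pos hu hv).le _

end Kernels

/-! ### The Gamma function and powers of factorials -/

/-- A lower bound for `Γ` between consecutive integers, from its log-convexity. -/
theorem factorial_mul_rpow_le_Gamma (m : ℕ) {θ : ℝ} (h0 : 0 ≤ θ) (h1 : θ ≤ 1) :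
    (m.factorial : ℝ) * (m + θ) ^ θ ≤ Real.Gamma (m + θ + 1) := by
  rcases h0.eq_or_lt with rfl | h0
  · simp [Real.Gamma_nat_eq_factorial]
  rcases h1.eq_or_lt with rfl | h1
  · have : ((m : ℝ) + 1 + 1) = ((m + 1 : ℕ) : ℝ) + 1 := by push_cast; ring
    rw [this, Real.Gamma_nat_eq_factorial, Real.rpow_one, Nat.factorial_succ]
    push_cast
    rw [mul_comm]
  have hx : 0 < (m : ℝ) + θ := by positivity
  have hΓ := Real.Gamma_pos_of_pos hx
  have hΓ1 : Real.Gamma (m + θ + 1) = (m + θ) * Real.Gamma (m + θ) := Real.Gamma_add_one hx.ne'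
  -- `m + 1` is the convex combination of `m + θ` and `m + θ + 1` with weights `θ` and `1 - θ`
  have h := Real.Gamma_mul_add_mul_le_rpow_Gamma_mul_rpow_Gamma hx
    (by linarith : 0 < (m : ℝ) + θ + 1) h0 (sub_pos.2 h1) (by ring)
  rw [show θ * ((m : ℝ) + θ) + (1 - θ) * (m + θ + 1) = m + 1 by ring,
    Real.Gamma_nat_eq_factorial, hΓ1, Real.mul_rpow hx.le hΓ.le] at h
  calc (m.factorial : ℝ) * (m + θ) ^ θ
      ≤ (Real.Gamma (m + θ) ^ θ * ((m + θ) ^ (1 - θ) * Real.Gamma (m + θ) ^ (1 - θ))) *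
          (m + θ) ^ θ := by gcongr
    _ = (Real.Gamma (m + θ) ^ θ * Real.Gamma (m + θ) ^ (1 - θ)) *
          ((m + θ) ^ (1 - θ) * (m + θ) ^ θ) := by ring
    _ = Real.Gamma (m + θ + 1) := by
        rw [← Real.rpow_add hΓ, ← Real.rpow_add hx, hΓ1]
        simp [mul_comm]

/-- A lower bound of Stirling type for the Gamma function. -/
theorem rpow_self_mul_sqrt_le_Gamma {x : ℝ} (hx : 0 ≤ x) :
    (x / Real.exp 1) ^ x * √(max 1 x) ≤ Real.Gamma (x + 1) := by
  have he : Real.exp 1 ≠ 0 := (Real.exp_pos 1).ne'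
  have hex : Real.exp 1 ^ x = Real.exp x := by rw [← Real.exp_mul, one_mul]
  rcases lt_or_ge x 1 with h1 | h1
  · have h := factorial_mul_rpow_le_Gamma 0 hx h1.le
    simp only [Nat.factorial_zero, Nat.cast_one, Nat.cast_zero, zero_add, one_mul] at h
    rw [max_eq_left h1.le, Real.sqrt_one, mul_one]
    refine le_trans (Real.rpow_le_rpow (by positivity) ?_ hx) h
    exact div_le_self hx (Real.one_le_exp zero_le_one)
  · have hx0 : 0 < x := by linarith
    set m := ⌊x⌋₊ with hm_def
    have hm1 : 1 ≤ m := Nat.le_floor (by simpa using h1)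
    have hm0 : (0 : ℝ) < m := by exact_mod_cast hm1
    have hm1' : (1 : ℝ) ≤ m := by exact_mod_cast hm1
    have hmx : (m : ℝ) ≤ x := Nat.floor_le hx
    have hxm : x < m + 1 := Nat.lt_floor_add_one x
    have h := factorial_mul_rpow_le_Gamma m (sub_nonneg.2 hmx) (by linarith : x - m ≤ 1)
    rw [add_sub_cancel] at h
    refine le_trans ?_ h
    have hst := Stirling.le_factorial_stirling m
    -- `(x/m)^m ≤ e^{x-m}`, so `x^x e^{-x}` is at most `m^m e^{-m} x^{x-m}`
    have hpow : x ^ m ≤ (m : ℝ) ^ m * Real.exp (x - m) := by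
      have h2 : (1 + (x - m) / m) ^ m ≤ Real.exp (x - m) := by
        calc (1 + (x - m) / m) ^ m ≤ Real.exp ((x - m) / m) ^ m := by
              have h3 : 0 ≤ (x - m) / m := div_nonneg (sub_nonneg.2 hmx) hm0.le
              have h4 := Real.add_one_le_exp ((x - m) / m)
              gcongr
              linarith
          _ = Real.exp (x - m) := by
              rw [← Real.exp_nat_mul, mul_div_cancel₀ _ hm0.ne']
      calc x ^ m = (m : ℝ) ^ m * (1 + (x - m) / m) ^ m := by
            rw [← mul_pow]
            congr 1
            field_simp
            ring
        _ ≤ _ := by gcongr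
    have hsq : √x ≤ √(2 * Real.pi * m) := by
      refine Real.sqrt_le_sqrt ?_
      nlinarith [Real.pi_gt_three]
    rw [max_eq_right h1]
    calc (x / Real.exp 1) ^ x * √x = x ^ m * x ^ (x - m) * Real.exp (-x) * √x := by
          rw [Real.div_rpow hx (Real.exp_pos 1).le, hex, ← Real.rpow_natCast, ← Real.rpow_add hx0,
            add_sub_cancel, Real.exp_neg, div_eq_mul_inv]
      _ ≤ (m : ℝ) ^ m * Real.exp (x - m) * x ^ (x - m) * Real.exp (-x) * √(2 * Real.pi * m) := by
          gcongr
      _ = √(2 * Real.pi * m) * (m / Real.exp 1) ^ m * x ^ (x - m) := by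
          rw [div_pow, ← Real.exp_nat_mul, mul_one, div_eq_mul_inv, ← Real.exp_neg,
            show (-(m : ℝ)) = (x - m) + -x by ring, Real.exp_add]
          ring
      _ ≤ _ := by gcongr

theorem factorial_le_stirling {n : ℕ} (hn : n ≠ 0) :
    (n.factorial : ℝ) ≤ Real.exp 1 * √n * (n / Real.exp 1) ^ n := by
  obtain ⟨k, rfl⟩ := Nat.exists_eq_succ_of_ne_zero hn
  have h := Stirling.stirlingSeq'_antitone (Nat.zero_le k)
  simp only [Function.comp_apply, Nat.succ_eq_add_one, zero_add, Stirling.stirlingSeq_one] at h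
  rw [Stirling.stirlingSeq, div_le_div_iff₀ (by positivity) (by positivity),
    Real.sqrt_mul (by norm_num)] at h
  have h2 : 0 < √(2 : ℝ) := by positivity
  refine le_of_mul_le_mul_right (h.trans (le_of_eq ?_)) h2
  rw [Nat.succ_eq_add_one]
  ring

/-- The comparison between `Γ(nκ + 1)` and `(n!)^κ` which replaces one series by the other. -/
theorem exists_factorial_rpow_le_Gamma {κ : ℝ} (hκ : 0 < κ) (hκ1 : κ ≤ 1) :
    ∃ C, 0 < C ∧ ∀ n : ℕ, (n.factorial : ℝ) ^ κ * κ ^ (κ * n) ≤ C * Real.Gamma (n * κ + 1) := by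
  have hC : 1 ≤ Real.exp 1 / √κ := by
    rw [one_le_div (by positivity)]
    exact (Real.sqrt_le_one.2 hκ1).trans (Real.one_le_exp zero_le_one)
  refine ⟨Real.exp 1 / √κ, by positivity, fun n => ?_⟩
  rcases eq_or_ne n 0 with rfl | hn
  · simpa using hC
  have hn1 : (1 : ℝ) ≤ n := by exact_mod_cast Nat.one_le_iff_ne_zero.2 hn
  have hn0 : (0 : ℝ) < n := by linarith
  have hx : 0 ≤ n * κ := by positivity
  have he1 : Real.exp 1 ^ κ ≤ Real.exp 1 := by
    conv_rhs => rw [← Real.rpow_one (Real.exp 1)]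
    exact Real.rpow_le_rpow_of_exponent_le (Real.one_le_exp zero_le_one) hκ1
  have hs1 : √(n : ℝ) ^ κ ≤ √(n : ℝ) := by
    conv_rhs => rw [← Real.rpow_one √(n : ℝ)]
    exact Real.rpow_le_rpow_of_exponent_le (Real.one_le_sqrt.2 hn1) hκ1
  have hs2 : √(n : ℝ) ≤ √(max 1 (n * κ)) / √κ := by
    rw [le_div_iff₀ (by positivity), ← Real.sqrt_mul hn0.le]
    exact Real.sqrt_le_sqrt (le_max_right _ _)
  calc (n.factorial : ℝ) ^ κ * κ ^ (κ * n)
      ≤ (Real.exp 1 * √n * (n / Real.exp 1) ^ n) ^ κ * κ ^ (κ * n) := by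
        gcongr
        exact factorial_le_stirling hn
    _ = Real.exp 1 ^ κ * √(n : ℝ) ^ κ * (n * κ / Real.exp 1) ^ (n * κ) := by
        rw [Real.mul_rpow (by positivity) (by positivity),
          Real.mul_rpow (by positivity) (by positivity), ← Real.rpow_natCast (_ / _),
          ← Real.rpow_mul (by positivity), mul_comm κ (n : ℝ), mul_assoc,
          ← Real.mul_rpow (by positivity) hκ.le]
        congr 2
        ring
    _ ≤ Real.exp 1 * (√(max 1 (n * κ)) / √κ) * (n * κ / Real.exp 1) ^ (n * κ) := by
        gcongr
        exact hs1.trans hs2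
    _ = Real.exp 1 / √κ * ((n * κ / Real.exp 1) ^ (n * κ) * √(max 1 (n * κ))) := by ring
    _ ≤ _ := by
        gcongr
        exact rpow_self_mul_sqrt_le_Gamma hx

/-- The series defining `Phi` converges. -/
theorem summable_pow_div_factorial_rpow {κ : ℝ} (hκ : 0 < κ) (x : ℝ) :
    Summable fun n : ℕ => x ^ n / (n.factorial : ℝ) ^ κ := by
  rcases eq_or_ne x 0 with rfl | hx
  · refine summable_of_ne_finset_zero (s := {0}) fun n hn => ?_
    simp only [Finset.mem_singleton] at hn
    rw [zero_pow hn, zero_div]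
  refine summable_of_ratio_test_tendsto_lt_one (l := 0) zero_lt_one
    (Eventually.of_forall fun n => by positivity) ?_
  have hlim : Tendsto (fun n : ℕ => |x| * ((n + 1 : ℕ) : ℝ) ^ (-κ)) atTop (𝓝 0) := by
    have h := ((tendsto_rpow_neg_atTop hκ).comp tendsto_natCast_atTop_atTop).comp
      (tendsto_add_atTop_nat 1)
    simpa using h.const_mul |x|
  refine hlim.congr fun n => ?_
  rw [norm_div, norm_div, norm_pow, norm_pow, Nat.factorial_succ, Nat.cast_mul,
    Real.mul_rpow (by positivity) (by positivity), Real.rpow_neg (by positivity), pow_succ,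
    Real.norm_eq_abs, Real.norm_of_nonneg (by positivity), Real.norm_of_nonneg (by positivity)]
  have : 0 < |x| := abs_pos.2 hx
  field_simp

/-! ### Weights with bounded marginals -/

section Marginals

variable {α β : Type*} [MeasurableSpace α] [MeasurableSpace β] {m₁ : Measure α} {m₂ : Measure β}
  [SFinite m₁] [SFinite m₂] {g : α × β → ℝ≥0∞} {N : ℝ≥0∞}

theorem map_fst_withDensity_prod_le (hg : Measurable g) (h : ∀ᵐ r ∂m₁, ∫⁻ s, g (r, s) ∂m₂ ≤ N) :
    ((m₁.prod m₂).withDensity g).map Prod.fst ≤ N • m₁ := by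
  refine Measure.le_iff.2 fun A hA => ?_
  rw [Measure.map_apply measurable_fst hA, withDensity_apply _ (measurable_fst hA),
    show (Prod.fst ⁻¹' A : Set (α × β)) = A ×ˢ Set.univ by ext; simp,
    ← Measure.prod_restrict, Measure.restrict_univ, lintegral_prod _ hg.aemeasurable]
  calc _ ≤ ∫⁻ _ in A, N ∂m₁ := lintegral_mono_ae (ae_restrict_of_ae h)
    _ = _ := by rw [setLIntegral_const]; rfl

theorem map_snd_withDensity_prod_le (hg : Measurable g) (h : ∀ᵐ s ∂m₂, ∫⁻ r, g (r, s) ∂m₁ ≤ N) :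
    ((m₁.prod m₂).withDensity g).map Prod.snd ≤ N • m₂ := by
  refine Measure.le_iff.2 fun A hA => ?_
  rw [Measure.map_apply measurable_snd hA, withDensity_apply _ (measurable_snd hA),
    show (Prod.snd ⁻¹' A : Set (α × β)) = Set.univ ×ˢ A by ext; simp,
    ← Measure.prod_restrict, Measure.restrict_univ, lintegral_prod_symm _ hg.aemeasurable]
  calc _ ≤ ∫⁻ _ in A, N ∂m₂ := lintegral_mono_ae (ae_restrict_of_ae h)
    _ = _ := by rw [setLIntegral_const]; rfl

end Marginals

/-- A weight on `[0,t]²` of finite norm is the density of a finite measure, whose marginals have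
densities at most `‖η‖_{1,t}`. -/
theorem exists_weightMeasure {t : ℝ} (ht : 0 < t) {η : ℝ → ℝ → ℝ≥0}
    (hη : Measurable fun q : Set.Icc (0 : ℝ) t × Set.Icc (0 : ℝ) t => η q.1 q.2)
    (hN : weightNorm η t < ∞) :
    ∃ ν : Measure (ℝ × ℝ),
      ν.map Prod.fst ≤ weightNorm η t • volume.restrict (Set.Ioc 0 t) ∧
      ν.map Prod.snd ≤ weightNorm η t • volume.restrict (Set.Ioc 0 t) ∧
      ν Set.univ ≤ weightNorm η t * ENNReal.ofReal t ∧
      ∀ (F : ℝ × ℝ → ℝ≥0∞) (C : ℝ≥0), Measurable F → (∀ q, F q ≤ C) →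
        ∫ s in (0 : ℝ)..t, ∫ r in (0 : ℝ)..t, (η r s : ℝ) * (F (r, s)).toReal =
          (∫⁻ q, F q ∂ν).toReal := by
  have hemb : MeasurableEmbedding
      (Prod.map ((↑) : Set.Icc (0 : ℝ) t → ℝ) ((↑) : Set.Icc (0 : ℝ) t → ℝ)) :=
    (MeasurableEmbedding.subtype_coe measurableSet_Icc).prodMap
      (MeasurableEmbedding.subtype_coe measurableSet_Icc)
  obtain ⟨g, hgm, hg⟩ := hemb.exists_measurable_extend hη fun _ => ⟨0⟩
  have hgη : ∀ r ∈ Set.Ioc 0 t, ∀ s ∈ Set.Ioc 0 t, g (r, s) = η r s := fun r hr s hs =>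
    congr_fun hg (⟨r, Set.Ioc_subset_Icc_self hr⟩, ⟨s, Set.Ioc_subset_Icc_self hs⟩)
  set m := volume.restrict (Set.Ioc 0 t) with hm
  have hmem : ∀ᵐ r ∂m, r ∈ Set.Ioc 0 t := ae_restrict_mem measurableSet_Ioc
  have hG : Measurable fun q => (g q : ℝ≥0∞) := hgm.coe_nnreal_ennreal
  have hs1 : ∀ r ∈ Set.Ioc 0 t, ∫⁻ s, (g (r, s) : ℝ≥0∞) ∂m ≤ weightNorm η t := by
    intro r hr
    rw [hm, setLIntegral_congr_fun measurableSet_Ioc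
      (g := fun s => (η r s : ℝ≥0∞)) fun s hs => by simp only [hgη r hr s hs],
      setLIntegral_congr Ioc_ae_eq_Icc]
    exact le_max_of_le_right (le_iSup₂ (f := fun r (_ : r ∈ Set.Icc 0 t) =>
      ∫⁻ s in Set.Icc 0 t, (η r s : ℝ≥0∞)) r (Set.Ioc_subset_Icc_self hr))
  have hs2 : ∀ s ∈ Set.Ioc 0 t, ∫⁻ r, (g (r, s) : ℝ≥0∞) ∂m ≤ weightNorm η t := by
    intro s hs
    rw [hm, setLIntegral_congr_fun measurableSet_Ioc
      (g := fun r => (η r s : ℝ≥0∞)) fun r hr => by simp only [hgη r hr s hs],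
      setLIntegral_congr Ioc_ae_eq_Icc]
    exact le_max_of_le_left (le_iSup₂ (f := fun s (_ : s ∈ Set.Icc 0 t) =>
      ∫⁻ r in Set.Icc 0 t, (η r s : ℝ≥0∞)) s (Set.Ioc_subset_Icc_self hs))
  have h1 := map_fst_withDensity_prod_le (m₁ := m) (m₂ := m) hG (hmem.mono hs1)
  refine ⟨_, h1, map_snd_withDensity_prod_le hG (hmem.mono hs2), ?_, fun F C hF hFC => ?_⟩
  · have h := h1 Set.univ
    rw [Measure.map_apply measurable_fst MeasurableSet.univ] at h
    simpa [hm] using h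
  · have hGF : Measurable fun q => (g q : ℝ≥0∞) * F q := hG.mul hF
    have hinner : ∀ s ∈ Set.Ioc 0 t, ∫ r in (0 : ℝ)..t, (η r s : ℝ) * (F (r, s)).toReal =
        (∫⁻ r, (g (r, s) : ℝ≥0∞) * F (r, s) ∂m).toReal := by
      intro s hs
      have hGs : Measurable fun r => (g (r, s) : ℝ≥0∞) * F (r, s) :=
        hGF.comp measurable_prodMk_right
      rw [intervalIntegral.integral_of_le ht.le, ← integral_toReal hGs.aemeasurable
        (Eventually.of_forall fun r =>
          ENNReal.mul_lt_top ENNReal.coe_lt_top ((hFC _).trans_lt ENNReal.coe_lt_top))]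
      refine setIntegral_congr_fun measurableSet_Ioc fun r hr => ?_
      simp only [hgη r hr s hs, ENNReal.toReal_mul, ENNReal.coe_toReal]
    have hfin : ∀ s ∈ Set.Ioc 0 t, ∫⁻ r, (g (r, s) : ℝ≥0∞) * F (r, s) ∂m < ∞ := by
      intro s hs
      calc _ ≤ ∫⁻ r, (g (r, s) : ℝ≥0∞) * C ∂m :=
            lintegral_mono fun r => mul_le_mul_right (hFC _) _
        _ = (∫⁻ r, (g (r, s) : ℝ≥0∞) ∂m) * C := lintegral_mul_const' _ _ ENNReal.coe_ne_top
        _ < ∞ := ENNReal.mul_lt_top ((hs2 s hs).trans_lt hN) ENNReal.coe_lt_top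
    rw [intervalIntegral.integral_of_le ht.le, setIntegral_congr_fun measurableSet_Ioc hinner,
      integral_toReal hGF.lintegral_prod_left'.aemeasurable (hmem.mono hfin),
      lintegral_withDensity_eq_lintegral_mul _ hG hF, lintegral_prod_symm' _ (hG.mul hF)]
    rfl

/-- The smoothed local times, weighted by `η`, are almost surely the mutual local times of
continuous Brownian motions; this carries over the estimates for the latter. -/
theorem exists_version_approxLocalTime {d : ℕ} [NeZero d] {f : Space d → ℝ} {μ : Measure ℝ}
    (hf : IsGaussMixture f μ)
    (hbdd : ∀ ε, 0 < ε → ∃ C : ℝ≥0, ∀ x, gaussMixture d μ ε x ≤ C)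
    {Ω : Type*} [MeasurableSpace Ω] {P : Measure Ω} [IsProbabilityMeasure P]
    {B₁ B₂ : ℝ≥0 → Ω → Space d} (hB₁ : IsBrownian B₁ P) (hB₂ : IsBrownian B₂ P)
    (hI : IndepFun (fun (ω : Ω) (t : ℝ≥0) => B₁ t ω) (fun (ω : Ω) (t : ℝ≥0) => B₂ t ω) P)
    {t : ℝ} (ht : 0 < t) {η : ℝ → ℝ → ℝ≥0}
    (hη : Measurable fun q : Set.Icc (0 : ℝ) t × Set.Icc (0 : ℝ) t => η q.1 q.2)
    (hN : weightNorm η t < ∞) :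
    ∃ X : ℝ → Ω → ℝ, (∀ ε, 0 < ε →
        (fun ω => approxLocalTime f η t ε (fun r => B₁ r ω) (fun s => B₂ s ω)) =ᵐ[P] X ε) ∧
      (∀ ε, Measurable (X ε)) ∧ (∀ ε ω, 0 ≤ X ε ω) ∧
      (∀ ε δ, 0 < δ → δ ≤ ε → ∫⁻ ω, ENNReal.ofReal (X ε ω) * ENNReal.ofReal (X ε ω) ∂P ≤
        ∫⁻ ω, ENNReal.ofReal (X ε ω) * ENNReal.ofReal (X δ ω) ∂P) ∧
      (∀ D κ : ℝ, 0 < D → 0 < κ → κ ≤ 1 →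
        (∀ w, 0 < w → ∀ x, gaussMixture d μ w x ≤ ENNReal.ofReal (D * w ^ (κ - 1))) →
        ∀ ε, 0 < ε → ∀ n : ℕ, ∫⁻ ω, ENNReal.ofReal (X ε ω) ^ n ∂P ≤
          ENNReal.ofReal (n.factorial *
            (D * 2 ^ (κ - 1) * (weightNorm η t).toReal * Real.Gamma κ * t ^ κ) ^ n /
              Real.Gamma (n * κ + 1))) ∧
      ∀ C ε : ℝ, 0 ≤ C → (∀ x, gaussMixture d μ ε x ≤ ENNReal.ofReal C) →
        ∀ ω, X ε ω ≤ C * (weightNorm η t).toReal * t := by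
  have := hf.sigmaFinite
  obtain ⟨ν, hν₁, hν₂, hνu, hν⟩ := exists_weightMeasure ht hη hN
  have hνf : IsFiniteMeasure ν := ⟨hνu.trans_lt (ENNReal.mul_lt_top hN ENNReal.ofReal_lt_top)⟩
  obtain ⟨B₁', hB₁', hc₁, h₁⟩ := hB₁.exists_continuous
  obtain ⟨B₂', hB₂', hc₂, h₂⟩ := hB₂.exists_continuous
  have hI' : IndepFun (fun (ω : Ω) (t : ℝ≥0) => B₁' t ω) (fun (ω : Ω) (t : ℝ≥0) => B₂' t ω) P :=
    hI.congr (h₁.mono fun ω hω => funext fun t => (hω t).symm)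
      (h₂.mono fun ω hω => funext fun t => (hω t).symm)
  let M : ℝ → Ω → ℝ≥0∞ := fun ε ω =>
    mutualLocalTime μ ν ε (fun r => B₁' r ω) (fun s => B₂' s ω)
  have hMm : ∀ ε, Measurable (M ε) :=
    measurable_mutualLocalTime hc₁ hB₁'.measurable hc₂ hB₂'.measurable
  have hMfin : ∀ ε, 0 < ε → ∀ ω, M ε ω ≠ ∞ := by
    intro ε hε ω
    obtain ⟨C, hC⟩ := hbdd ε hε
    exact ((mutualLocalTime_le hC _ _).trans_lt
      (ENNReal.mul_lt_top ENNReal.coe_lt_top (measure_lt_top _ _))).ne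
  have hMr : ∀ ε, 0 < ε → ∀ ω, ENNReal.ofReal (M ε ω).toReal = M ε ω := fun ε hε ω =>
    ENNReal.ofReal_toReal (hMfin ε hε ω)
  have hNN : weightNorm η t = ((weightNorm η t).toNNReal : ℝ≥0∞) :=
    (ENNReal.coe_toNNReal hN.ne).symm
  -- `toReal` loses nothing: `M ε` is finite for `ε > 0`, by the boundedness of the smoothed kernel
  refine ⟨fun ε ω => (M ε ω).toReal, fun ε hε => ?_, fun ε => (hMm ε).ennreal_toReal,
    fun ε ω => ENNReal.toReal_nonneg, fun ε δ hδ hle => ?_, fun D κ hD hκ hκ1 hF ε hε n => ?_,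
    fun C ε hC hle ω => ?_⟩
  · obtain ⟨C, hC⟩ := hbdd ε hε
    filter_upwards [h₁, h₂] with ω hω₁ hω₂
    have hF : Measurable fun q : ℝ × ℝ =>
        gaussMixture d μ ε (B₁' q.1.toNNReal ω - B₂' q.2.toNNReal ω) :=
      Measurable.gaussMixture
        ((((hc₁ ω).comp continuous_real_toNNReal).measurable.comp measurable_fst).sub
          (((hc₂ ω).comp continuous_real_toNNReal).measurable.comp measurable_snd))
    refine Eq.trans ?_ (hν _ C hF fun q => hC _)
    refine intervalIntegral.integral_congr fun s _ => intervalIntegral.integral_congr fun r _ => ?_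
    simp only [mul_assoc]
    rw [integral_const_mul, hf.integral_heatKernel_mul hε, hω₁, hω₂]
  · have hε := hδ.trans_le hle
    simp only [hMr ε hε, hMr δ hδ]
    have h := lintegral_prod_mutualLocalTime_antitone (ν := ν) hB₁' hB₂' hI' hc₁ hc₂ hf.ae_pos
      (ε := ![ε, δ]) (δ := ![ε, ε]) (by simp [Fin.forall_fin_two, hε, hδ])
      (by simp [Fin.forall_fin_two, hle])
    simpa [Fin.prod_univ_two] using h
  · simp only [hMr ε hε]
    rw [hNN] at hν₁ hν₂
    exact lintegral_mutualLocalTime_pow_le hB₁' hB₂' hI' hc₁ hc₂ hf.ae_pos hε hD hκ hκ1 hF ht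
      hν₁ hν₂ n
  · refine ENNReal.toReal_le_of_le_ofReal (by positivity) ?_
    refine (mutualLocalTime_le hle _ _).trans ((mul_le_mul_right hνu _).trans (le_of_eq ?_))
    rw [ENNReal.ofReal_mul (by positivity), ENNReal.ofReal_mul hC, ENNReal.ofReal_toReal hN.ne,
      mul_assoc]

/-! ### Convergence and exponential moments -/

theorem ConvergesInLp.congr {Ω : Type*} [MeasurableSpace Ω] {P : Measure Ω} {X Y : ℝ → Ω → ℝ}
    (hX : ConvergesInLp X P) (h : ∀ ε, 0 < ε → Y ε =ᵐ[P] X ε) : ConvergesInLp Y P := by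
  obtain ⟨L, hL⟩ := hX
  refine ⟨L, fun p hp2 hp => ?_⟩
  obtain ⟨h1, h2, h3⟩ := hL p hp2 hp
  refine ⟨fun ε hε => (memLp_congr_ae (h ε hε)).2 (h1 ε hε), h2, h3.congr' ?_⟩
  filter_upwards [self_mem_nhdsWithin] with ε hε
  exact eLpNorm_congr_ae ((h ε hε).symm.sub EventuallyEq.rfl)

/-- Bounds `E[Xⁿ] ≤ n! aₙ` on the moments bound the exponential moments, by `∑ lⁿ aₙ`. -/
theorem integrable_exp_of_moments {Ω : Type*} [MeasurableSpace Ω] {P : Measure Ω} {X : Ω → ℝ}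
    (hX : Measurable X) (h0 : ∀ ω, 0 ≤ X ω) {a : ℕ → ℝ} (ha : ∀ n, 0 ≤ a n)
    (hle : ∀ n : ℕ, ∫⁻ ω, ENNReal.ofReal (X ω) ^ n ∂P ≤ ENNReal.ofReal (n.factorial * a n))
    {l : ℝ} (hl : 0 ≤ l) (hs : Summable fun n => l ^ n * a n) :
    Integrable (fun ω => Real.exp (l * X ω)) P ∧
      ∫ ω, Real.exp (l * X ω) ∂P ≤ ∑' n, l ^ n * a n := by
  have hlX : ∀ ω, 0 ≤ l * X ω := fun ω => mul_nonneg hl (h0 ω)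
  have hm : Measurable fun ω => Real.exp (l * X ω) := (hX.const_mul l).exp
  have hexp : ∀ ω, ENNReal.ofReal (Real.exp (l * X ω)) =
      ∑' n : ℕ, ENNReal.ofReal (l ^ n / n.factorial) * ENNReal.ofReal (X ω) ^ n := by
    intro ω
    have h := NormedSpace.expSeries_div_hasSum_exp (𝔸 := ℝ) (l * X ω)
    rw [← Real.exp_eq_exp_ℝ] at h
    rw [← h.tsum_eq, ENNReal.ofReal_tsum_of_nonneg (fun n => by have := hlX ω; positivity)
      h.summable]
    refine tsum_congr fun n => ?_
    rw [← ENNReal.ofReal_pow (h0 ω), ← ENNReal.ofReal_mul (by positivity), mul_pow]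
    congr 1
    ring
  have hI : ∫⁻ ω, ENNReal.ofReal (Real.exp (l * X ω)) ∂P ≤
      ENNReal.ofReal (∑' n, l ^ n * a n) := by
    rw [lintegral_congr hexp, lintegral_tsum fun n =>
      ((hX.ennreal_ofReal.pow_const n).const_mul _).aemeasurable,
      ENNReal.ofReal_tsum_of_nonneg (fun n => mul_nonneg (pow_nonneg hl n) (ha n)) hs]
    refine ENNReal.tsum_le_tsum fun n => ?_
    rw [lintegral_const_mul' _ _ ENNReal.ofReal_ne_top]
    refine (mul_le_mul_right (hle n) _).trans (le_of_eq ?_)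
    rw [← ENNReal.ofReal_mul (by positivity)]
    congr 1
    field_simp
  have hpos : 0 ≤ᵐ[P] fun ω => Real.exp (l * X ω) := Eventually.of_forall fun ω =>
    (Real.exp_pos _).le
  refine ⟨⟨hm.aestronglyMeasurable, ?_⟩, ?_⟩
  · rw [hasFiniteIntegral_iff_ofReal hpos]
    exact hI.trans_lt ENNReal.ofReal_lt_top
  · rw [integral_eq_lintegral_of_nonneg_ae hpos hm.aestronglyMeasurable]
    exact ENNReal.toReal_le_of_le_ofReal
      (tsum_nonneg fun n => mul_nonneg (pow_nonneg hl n) (ha n)) hI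

section Main

variable {d : ℕ} [NeZero d] {f : Space d → ℝ} {μ : Measure ℝ}
  {Ω : Type*} [MeasurableSpace Ω] {P : Measure Ω} [IsProbabilityMeasure P]
  {B₁ B₂ : ℝ≥0 → Ω → Space d} {t : ℝ} {η : ℝ → ℝ → ℝ≥0}

theorem IsGaussMixture.le_of_isDecayConst (hf : IsGaussMixture f μ) {α D : ℝ}
    (hD : IsDecayConst f α D) {w : ℝ} (hw : 0 < w) (x : Space d) :
    gaussMixture d μ w x ≤ ENNReal.ofReal (D * w ^ (1 - ((d : ℝ) - α) / 2 - 1)) := by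
  rw [hf.gaussMixture_eq_kernelEnergy hw]
  refine (hD.2 _ _ (half_pos hw) (half_pos hw) _ _).trans (le_of_eq ?_)
  rw [add_halves]
  congr 3
  ring

theorem IsGaussMixture.le_of_isBoundConst (hf : IsGaussMixture f μ) {C : ℝ}
    (hC : IsBoundConst f C) {w : ℝ} (hw : 0 < w) (x : Space d) :
    gaussMixture d μ w x ≤ ENNReal.ofReal C := by
  rw [hf.gaussMixture_eq_kernelEnergy hw]
  exact hC.2 _ _ (half_pos hw) (half_pos hw) _ _

/-- If `F_w ≤ D w^{κ-1}` with `0 < κ ≤ 1`, the smoothed local times converge, and their exponential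
moments are bounded by the series `Φ`; if the `F_w` are bounded, so are the local times. -/
theorem localTime_of_decay {κ D₀ : ℝ} (hκ : 0 < κ) (hκ1 : κ ≤ 1) {C : ℝ}
    (hC : ∀ n : ℕ, (n.factorial : ℝ) ^ κ * κ ^ (κ * n) ≤ C * Real.Gamma (n * κ + 1))
    (hf : IsGaussMixture f μ) (hD₀ : 0 < D₀)
    (hF₀ : ∀ w, 0 < w → ∀ x, gaussMixture d μ w x ≤ ENNReal.ofReal (D₀ * w ^ (κ - 1)))
    (hB₁ : IsBrownian B₁ P) (hB₂ : IsBrownian B₂ P)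
    (hI : IndepFun (fun (ω : Ω) (t : ℝ≥0) => B₁ t ω) (fun (ω : Ω) (t : ℝ≥0) => B₂ t ω) P)
    (ht : 0 < t)
    (hη : Measurable fun q : Set.Icc (0 : ℝ) t × Set.Icc (0 : ℝ) t => η q.1 q.2)
    (hN : weightNorm η t < ∞) :
    ConvergesInLp
      (fun ε ω => approxLocalTime f η t ε (fun r => B₁ r ω) (fun s => B₂ s ω)) P ∧
    (∀ D, 0 < D →
      (∀ w, 0 < w → ∀ x, gaussMixture d μ w x ≤ ENNReal.ofReal (D * w ^ (κ - 1))) →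
      ∀ l : ℝ, 0 < l → ∀ ε : ℝ, 0 < ε →
        Integrable (fun ω => Real.exp (l *
          approxLocalTime f η t ε (fun r => B₁ r ω) (fun s => B₂ s ω))) P ∧
        ∫ ω, Real.exp (l *
            approxLocalTime f η t ε (fun r => B₁ r ω) (fun s => B₂ s ω)) ∂P ≤
          C * Phi (l * (D * 2 ^ (κ - 1) * (weightNorm η t).toReal * Real.Gamma κ *
            κ ^ (-κ) * t ^ κ)) κ) ∧
    ∀ C' : ℝ, 0 ≤ C' → (∀ w, 0 < w → ∀ x, gaussMixture d μ w x ≤ ENNReal.ofReal C') →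
      ∀ l : ℝ, 0 < l → ∀ ε : ℝ, 0 < ε →
        Integrable (fun ω => Real.exp (l *
          approxLocalTime f η t ε (fun r => B₁ r ω) (fun s => B₂ s ω))) P ∧
        ∫ ω, Real.exp (l *
            approxLocalTime f η t ε (fun r => B₁ r ω) (fun s => B₂ s ω)) ∂P ≤
          Real.exp (l * (C' * (weightNorm η t).toReal * t)) := by
  have hΓ := Real.Gamma_pos_of_pos hκ
  obtain ⟨X, hXae, hXm, hX0, hXa, hXM, hXb⟩ := exists_version_approxLocalTime hf
    (fun ε hε => ⟨(D₀ * ε ^ (κ - 1)).toNNReal, hF₀ ε hε⟩) hB₁ hB₂ hI ht hη hN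
  have hexp : ∀ (ε : ℝ), 0 < ε → ∀ l : ℝ, (fun ω => Real.exp (l *
      approxLocalTime f η t ε (fun r => B₁ r ω) (fun s => B₂ s ω))) =ᵐ[P]
      fun ω => Real.exp (l * X ε ω) := by
    intro ε hε l
    filter_upwards [hXae ε hε] with ω hω
    rw [hω]
  refine ⟨?_, fun D hD hF l hl ε hε => ?_, fun C' hC' hF l hl ε hε => ?_⟩
  · refine ConvergesInLp.congr (convergesInLp_of_antitone
      (fun ε _ => (hXm ε).aestronglyMeasurable) hX0 (fun n => ?_) hXa) hXae
    exact ⟨_, ENNReal.ofReal_ne_top, fun ε hε => hXM D₀ κ hD₀ hκ hκ1 hF₀ ε hε n⟩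
  · rw [integrable_congr (hexp ε hε l), integral_congr_ae (hexp ε hε l)]
    set N := (weightNorm η t).toReal
    have hN0 : 0 ≤ N := ENNReal.toReal_nonneg
    obtain ⟨A, hA_def⟩ : ∃ A, A = D * 2 ^ (κ - 1) * N * Real.Gamma κ * t ^ κ := ⟨_, rfl⟩
    have hA : 0 ≤ A := by rw [hA_def]; positivity
    have hΓn : ∀ n : ℕ, 0 < Real.Gamma (n * κ + 1) := fun n =>
      Real.Gamma_pos_of_pos (by positivity)
    have hA' : D * 2 ^ (κ - 1) * N * Real.Gamma κ * κ ^ (-κ) * t ^ κ = A * κ ^ (-κ) := by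
      rw [hA_def]; ring
    rw [hA']
    have hterm : ∀ n : ℕ, l ^ n * (A ^ n / Real.Gamma (n * κ + 1)) ≤
        C * ((l * (A * κ ^ (-κ))) ^ n / (n.factorial : ℝ) ^ κ) := by
      intro n
      have hk : (κ ^ (-κ)) ^ n = (κ ^ (κ * n))⁻¹ := by
        rw [← Real.rpow_natCast, ← Real.rpow_mul hκ.le, neg_mul, Real.rpow_neg hκ.le]
      have hk0 : 0 < κ ^ (κ * n) := by positivity
      have hn0 : 0 < (n.factorial : ℝ) ^ κ := by positivity
      rw [mul_pow l, mul_pow A, hk]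
      have h1 : (Real.Gamma (n * κ + 1))⁻¹ ≤ C * ((κ ^ (κ * n))⁻¹ / (n.factorial : ℝ) ^ κ) := by
        rw [inv_le_iff_one_le_mul₀ (hΓn n)]
        rw [show C * ((κ ^ (κ * n))⁻¹ / (n.factorial : ℝ) ^ κ) * Real.Gamma (n * κ + 1) =
          C * Real.Gamma (n * κ + 1) / ((n.factorial : ℝ) ^ κ * κ ^ (κ * n)) by field_simp,
          one_le_div (by positivity)]
        exact hC n
      calc l ^ n * (A ^ n / Real.Gamma (n * κ + 1))
          = l ^ n * A ^ n * (Real.Gamma (n * κ + 1))⁻¹ := by ring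
        _ ≤ l ^ n * A ^ n * (C * ((κ ^ (κ * n))⁻¹ / (n.factorial : ℝ) ^ κ)) := by gcongr
        _ = _ := by ring
    have hs := (summable_pow_div_factorial_rpow hκ (l * (A * κ ^ (-κ)))).mul_left C
    have ha : ∀ n : ℕ, 0 ≤ A ^ n / Real.Gamma (n * κ + 1) := fun n =>
      div_nonneg (pow_nonneg hA n) (hΓn n).le
    have hs' : Summable fun n : ℕ => l ^ n * (A ^ n / Real.Gamma (n * κ + 1)) :=
      hs.of_nonneg_of_le (fun n => mul_nonneg (by positivity) (ha n)) hterm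
    obtain ⟨hint, hle⟩ := integrable_exp_of_moments (hXm ε) (hX0 ε) ha
      (fun n => (hXM D κ hD hκ hκ1 hF ε hε n).trans (le_of_eq (by rw [hA_def, mul_div_assoc])))
      hl.le hs'
    refine ⟨hint, hle.trans ?_⟩
    rw [Phi, ← tsum_mul_left]
    exact hs'.tsum_le_tsum hterm hs
  · rw [integrable_congr (hexp ε hε l), integral_congr_ae (hexp ε hε l)]
    have hle : ∀ ω, Real.exp (l * X ε ω) ≤ Real.exp (l * (C' * (weightNorm η t).toReal * t)) :=
      fun ω => Real.exp_le_exp.2 (mul_le_mul_of_nonneg_left (hXb C' ε hC' (hF ε hε) ω) hl.le)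
    have hint : Integrable (fun ω => Real.exp (l * X ε ω)) P :=
      Integrable.of_bound ((hXm ε).const_mul l).exp.aestronglyMeasurable _
        (Eventually.of_forall fun ω => by
          rw [Real.norm_of_nonneg (Real.exp_pos _).le]
          exact hle ω)
    refine ⟨hint, (integral_mono hint (integrable_const _) hle).trans (le_of_eq ?_)⟩
    simp

end Main

end LocalTime

theorem proposition4 (d : ℕ) (hd : 0 < d) (α : ℝ) (hα : 0 < α) :
    -- (i) the Riesz and Bessel kernels of order `α < d`, with `d < 2 + α`
    (α < d → (d : ℝ) < 2 + α →
      (∀ f : LocalTime.Space d → ℝ,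
        (f = LocalTime.rieszKernel d α ∨ f = LocalTime.besselKernel d α) →
          ∃ D : ℝ, LocalTime.IsDecayConst f α D) ∧
      ∃ C : ℝ, 0 < C ∧
        ∀ f : LocalTime.Space d → ℝ,
          (f = LocalTime.rieszKernel d α ∨ f = LocalTime.besselKernel d α) →
        ∀ (Ω : Type*) [MeasurableSpace Ω] (P : Measure Ω) [IsProbabilityMeasure P]
          (B₁ B₂ : ℝ≥0 → Ω → LocalTime.Space d),
          LocalTime.IsBrownian B₁ P → LocalTime.IsBrownian B₂ P →
          IndepFun (fun (ω : Ω) (t : ℝ≥0) => B₁ t ω) (fun (ω : Ω) (t : ℝ≥0) => B₂ t ω) P →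
        ∀ (t : ℝ) (η : ℝ → ℝ → ℝ≥0), 0 < t →
          Measurable (fun q : Set.Icc (0 : ℝ) t × Set.Icc (0 : ℝ) t => η q.1 q.2) →
          LocalTime.weightNorm η t < ∞ →
          LocalTime.ConvergesInLp
            (fun ε ω => LocalTime.approxLocalTime f η t ε (fun r => B₁ r ω) (fun s => B₂ s ω)) P ∧
          ∀ D : ℝ, LocalTime.IsDecayConst f α D → ∀ l : ℝ, 0 < l → ∀ ε : ℝ, 0 < ε →
            Integrable (fun ω => Real.exp (l *
              LocalTime.approxLocalTime f η t ε (fun r => B₁ r ω) (fun s => B₂ s ω))) P ∧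
            ∫ ω, Real.exp (l *
                LocalTime.approxLocalTime f η t ε (fun r => B₁ r ω) (fun s => B₂ s ω)) ∂P ≤
              C * LocalTime.Phi
                (l * LocalTime.growthConst d α D (LocalTime.weightNorm η t).toReal t)
                (1 - ((d : ℝ) - α) / 2)) ∧
    -- (ii) the heat and Poisson kernels of order `α`
    (∀ f : LocalTime.Space d → ℝ,
      (f = LocalTime.heatKernel d α ∨ f = LocalTime.poissonKernel d α) →
      (∃ C : ℝ, LocalTime.IsBoundConst f C) ∧
      ∀ (Ω : Type*) [MeasurableSpace Ω] (P : Measure Ω) [IsProbabilityMeasure P]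
        (B₁ B₂ : ℝ≥0 → Ω → LocalTime.Space d),
        LocalTime.IsBrownian B₁ P → LocalTime.IsBrownian B₂ P →
        IndepFun (fun (ω : Ω) (t : ℝ≥0) => B₁ t ω) (fun (ω : Ω) (t : ℝ≥0) => B₂ t ω) P →
      ∀ (t : ℝ) (η : ℝ → ℝ → ℝ≥0), 0 < t →
        Measurable (fun q : Set.Icc (0 : ℝ) t × Set.Icc (0 : ℝ) t => η q.1 q.2) →
        LocalTime.weightNorm η t < ∞ →
        LocalTime.ConvergesInLp
          (fun ε ω => LocalTime.approxLocalTime f η t ε (fun r => B₁ r ω) (fun s => B₂ s ω)) P ∧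
        ∀ C : ℝ, LocalTime.IsBoundConst f C → ∀ l : ℝ, 0 < l → ∀ ε : ℝ, 0 < ε →
          Integrable (fun ω => Real.exp (l *
            LocalTime.approxLocalTime f η t ε (fun r => B₁ r ω) (fun s => B₂ s ω))) P ∧
          ∫ ω, Real.exp (l *
              LocalTime.approxLocalTime f η t ε (fun r => B₁ r ω) (fun s => B₂ s ω)) ∂P ≤
            Real.exp (l * (C * (LocalTime.weightNorm η t).toReal * t))) := by
  have : NeZero d := ⟨hd.ne'⟩
  refine ⟨fun hαd hdα => ?_, fun f hf => ?_⟩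
  · have hκ : 0 < 1 - ((d : ℝ) - α) / 2 := by linarith
    have hκ1 : 1 - ((d : ℝ) - α) / 2 ≤ 1 := by linarith
    obtain ⟨C, hC0, hC⟩ := LocalTime.exists_factorial_rpow_le_Gamma hκ hκ1
    refine ⟨fun f hf => (LocalTime.exists_mixture_riesz_bessel hα hαd hf).choose_spec.2, C, hC0,
      fun f hf Ω _ P _ B₁ B₂ hB₁ hB₂ hI t η ht hη hN => ?_⟩
    obtain ⟨μ, hμ, D₀, hD₀⟩ := LocalTime.exists_mixture_riesz_bessel hα hαd hf
    have h := LocalTime.localTime_of_decay hκ hκ1 hC hμ hD₀.1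
      (fun w hw x => hμ.le_of_isDecayConst hD₀ hw x) hB₁ hB₂ hI ht hη hN
    refine ⟨h.1, fun D hD l hl ε hε => ?_⟩
    have h2 := h.2.1 D hD.1 (fun w hw x => hμ.le_of_isDecayConst hD hw x) l hl ε hε
    rwa [show 1 - ((d : ℝ) - α) / 2 - 1 = -((d : ℝ) - α) / 2 by ring] at h2
  · obtain ⟨μ, hμ, C₀, hC₀⟩ := LocalTime.exists_mixture_heat_poisson hα hf
    refine ⟨⟨C₀, hC₀⟩, fun Ω _ P _ B₁ B₂ hB₁ hB₂ hI t η ht hη hN => ?_⟩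
    obtain ⟨C, -, hC⟩ := LocalTime.exists_factorial_rpow_le_Gamma one_pos le_rfl
    have h := LocalTime.localTime_of_decay one_pos le_rfl hC hμ hC₀.1
      (fun w hw x => by simpa using hμ.le_of_isBoundConst hC₀ hw x) hB₁ hB₂ hI ht hη hN
    exact ⟨h.1, fun C' hC' => h.2.2 C' hC'.1.le fun w hw x => hμ.le_of_isBoundConst hC' hw x⟩
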